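/- **Model.** Let $(Y_i,X_i,\xi_i)_{i\ge1}$ be i.i.d. triples with $Y_i\in\mathbb R$, $X_i\in\mathbb R^p$ and $\xi_i\sim\mathrm{Unif}[0,1]$, and let $(\eta_{ij})_{i<j}$ be i.i.d. $\mathrm{Unif}[0,1]$, independent of the triples. Let $w$ be a symmetric measurable function on $[0,1]^2$ with $\int_{[0,1]^2} w=1$, and let $\rho_n>0$ with $\rho_n\to0$. The $n$-th graph on $[n]$ has the symmetric adjacency matrix $A=A^{(n)}$ with zero diagonal and $A_{ij}=\mathbf 1\{\eta_{ij}\le \rho_n w(\xi_i,\xi_j)\wedge 1\}$ for $i<j$. Put $\lambda_n=n\rho_n$ and $\hat\rho_n=\binom n2^{-1}\sum_{i<j}A_{ij}$. **Covariates.** Let $d\ge1$. Each coordinate $\widehat Z_{i,l}$, $l=1,\dots,d$, of the network covariate $\widehat Z_i\in\mathbb R^d$ is one of the following two, with the corresponding noiseless coordinate $Z_{i,l}$. (a) Local transitivity: $$\widehat Z_{i,l}=\frac{\bigl(\binom{n-1}2\hat\rho_n^3\bigr)^{-1}\,3\sum_{j<k;\,j,k\ne i}A_{ij}A_{jk}A_{ki}}{\bigl(\binom{n-1}2\hat\rho_n^2\bigr)^{-1}\sum_{j<k;\,j,k\ne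 i}(A_{ij}A_{ik}+A_{ji}A_{jk}+A_{ki}A_{kj})},$$ $$Z_{i,l}=\frac{3\,E[w(\xi_i,\xi_j)w(\xi_j,\xi_k)w(\xi_k,\xi_i)\mid\xi_i]}{E[w(\xi_i,\xi_j)w(\xi_i,\xi_k)+w(\xi_j,\xi_i)w(\xi_j,\xi_k)+w(\xi_k,\xi_i)w(\xi_k,\xi_j)\mid\xi_i]}\qquad(i,j,k\text{ distinct}).$$ (b) Neighborhood average of a coordinate $x_j$ of $X_j$: $$\widehat Z_{i,l}=\frac{\sum_{j\ne i}A_{ij}x_j}{\sum_{j\ne i}A_{ij}},\qquad Z_{i,l}=\frac{E[w(\xi_i,\xi_j)x_j\mid\xi_i]}{E[w(\xi_i,\xi_j)\mid\xi_i]}\qquad(j\neq i).$$ (Ratios with zero denominator are set to $0$.) **Estimator.** Put $L_i=(X_i,Z_i)$, $\widehat L_i=(X_i,\widehat Z_i)$, $\Lambda=E(LL^T)$, $\gamma=E(YL)$, $\beta^*=\arg\min_\beta E(Y-\beta^TL)^2$, and let $\widehat\beta^{(m)}$ be a (measurable) minimizer of $\frac1m\sum_{i=1}^m(Y_i-\widehat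 L_i^T\beta)^2$. **Proposition.** Suppose that $\Lambda$ is invertible, $E(Y^4)<\infty$, $E(\|X\|^4)<\infty$, and $0<c\le w\le C<\infty$ almost everywhere for some constants $c,C$. Let $m=m_n\to\infty$ be such that * $m^2=o(\lambda_n\wedge\lambda_n^3/n)$ if one of the coordinates is of type (a); * $m^2=o(\lambda_n)$ if one of the coordinates is of type (b). Then $Z_1,Z_2,\dots$ are i.i.d., $m=o(n)$, and there is a sequence $a_n\to0$ with $a_n=o(m^{-1/2})$ and $$\max_{1\le i\le m}\|\widehat Z_i-Z_i\|=O_P(a_n).$$ Moreover $$m^{1/2}\bigl(\widehat\beta^{(m)}-\beta^*\bigr)\to N(0,\Sigma_\beta)\quad\text{in distribution},\qquad \Sigma_\beta=D_f(\Lambda,\gamma)\,\operatorname{var}(\psi)\,D_f(\Lambda,\gamma)^T,$$ where $\psi=(\operatorname{vec}(LL^T),LY)$ and $D_f$ is the Jacobian of $f(M,b)=M^{-1}b$. -/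

import Mathlib

open MeasureTheory ProbabilityTheory Filter Asymptotics
open scoped Topology Matrix NNReal

noncomputable section

namespace NetworkRegression

/-! ### Finite-sample network statistics -/

/-- Empirical edge density of the graph on the nodes `0, …, n - 1` with adjacency matrix `A`. -/
def edgeDensity (n : ℕ) (A : ℕ → ℕ → ℝ) : ℝ :=
  ((n.choose 2 : ℕ) : ℝ)⁻¹ * ∑ j ∈ Finset.range n, ∑ i ∈ Finset.range j, A i j

/-- Sum of `F j k` over all pairs of nodes `j < k < n` that are both different from `i`. -/
def pairSum (n i : ℕ) (F : ℕ → ℕ → ℝ) : ℝ :=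
  ∑ k ∈ (Finset.range n).erase i, ∑ j ∈ (Finset.range k).erase i, F j k

/-- Local transitivity of node `i`: the ratio of the normalized (rooted at `i`) triangle and
two-star frequencies. -/
def localTransitivity (n : ℕ) (A : ℕ → ℕ → ℝ) (i : ℕ) : ℝ :=
  ((((n - 1).choose 2 : ℕ) : ℝ) * edgeDensity n A ^ 3)⁻¹ *
      (3 * pairSum n i fun j k => A i j * A j k * A k i) /
    (((((n - 1).choose 2 : ℕ) : ℝ) * edgeDensity n A ^ 2)⁻¹ *
      pairSum n i fun j k => A i j * A i k + A j i * A j k + A k i * A k j)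

/-- Average of `x j` over the neighbors `j` of node `i`. -/
def neighborhoodAverage (n : ℕ) (A : ℕ → ℕ → ℝ) (x : ℕ → ℝ) (i : ℕ) : ℝ :=
  (∑ j ∈ (Finset.range n).erase i, A i j * x j) / ∑ j ∈ (Finset.range n).erase i, A i j

/-- The two kinds of network covariate: local transitivity, and the neighborhood average of the
`k`-th coordinate of the nodal covariate `X`. -/
inductive CompositeCovariate (p : ℕ) where
  | transitivity : CompositeCovariate p
  | neighborAverage (k : Fin p) : CompositeCovariate p

/-! ### The model -/

/-- Independent triples `(Y i, X i, ξ i)` with uniform latent positions `ξ i`, and independent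
uniform edge variables `η i j`, `i < j`, that are independent of the triples, together with a
symmetric graphon `w` of total mass one and sparsity parameters `ρ n → 0`. -/
structure SparseGraphonModel {Ω : Type*} [MeasurableSpace Ω] (P : Measure Ω) (p : ℕ) where
  Y : ℕ → Ω → ℝ
  X : ℕ → Ω → EuclideanSpace ℝ (Fin p)
  ξ : ℕ → Ω → unitInterval
  η : ℕ → ℕ → Ω → unitInterval
  w : unitInterval → unitInterval → ℝ
  ρ : ℕ → ℝ
  measurable_Y : ∀ i, Measurable (Y i)
  measurable_X : ∀ i, Measurable (X i)
  measurable_ξ : ∀ i, Measurable (ξ i)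
  measurable_η : ∀ i j, Measurable (η i j)
  iIndepFun_triple : iIndepFun (fun i ω => (Y i ω, X i ω, ξ i ω)) P
  identDistrib_triple : ∀ i,
    IdentDistrib (fun ω => (Y i ω, X i ω, ξ i ω)) (fun ω => (Y 0 ω, X 0 ω, ξ 0 ω)) P P
  map_ξ : ∀ i, P.map (ξ i) = volume
  map_η : ∀ i j, i < j → P.map (η i j) = volume
  iIndepFun_η : iIndepFun (fun e : {e : ℕ × ℕ // e.1 < e.2} => η e.1.1 e.1.2) P
  indepFun_triple_η : IndepFun (fun ω (i : ℕ) => (Y i ω, X i ω, ξ i ω))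
    (fun ω (e : {e : ℕ × ℕ // e.1 < e.2}) => η e.1.1 e.1.2 ω) P
  measurable_w : Measurable (Function.uncurry w)
  w_symm : ∀ x y, w x y = w y x
  integral_w : ∫ x, ∫ y, w x y = 1
  ρ_pos : ∀ n, 0 < ρ n
  ρ_tendsto : Tendsto ρ atTop (𝓝 0)

namespace SparseGraphonModel

variable {Ω : Type*} [MeasurableSpace Ω] {P : Measure Ω} {p d : ℕ}

/-- Indicator of an edge between `i < j` in the graph with sparsity parameter `ρ n`. -/
def edge (M : SparseGraphonModel P p) (n i j : ℕ) (ω : Ω) : ℝ :=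
  if (M.η i j ω : ℝ) ≤ min (M.ρ n * M.w (M.ξ i ω) (M.ξ j ω)) 1 then 1 else 0

/-- The symmetric adjacency matrix, without self-loops, of the `n`-th graph. -/
def adj (M : SparseGraphonModel P p) (n : ℕ) (ω : Ω) (i j : ℕ) : ℝ :=
  if i < j then M.edge n i j ω else if j < i then M.edge n j i ω else 0

/-- The average degree parameter `λ_n = n ρ_n`. -/
def lam (M : SparseGraphonModel P p) (n : ℕ) : ℝ := n * M.ρ n

/-- Observed network covariate of node `i` in the `n`-th graph. -/
def covariateHat (M : SparseGraphonModel P p) (n i : ℕ) (ω : Ω) : CompositeCovariate p → ℝ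
  | .transitivity => localTransitivity n (M.adj n ω) i
  | .neighborAverage k => neighborhoodAverage n (M.adj n ω) (fun j => M.X j ω k) i

/-- Noiseless network covariate at latent position `x`: the ratio of the conditional expectations,
given that the root has latent position `x`, of the latent numerator and denominator
statistics. -/
def latentCovariate (M : SparseGraphonModel P p) (x : unitInterval) : CompositeCovariate p → ℝ
  | .transitivity =>
      (3 * ∫ y, ∫ z, M.w x y * M.w y z * M.w z x) /
        ∫ y, ∫ z, (M.w x y * M.w x z + M.w y x * M.w y z + M.w z x * M.w z y)
  | .neighborAverage k =>
      (∫ ω, M.w x (M.ξ 0 ω) * M.X 0 ω k ∂P) / ∫ ω, M.w x (M.ξ 0 ω) ∂P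

/-- The vector of observed network covariates of node `i` in the `n`-th graph. -/
def Zhat (M : SparseGraphonModel P p) (kind : Fin d → CompositeCovariate p) (n i : ℕ) (ω : Ω) :
    EuclideanSpace ℝ (Fin d) :=
  WithLp.toLp 2 fun j => M.covariateHat n i ω (kind j)

/-- The vector of noiseless network covariates of node `i`. -/
def Z (M : SparseGraphonModel P p) (kind : Fin d → CompositeCovariate p) (i : ℕ) (ω : Ω) :
    EuclideanSpace ℝ (Fin d) :=
  WithLp.toLp 2 fun j => M.latentCovariate (M.ξ i ω) (kind j)

/-- The observed design vector `(X_i, Ẑ_i)`. -/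
def Lhat (M : SparseGraphonModel P p) (kind : Fin d → CompositeCovariate p) (n i : ℕ) (ω : Ω) :
    EuclideanSpace ℝ (Fin p ⊕ Fin d) :=
  WithLp.toLp 2 (Sum.elim (fun k => M.X i ω k) fun j => M.Zhat kind n i ω j)

/-- The noiseless design vector `(X_i, Z_i)`. -/
def L (M : SparseGraphonModel P p) (kind : Fin d → CompositeCovariate p) (i : ℕ) (ω : Ω) :
    EuclideanSpace ℝ (Fin p ⊕ Fin d) :=
  WithLp.toLp 2 (Sum.elim (fun k => M.X i ω k) fun j => M.Z kind i ω j)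

/-- `Λ = E[L Lᵀ]`. -/
def Lambda (M : SparseGraphonModel P p) (kind : Fin d → CompositeCovariate p) :
    Matrix (Fin p ⊕ Fin d) (Fin p ⊕ Fin d) ℝ :=
  Matrix.of fun a b => ∫ ω, M.L kind 0 ω a * M.L kind 0 ω b ∂P

/-- Mean squared error `E[(Y - bᵀ L)²]` of a linear predictor. -/
def populationRisk (M : SparseGraphonModel P p) (kind : Fin d → CompositeCovariate p)
    (b : EuclideanSpace ℝ (Fin p ⊕ Fin d)) : ℝ :=
  ∫ ω, (M.Y 0 ω - inner ℝ b (M.L kind 0 ω)) ^ 2 ∂P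

/-- Least squares criterion based on the first `m` nodes, whose network covariates are computed
from the whole `n`-th graph. -/
def downSampleRisk (M : SparseGraphonModel P p) (kind : Fin d → CompositeCovariate p) (n m : ℕ)
    (ω : Ω) (b : EuclideanSpace ℝ (Fin p ⊕ Fin d)) : ℝ :=
  (m : ℝ)⁻¹ * ∑ i ∈ Finset.range m, (M.Y i ω - inner ℝ b (M.Lhat kind n i ω)) ^ 2

/-- `max_{i < m} ‖Ẑ_i - Z_i‖` in the `n`-th graph. -/
def maxNoise (M : SparseGraphonModel P p) (kind : Fin d → CompositeCovariate p) (n m : ℕ)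
    (ω : Ω) : ℝ :=
  ((Finset.range m).sup fun i => ‖M.Zhat kind n i ω - M.Z kind i ω‖₊ : ℝ≥0)

/-- The vector `ψ = (vec (L Lᵀ), L Y)`. -/
def psi (M : SparseGraphonModel P p) (kind : Fin d → CompositeCovariate p) (ω : Ω) :
    ((Fin p ⊕ Fin d) × (Fin p ⊕ Fin d)) ⊕ (Fin p ⊕ Fin d) → ℝ :=
  Sum.elim (fun ab => M.L kind 0 ω ab.1 * M.L kind 0 ω ab.2) fun a => M.L kind 0 ω a * M.Y 0 ω

/-- Covariance matrix of `ψ`. -/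
def SigmaPsi (M : SparseGraphonModel P p) (kind : Fin d → CompositeCovariate p) :
    Matrix (((Fin p ⊕ Fin d) × (Fin p ⊕ Fin d)) ⊕ (Fin p ⊕ Fin d))
      (((Fin p ⊕ Fin d) × (Fin p ⊕ Fin d)) ⊕ (Fin p ⊕ Fin d)) ℝ :=
  Matrix.of fun a b => cov[fun ω => M.psi kind ω a, fun ω => M.psi kind ω b; P]

end SparseGraphonModel

/-- The ordinary least squares functional `(vec M, b) ↦ M⁻¹ b`. -/
def olsFunctional (ι : Type*) [Fintype ι] [DecidableEq ι] (v : (ι × ι) ⊕ ι → ℝ) : ι → ℝ :=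
  (Matrix.of fun a b => v (Sum.inl (a, b)))⁻¹ *ᵥ fun a => v (Sum.inr a)

namespace SparseGraphonModel

variable {Ω : Type*} [MeasurableSpace Ω] {P : Measure Ω} {p d : ℕ}

/-- Jacobian matrix of the least squares functional at `(Λ, γ) = E[ψ]`. -/
def olsJacobian (M : SparseGraphonModel P p) (kind : Fin d → CompositeCovariate p) :
    Matrix (Fin p ⊕ Fin d) (((Fin p ⊕ Fin d) × (Fin p ⊕ Fin d)) ⊕ (Fin p ⊕ Fin d)) ℝ :=
  LinearMap.toMatrix'
    (fderiv ℝ (olsFunctional (Fin p ⊕ Fin d)) fun a => ∫ ω, M.psi kind ω a ∂P).toLinearMap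

/-- Asymptotic covariance matrix `D Σ_ψ Dᵀ` of the down-sampled estimator. -/
def SigmaBeta (M : SparseGraphonModel P p) (kind : Fin d → CompositeCovariate p) :
    Matrix (Fin p ⊕ Fin d) (Fin p ⊕ Fin d) ℝ :=
  M.olsJacobian kind * M.SigmaPsi kind * (M.olsJacobian kind)ᵀ

/-- Restriction on the down-sample size that goes with a network covariate. -/
def SizeCondition (M : SparseGraphonModel P p) (m : ℕ → ℕ) : CompositeCovariate p → Prop
  | .transitivity =>
      (fun n => (m n : ℝ) ^ 2) =o[atTop] fun n => min (M.lam n) (M.lam n ^ 3 / n)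
  | .neighborAverage _ => (fun n => (m n : ℝ) ^ 2) =o[atTop] M.lam

end SparseGraphonModel

/-- `U n = O_P(a n)`. -/
def IsBigOInProbability {Ω : Type*} [MeasurableSpace Ω] (P : Measure Ω) (U : ℕ → Ω → ℝ)
    (a : ℕ → ℝ) : Prop :=
  ∀ ε : ℝ, 0 < ε → ∃ K : ℝ, ∀ᶠ n in atTop, P {ω | K * a n < |U n ω|} ≤ ENNReal.ofReal ε

end NetworkRegression

end

/-!
# Asymptotic normality of down-sampled least squares with network covariates

Every network covariate is a ratio of subgraph statistics rooted at the node in question: counts of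
triangles and two-stars, or degrees weighted by a nodal covariate. Given the latent position of the
root, such a statistic concentrates around `ρ` to the number of edges times the corresponding
integral of `w`. Its deviation is a sum of conditionally centred terms, and terms that share no
source of randomness besides the root are conditionally uncorrelated
(`integral_centered_mul_eq_zero`), so only overlapping subgraphs contribute to the variance. As
`w ≤ C`, an edge forces its own uniform edge variable below `ρ C`, which bounds the probability of
`t` distinct edges by `(ρ C) ^ t`. This gives `integral_sq_sum_triadDev_le` and
`integral_sq_sum_nbrDev_le`. Since `w ≥ c > 0`, the denominators stay away from zero, and
Chebyshev's inequality yields tail bounds of order `1 / λ + n / λ ^ 3` or `1 / λ` for a single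
covariate, uniformly over the nodes (`exists_tail_covariate`). The size condition is exactly what
makes a union bound over `m` nodes negligible compared to `m ^ (-1 / 2)` (`exists_rate_maxNoise`).

The noiseless covariates are a function of the latent position, hence i.i.d. and almost surely
bounded, so that the vector `ψ` of second moments is square integrable. By the normal equations both
the estimator and its target are values of the least squares functional, at the empirical second
moments of the observed design and at the true ones. Replacing observed by noiseless covariates
moves the empirical second moments by `o_P (m ^ (-1 / 2))`
(`tendsto_sqrt_mul_norm_momentVector_sub`), the multivariate central limit theorem applies to the
averages of `ψ` (`tendstoInDistribution_mulVec`), and the delta method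
(`tendstoInDistribution_sqrt_smul_sub`) gives the claim.
-/

noncomputable section

namespace NetworkRegression

namespace SparseGraphonModel

/-! ### Independence of the sources of randomness -/

section

variable {Ω : Type*} [MeasurableSpace Ω] {P : Measure Ω} {p d : ℕ}

/-- The sources of randomness: one for each node and one for each unordered pair of nodes. -/
abbrev Source : Type := ℕ ⊕ {e : ℕ × ℕ // e.1 < e.2}

/-- The triple `(Y i, X i, ξ i)` of node `i`. -/
def triple (M : SparseGraphonModel P p) (i : ℕ) (ω : Ω) :
    ℝ × EuclideanSpace ℝ (Fin p) × unitInterval :=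
  (M.Y i ω, M.X i ω, M.ξ i ω)

/-- The edge variable of a pair of nodes. -/
def edgeVar (M : SparseGraphonModel P p) (e : {e : ℕ × ℕ // e.1 < e.2}) (ω : Ω) : unitInterval :=
  M.η e.1.1 e.1.2 ω

lemma measurable_triple (M : SparseGraphonModel P p) (i : ℕ) : Measurable (M.triple i) :=
  (M.measurable_Y i).prodMk ((M.measurable_X i).prodMk (M.measurable_ξ i))

lemma measurable_edgeVar (M : SparseGraphonModel P p) (e : {e : ℕ × ℕ // e.1 < e.2}) :
    Measurable (M.edgeVar e) :=
  M.measurable_η _ _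

/-- The σ-algebra generated by one source of randomness. -/
abbrev sourceAlgebra (M : SparseGraphonModel P p) : Source → MeasurableSpace Ω
  | .inl i => MeasurableSpace.comap (M.triple i) inferInstance
  | .inr e => MeasurableSpace.comap (M.edgeVar e) inferInstance

lemma sourceAlgebra_le (M : SparseGraphonModel P p) (s : Source) :
    M.sourceAlgebra s ≤ ‹MeasurableSpace Ω› := by
  cases s with
  | inl i => exact (M.measurable_triple i).comap_le
  | inr e => exact (M.measurable_edgeVar e).comap_le

lemma iIndep_sourceAlgebra (M : SparseGraphonModel P p) : iIndep M.sourceAlgebra P := by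
  rw [iIndep_iff]
  intro s f hf
  have hs : s = s.toLeft.disjSum s.toRight := (Finset.toLeft_disjSum_toRight).symm
  have hl : ∀ i ∈ s.toLeft, MeasurableSet[MeasurableSpace.comap (M.triple i) inferInstance]
      (f (.inl i)) := fun i hi => hf (.inl i) (by simpa using hi)
  have hr : ∀ e ∈ s.toRight, MeasurableSet[MeasurableSpace.comap (M.edgeVar e) inferInstance]
      (f (.inr e)) := fun i hi => hf (.inr i) (by simpa using hi)
  have hset : (⋂ i ∈ s, f i) = (⋂ i ∈ s.toLeft, f (.inl i)) ∩ ⋂ e ∈ s.toRight, f (.inr e) := by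
    ext ω
    simp only [Set.mem_iInter, Set.mem_inter_iff, Finset.mem_toLeft, Finset.mem_toRight]
    exact ⟨fun h => ⟨fun i hi => h _ hi, fun e he => h _ he⟩, fun h i hi => by
      cases i with
      | inl i => exact h.1 i hi
      | inr e => exact h.2 e hi⟩
  have hprod : ∏ i ∈ s, P (f i) =
      (∏ i ∈ s.toLeft, P (f (.inl i))) * ∏ e ∈ s.toRight, P (f (.inr e)) := by
    conv_lhs => rw [hs]
    rw [Finset.prod_disjSum]
  rw [hset, hprod]
  have hind := (IndepFun_iff_Indep _ _ _).1 M.indepFun_triple_η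
  rw [(Indep_iff _ _ _).1 hind _ _ _ _]
  · congr 1
    · exact ((iIndepFun_iff_iIndep _ _ _).1 M.iIndepFun_triple).meas_biInter hl
    · exact ((iIndepFun_iff_iIndep _ _ _).1 M.iIndepFun_η).meas_biInter hr
  · refine Finset.measurableSet_biInter _ fun i hi => ?_
    obtain ⟨t, ht, hft⟩ := hl i hi
    exact ⟨(fun x => x i) ⁻¹' t, measurable_pi_apply i ht, hft⟩
  · refine Finset.measurableSet_biInter _ fun e he => ?_
    obtain ⟨t, ht, hft⟩ := hr e he
    exact ⟨(fun x => x e) ⁻¹' t, measurable_pi_apply e ht, hft⟩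

/-- The σ-algebra generated by a set of sources. -/
abbrev sigmaOf (M : SparseGraphonModel P p) (S : Set Source) : MeasurableSpace Ω :=
  ⨆ s ∈ S, M.sourceAlgebra s

/-- Functions of disjoint sets of sources are independent. -/
lemma indepFun_of_disjoint (M : SparseGraphonModel P p) {S T : Set Source} (hST : Disjoint S T)
    {β γ : Type*} [MeasurableSpace β] [MeasurableSpace γ] {f : Ω → β} {g : Ω → γ}
    (hf : Measurable[M.sigmaOf S] f) (hg : Measurable[M.sigmaOf T] g) : IndepFun f g P := by
  rw [IndepFun_iff_Indep]
  exact indep_of_indep_of_le (indep_iSup_of_disjoint M.sourceAlgebra_le M.iIndep_sourceAlgebra hST)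
    hf.comap_le hg.comap_le

lemma measurable_triple_sigmaOf (M : SparseGraphonModel P p) {S : Set Source} {i : ℕ}
    (hi : Sum.inl i ∈ S) : Measurable[M.sigmaOf S] (M.triple i) :=
  measurable_iff_comap_le.2 (le_biSup M.sourceAlgebra hi)

lemma measurable_ξ_sigmaOf (M : SparseGraphonModel P p) {S : Set Source} {i : ℕ}
    (hi : Sum.inl i ∈ S) : Measurable[M.sigmaOf S] (M.ξ i) :=
  (measurable_snd.comp measurable_snd).comp (M.measurable_triple_sigmaOf hi)

lemma measurable_X_sigmaOf (M : SparseGraphonModel P p) {S : Set Source} {i : ℕ}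
    (hi : Sum.inl i ∈ S) : Measurable[M.sigmaOf S] (M.X i) :=
  (measurable_fst.comp measurable_snd).comp (M.measurable_triple_sigmaOf hi)

lemma measurable_edgeVar_sigmaOf (M : SparseGraphonModel P p) {S : Set Source}
    {e : {e : ℕ × ℕ // e.1 < e.2}} (he : Sum.inr e ∈ S) : Measurable[M.sigmaOf S] (M.edgeVar e) :=
  measurable_iff_comap_le.2 (le_biSup M.sourceAlgebra he)

lemma map_edgeVar (M : SparseGraphonModel P p) (e : {e : ℕ × ℕ // e.1 < e.2}) :
    P.map (M.edgeVar e) = volume :=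
  M.map_η _ _ e.2

/-- The unordered pair `{i, j}`, encoded as an increasing pair; the value at `i = j` is
arbitrary. -/
def pairIdx (i j : ℕ) : {e : ℕ × ℕ // e.1 < e.2} :=
  if h : i < j then ⟨(i, j), h⟩ else if h : j < i then ⟨(j, i), h⟩ else ⟨(0, 1), zero_lt_one⟩

lemma pairIdx_eq_iff {i j k l : ℕ} (hij : i ≠ j) (hkl : k ≠ l) :
    pairIdx i j = pairIdx k l ↔ (i = k ∧ j = l) ∨ (i = l ∧ j = k) := by
  unfold pairIdx
  rcases hij.lt_or_gt with h | h <;> rcases hkl.lt_or_gt with h' | h' <;>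
    simp only [h, h', h.not_gt, h'.not_gt, dif_pos, dif_neg, not_false_eq_true, Subtype.mk.injEq,
      Prod.mk.injEq] <;> omega

/-- The indicator of an edge as a function of two latent positions and of an edge variable. -/
def edgeFn (M : SparseGraphonModel P p) (n : ℕ) (x y u : unitInterval) : ℝ :=
  if (u : ℝ) ≤ min (M.ρ n * M.w x y) 1 then 1 else 0

lemma measurable_edgeFn (M : SparseGraphonModel P p) (n : ℕ) :
    Measurable fun z : unitInterval × unitInterval × unitInterval =>
      M.edgeFn n z.1 z.2.1 z.2.2 := by
  have hw : Measurable fun z : unitInterval × unitInterval × unitInterval => M.w z.1 z.2.1 :=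
    M.measurable_w.comp (measurable_fst.prodMk (measurable_fst.comp measurable_snd))
  refine Measurable.ite (measurableSet_le ?_ ?_) measurable_const measurable_const
  · exact measurable_subtype_coe.comp (measurable_snd.comp measurable_snd)
  · exact (hw.const_mul _).min measurable_const

lemma edgeFn_nonneg (M : SparseGraphonModel P p) (n : ℕ) (x y u : unitInterval) :
    0 ≤ M.edgeFn n x y u := by
  unfold edgeFn; split_ifs <;> norm_num

lemma edgeFn_le_one (M : SparseGraphonModel P p) (n : ℕ) (x y u : unitInterval) :
    M.edgeFn n x y u ≤ 1 := by
  unfold edgeFn; split_ifs <;> norm_num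

lemma adj_eq_edgeFn (M : SparseGraphonModel P p) (n : ℕ) {i j : ℕ} (hij : i ≠ j) (ω : Ω) :
    M.adj n ω i j = M.edgeFn n (M.ξ i ω) (M.ξ j ω) (M.edgeVar (pairIdx i j) ω) := by
  unfold adj edge edgeFn edgeVar pairIdx
  rcases hij.lt_or_gt with h | h
  · simp [h]
  · simp [h, h.not_gt, M.w_symm (M.ξ i ω) (M.ξ j ω)]

lemma adj_comm (M : SparseGraphonModel P p) (n : ℕ) (i j : ℕ) (ω : Ω) :
    M.adj n ω i j = M.adj n ω j i := by
  unfold adj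
  rcases lt_trichotomy i j with h | rfl | h
  · simp [h, h.not_gt]
  · rfl
  · simp [h, h.not_gt]

lemma measurable_adj (M : SparseGraphonModel P p) (n i j : ℕ) :
    Measurable fun ω => M.adj n ω i j := by
  rcases eq_or_ne i j with rfl | hij
  · simp [adj]
  · simp_rw [M.adj_eq_edgeFn n hij]
    exact (M.measurable_edgeFn n).comp
      ((M.measurable_ξ i).prodMk ((M.measurable_ξ j).prodMk (M.measurable_edgeVar _)))

lemma adj_nonneg (M : SparseGraphonModel P p) (n i j : ℕ) (ω : Ω) : 0 ≤ M.adj n ω i j := by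
  rcases eq_or_ne i j with rfl | hij
  · simp [adj]
  · rw [M.adj_eq_edgeFn n hij]; exact M.edgeFn_nonneg _ _ _ _

lemma adj_le_one (M : SparseGraphonModel P p) (n i j : ℕ) (ω : Ω) : M.adj n ω i j ≤ 1 := by
  rcases eq_or_ne i j with rfl | hij
  · simp [adj]
  · rw [M.adj_eq_edgeFn n hij]; exact M.edgeFn_le_one _ _ _ _

lemma volume_coe_le {b : ℝ} (hb : 0 ≤ b) (hb1 : b ≤ 1) :
    (volume : Measure unitInterval) {u | (u : ℝ) ≤ b} = ENNReal.ofReal b := by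
  have := unitInterval.volume_Iic (⟨b, hb, hb1⟩ : unitInterval)
  simpa [Set.Iic, ← Subtype.coe_le_coe] using this

lemma integral_edgeFn (M : SparseGraphonModel P p) (n : ℕ) {x y : unitInterval}
    (h0 : 0 ≤ M.ρ n * M.w x y) (h1 : M.ρ n * M.w x y ≤ 1) :
    ∫ u, M.edgeFn n x y u = M.ρ n * M.w x y := by
  have : (fun u => M.edgeFn n x y u) =
      Set.indicator {u : unitInterval | (u : ℝ) ≤ M.ρ n * M.w x y} (fun _ => (1 : ℝ)) := by
    ext u
    simp [edgeFn, Set.indicator_apply, min_eq_left h1]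
  rw [this, integral_indicator_const _ (measurableSet_le measurable_subtype_coe measurable_const),
    measureReal_def, volume_coe_le h0 h1, ENNReal.toReal_ofReal h0, smul_eq_mul, mul_one]

lemma w_bounds_ξ [IsProbabilityMeasure P] (M : SparseGraphonModel P p) {c C : ℝ}
    (hw : ∀ᵐ z ∂(volume : Measure (unitInterval × unitInterval)),
      c ≤ M.w z.1 z.2 ∧ M.w z.1 z.2 ≤ C) {i j : ℕ} (hij : i ≠ j) :
    ∀ᵐ ω ∂P, c ≤ M.w (M.ξ i ω) (M.ξ j ω) ∧ M.w (M.ξ i ω) (M.ξ j ω) ≤ C := by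
  have hind : IndepFun (M.ξ i) (M.ξ j) P := by
    refine M.indepFun_of_disjoint (S := {Sum.inl i}) (T := {Sum.inl j}) (by simpa using hij)
      (M.measurable_ξ_sigmaOf (by simp)) (M.measurable_ξ_sigmaOf (by simp))
  have hmap := (indepFun_iff_map_prod_eq_prod_map_map (M.measurable_ξ i).aemeasurable
    (M.measurable_ξ j).aemeasurable).1 hind
  rw [M.map_ξ, M.map_ξ] at hmap
  refine ae_of_ae_map ((M.measurable_ξ i).prodMk (M.measurable_ξ j)).aemeasurable
    (p := fun z : unitInterval × unitInterval => c ≤ M.w z.1 z.2 ∧ M.w z.1 z.2 ≤ C) ?_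
  rw [hmap]
  exact hw

end

/-! ### Second moments of conditionally centred sums -/

section SecondMoment

variable {Ω : Type*} [MeasurableSpace Ω] {P : Measure Ω}

/-- If `X`, `U`, `V` are independent and `U`, `V` have law `ν`, then `Φ X U` and `Φ X V` are
conditionally uncorrelated given `X`. No integrability is needed, because a non-integrable
section of `Φ` has integral `0` both before and after centring. -/
lemma integral_centered_mul_eq_zero [IsProbabilityMeasure P] {α β : Type*} [MeasurableSpace α]
    [MeasurableSpace β]
    {X : Ω → α} {U V : Ω → β} (hX : Measurable X) (hU : Measurable U) (hV : Measurable V)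
    {ν : Measure β} [IsProbabilityMeasure ν] (hνU : P.map U = ν) (hνV : P.map V = ν)
    (hUV : IndepFun U V P) (hXUV : IndepFun X (fun ω => (U ω, V ω)) P) {Φ : α → β → ℝ}
    (hΦ : Measurable (Function.uncurry Φ)) :
    ∫ ω, (Φ (X ω) (U ω) - ∫ u, Φ (X ω) u ∂ν) * (Φ (X ω) (V ω) - ∫ u, Φ (X ω) u ∂ν) ∂P = 0 := by
  have hmap : P.map (fun ω => (X ω, (U ω, V ω))) = (P.map X).prod (ν.prod ν) := by
    rw [(indepFun_iff_map_prod_eq_prod_map_map hX.aemeasurable (hU.prodMk hV).aemeasurable).1 hXUV,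
      (indepFun_iff_map_prod_eq_prod_map_map hU.aemeasurable hV.aemeasurable).1 hUV, hνU, hνV]
  have hμ : Measurable fun x => ∫ u, Φ x u ∂ν :=
    (hΦ.stronglyMeasurable.integral_prod_right (ν := ν)).measurable
  have hD : Measurable fun z : α × β => Φ z.1 z.2 - ∫ u, Φ z.1 u ∂ν :=
    hΦ.sub (hμ.comp measurable_fst)
  have hG : Measurable fun z : α × β × β =>
      (Φ z.1 z.2.1 - ∫ u, Φ z.1 u ∂ν) * (Φ z.1 z.2.2 - ∫ u, Φ z.1 u ∂ν) :=
    (hD.comp (measurable_fst.prodMk (measurable_fst.comp measurable_snd))).mul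
      (hD.comp (measurable_fst.prodMk (measurable_snd.comp measurable_snd)))
  have hXprob : IsProbabilityMeasure (P.map X) := Measure.isProbabilityMeasure_map hX.aemeasurable
  have hzero : ∀ x, ∫ u, (Φ x u - ∫ u, Φ x u ∂ν) ∂ν = 0 := by
    intro x
    by_cases hx : Integrable (Φ x) ν
    · rw [integral_sub hx (integrable_const _)]
      simp
    · simp [integral_undef hx]
  have hrw : ∫ ω, (Φ (X ω) (U ω) - ∫ u, Φ (X ω) u ∂ν) * (Φ (X ω) (V ω) - ∫ u, Φ (X ω) u ∂ν) ∂P =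
      ∫ z, (Φ z.1 z.2.1 - ∫ u, Φ z.1 u ∂ν) * (Φ z.1 z.2.2 - ∫ u, Φ z.1 u ∂ν)
        ∂((P.map X).prod (ν.prod ν)) := by
    rw [← hmap, integral_map (hX.prodMk (hU.prodMk hV)).aemeasurable hG.aestronglyMeasurable]
  rw [hrw]
  by_cases hint : Integrable (fun z : α × β × β =>
      (Φ z.1 z.2.1 - ∫ u, Φ z.1 u ∂ν) * (Φ z.1 z.2.2 - ∫ u, Φ z.1 u ∂ν))
      ((P.map X).prod (ν.prod ν))
  · rw [integral_prod _ hint]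
    refine (integral_congr_ae (Eventually.of_forall fun x => ?_)).trans (integral_zero _ _)
    exact (integral_prod_mul (fun u => Φ x u - ∫ u, Φ x u ∂ν)
      (fun u => Φ x u - ∫ u, Φ x u ∂ν)).trans (by simp [hzero])
  · exact integral_undef hint

lemma integral_sq_sum_le {E : Type*} (s : Finset E) {D : E → Ω → ℝ}
    (hD : ∀ e ∈ s, MemLp (D e) 2 P) {B : E → E → ℝ}
    (hB : ∀ e ∈ s, ∀ e' ∈ s, ∫ ω, D e ω * D e' ω ∂P ≤ B e e') :
    ∫ ω, (∑ e ∈ s, D e ω) ^ 2 ∂P ≤ ∑ e ∈ s, ∑ e' ∈ s, B e e' := by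
  have hint : ∀ e ∈ s, ∀ e' ∈ s, Integrable (fun ω => D e ω * D e' ω) P :=
    fun e he e' he' => (hD e he).integrable_mul (hD e' he')
  simp_rw [sq, Finset.sum_mul_sum]
  rw [integral_finsetSum _ fun e he => integrable_finsetSum _ fun e' he' => hint e he e' he']
  refine Finset.sum_le_sum fun e he => ?_
  rw [integral_finsetSum _ fun e' he' => hint e he e' he']
  exact Finset.sum_le_sum fun e' he' => hB e he e' he'

end SecondMoment

/-! ### Rooted subgraph counts -/

section

variable {Ω : Type*} [MeasurableSpace Ω] {P : Measure Ω} {p d : ℕ}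

/-- The product of those of the numbers `a`, `b`, `c` that the mask `q` selects. With the edge
indicators of a triangle in place of `a`, `b`, `c`, it is the indicator of a subgraph of the
triangle. -/
def triad (q : Bool × Bool × Bool) (a b c : ℝ) : ℝ :=
  (if q.1 then a else 1) * (if q.2.1 then b else 1) * (if q.2.2 then c else 1)

/-- The number of edges that a mask selects. -/
def triadSize (q : Bool × Bool × Bool) : ℕ :=
  (if q.1 then 1 else 0) + (if q.2.1 then 1 else 0) + (if q.2.2 then 1 else 0)

/-- The selected edges of the triangle on the nodes `i`, `j`, `k`. -/
def triadEdges (q : Bool × Bool × Bool) (i j k : ℕ) : Finset {e : ℕ × ℕ // e.1 < e.2} :=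
  ((if q.1 then {pairIdx i j} else ∅) ∪ (if q.2.1 then {pairIdx j k} else ∅)) ∪
    (if q.2.2 then {pairIdx k i} else ∅)

lemma mem_triadEdges {q : Bool × Bool × Bool} {i j k : ℕ} {e : {e : ℕ × ℕ // e.1 < e.2}} :
    e ∈ triadEdges q i j k ↔ (q.1 = true ∧ e = pairIdx i j) ∨ (q.2.1 = true ∧ e = pairIdx j k) ∨
      (q.2.2 = true ∧ e = pairIdx k i) := by
  obtain ⟨q1, q2, q3⟩ := q
  cases q1 <;> cases q2 <;> cases q3 <;> simp [triadEdges]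

lemma endpoints_of_mem_triadEdges {q : Bool × Bool × Bool} {i j k : ℕ} (hij : i ≠ j) (hjk : j ≠ k)
    (hki : k ≠ i) {e : {e : ℕ × ℕ // e.1 < e.2}} (he : e ∈ triadEdges q i j k) :
    (e.1.1 = i ∨ e.1.1 = j ∨ e.1.1 = k) ∧ (e.1.2 = i ∨ e.1.2 = j ∨ e.1.2 = k) := by
  have key : ∀ a b : ℕ, a ≠ b →
      ((pairIdx a b).1.1 = a ∨ (pairIdx a b).1.1 = b) ∧
        ((pairIdx a b).1.2 = a ∨ (pairIdx a b).1.2 = b) := by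
    intro a b hab
    unfold pairIdx
    rcases hab.lt_or_gt with h | h <;> simp [h, h.not_gt]
  rcases mem_triadEdges.1 he with ⟨-, rfl⟩ | ⟨-, rfl⟩ | ⟨-, rfl⟩
  · have := key i j hij; tauto
  · have := key j k hjk; tauto
  · have := key k i hki; tauto

lemma card_triadEdges (q : Bool × Bool × Bool) {i j k : ℕ} (hij : i ≠ j) (hjk : j ≠ k)
    (hki : k ≠ i) : (triadEdges q i j k).card = triadSize q := by
  have h1 : pairIdx i j ≠ pairIdx j k := by rw [Ne, pairIdx_eq_iff hij hjk]; omega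
  have h2 : pairIdx i j ≠ pairIdx k i := by rw [Ne, pairIdx_eq_iff hij hki]; omega
  have h3 : pairIdx j k ≠ pairIdx k i := by rw [Ne, pairIdx_eq_iff hjk hki]; omega
  obtain ⟨q1, q2, q3⟩ := q
  cases q1 <;> cases q2 <;> cases q3 <;> simp [triadEdges, triadSize, h1, h2, h3,
    Finset.card_insert_of_notMem]

/-- Two triangles with the same root that share exactly one further node have at most one edge in
common, so that the union of their selected edges is large. -/
lemma le_card_triadEdges_union {q : Bool × Bool × Bool} {s : ℕ} (hq : triadSize q = s + 1)
    {i j k j' k' : ℕ} (hij : i ≠ j) (hjk : j ≠ k) (hki : k ≠ i) (hij' : i ≠ j') (hjk' : j' ≠ k')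
    (hki' : k' ≠ i) (h : ¬ ((j = j' ∧ k = k') ∨ (j = k' ∧ k = j'))) :
    2 * s + 1 ≤ (triadEdges q i j k ∪ triadEdges q i j' k').card := by
  have hinter : (triadEdges q i j k ∩ triadEdges q i j' k').card ≤ 1 := by
    rw [Finset.card_le_one]
    intro e he f hf
    rw [Finset.mem_inter] at he hf
    have hshare : ∃ a, ∀ v, (v = i ∨ v = j ∨ v = k) → (v = i ∨ v = j' ∨ v = k') →
        v = i ∨ v = a := by
      by_cases h1 : j = j' ∨ j = k'
      · exact ⟨j, fun v hv hv' => by omega⟩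
      · exact ⟨k, fun v hv hv' => by omega⟩
    obtain ⟨a, ha⟩ := hshare
    obtain ⟨e1, e2⟩ := endpoints_of_mem_triadEdges hij hjk hki he.1
    obtain ⟨e3, e4⟩ := endpoints_of_mem_triadEdges hij' hjk' hki' he.2
    obtain ⟨f1, f2⟩ := endpoints_of_mem_triadEdges hij hjk hki hf.1
    obtain ⟨f3, f4⟩ := endpoints_of_mem_triadEdges hij' hjk' hki' hf.2
    have E1 := ha _ e1 e3
    have E2 := ha _ e2 e4
    have F1 := ha _ f1 f3
    have F2 := ha _ f2 f4
    have he' := e.2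
    have hf' := f.2
    clear e1 e2 e3 e4 f1 f2 f3 f4 ha h
    exact Subtype.ext (Prod.ext (by omega) (by omega))
  have h1 := card_triadEdges q hij hjk hki
  have h2 := card_triadEdges q hij' hjk' hki'
  have h3 := Finset.card_union_add_card_inter (triadEdges q i j k) (triadEdges q i j' k')
  omega

lemma triad_nonneg (q : Bool × Bool × Bool) {a b c : ℝ} (ha : 0 ≤ a) (hb : 0 ≤ b) (hc : 0 ≤ c) :
    0 ≤ triad q a b c := by
  unfold triad
  refine mul_nonneg (mul_nonneg ?_ ?_) ?_ <;> split_ifs <;> first | assumption | exact zero_le_one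

lemma triad_le_pow (q : Bool × Bool × Bool) {a b c K : ℝ} (ha : 0 ≤ a) (hb : 0 ≤ b) (hc : 0 ≤ c)
    (ha' : a ≤ K) (hb' : b ≤ K) (hc' : c ≤ K) : triad q a b c ≤ K ^ triadSize q := by
  have hK : 0 ≤ K := ha.trans ha'
  unfold triad triadSize
  rw [pow_add, pow_add]
  have h0 : ∀ (r : Bool) (x : ℝ), 0 ≤ x → 0 ≤ if r then x else 1 := by
    intro r x hx; split_ifs <;> [exact hx; exact zero_le_one]
  have h1 : ∀ (r : Bool) (x : ℝ), x ≤ K → (if r then x else 1) ≤ K ^ (if r then 1 else 0 : ℕ) := by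
    intro r x hx; split_ifs <;> simp [hx]
  exact mul_le_mul (mul_le_mul (h1 _ _ ha') (h1 _ _ hb') (h0 _ _ hb) (by positivity)) (h1 _ _ hc')
    (h0 _ _ hc) (by positivity)

lemma pow_le_triad (q : Bool × Bool × Bool) {a b c K : ℝ} (hK : 0 ≤ K)
    (ha' : K ≤ a) (hb' : K ≤ b) (hc' : K ≤ c) : K ^ triadSize q ≤ triad q a b c := by
  unfold triad triadSize
  rw [pow_add, pow_add]
  have h0 : ∀ (r : Bool) (x : ℝ), K ≤ x → 0 ≤ if r then x else 1 := by
    intro r x hx; split_ifs <;> [exact hK.trans hx; exact zero_le_one]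
  have h1 : ∀ (r : Bool) (x : ℝ), K ≤ x → K ^ (if r then 1 else 0 : ℕ) ≤ (if r then x else 1) := by
    intro r x hx; split_ifs <;> simp [hx]
  exact mul_le_mul (mul_le_mul (h1 _ _ ha') (h1 _ _ hb') (by positivity) (h0 _ _ ha')) (h1 _ _ hc')
    (by positivity) (mul_nonneg (h0 _ _ ha') (h0 _ _ hb'))

lemma triad_mul (q : Bool × Bool × Bool) (r a b c : ℝ) :
    triad q (r * a) (r * b) (r * c) = r ^ triadSize q * triad q a b c := by
  obtain ⟨q1, q2, q3⟩ := q
  cases q1 <;> cases q2 <;> cases q3 <;> simp [triad, triadSize] <;> ring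

lemma measurable_triad {α : Type*} [MeasurableSpace α] (q : Bool × Bool × Bool) {a b c : α → ℝ}
    (ha : Measurable a) (hb : Measurable b) (hc : Measurable c) :
    Measurable fun x => triad q (a x) (b x) (c x) := by
  unfold triad
  refine (Measurable.mul (Measurable.mul ?_ ?_) ?_) <;> split_ifs <;>
    first | assumption | exact measurable_const

/-- The latent density at the root position `x` of the rooted subgraph with mask `q`. -/
def latentTriad (M : SparseGraphonModel P p) (q : Bool × Bool × Bool) (x : unitInterval) : ℝ :=
  ∫ y, ∫ z, triad q (M.w x y) (M.w y z) (M.w z x)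

/-- The sources, other than the position of the root `i`, that determine the subgraph on
`i`, `j`, `k`. -/
def triadData (M : SparseGraphonModel P p) (i j k : ℕ) (ω : Ω) :
    (unitInterval × unitInterval) × unitInterval × unitInterval × unitInterval :=
  ((M.ξ j ω, M.ξ k ω),
    (M.edgeVar (pairIdx i j) ω, M.edgeVar (pairIdx j k) ω, M.edgeVar (pairIdx k i) ω))

/-- The subgraph indicator as a function of the position of the root and of `triadData`. -/
def rootedTriad (M : SparseGraphonModel P p) (n : ℕ) (q : Bool × Bool × Bool) (x : unitInterval)
    (U : (unitInterval × unitInterval) × unitInterval × unitInterval × unitInterval) : ℝ :=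
  triad q (M.edgeFn n x U.1.1 U.2.1) (M.edgeFn n U.1.1 U.1.2 U.2.2.1)
    (M.edgeFn n U.1.2 x U.2.2.2)

lemma triad_adj_eq (M : SparseGraphonModel P p) (n : ℕ) (q : Bool × Bool × Bool) {i j k : ℕ}
    (hij : i ≠ j) (hjk : j ≠ k) (hki : k ≠ i) (ω : Ω) :
    triad q (M.adj n ω i j) (M.adj n ω j k) (M.adj n ω k i) =
      M.rootedTriad n q (M.ξ i ω) (M.triadData i j k ω) := by
  rw [M.adj_eq_edgeFn n hij, M.adj_eq_edgeFn n hjk, M.adj_eq_edgeFn n hki]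
  rfl

lemma measurable_rootedTriad (M : SparseGraphonModel P p) (n : ℕ) (q : Bool × Bool × Bool) :
    Measurable (Function.uncurry (M.rootedTriad n q)) := by
  have h : ∀ {a b u : unitInterval × ((unitInterval × unitInterval) × unitInterval ×
      unitInterval × unitInterval) → unitInterval}, Measurable a → Measurable b → Measurable u →
      Measurable fun z => M.edgeFn n (a z) (b z) (u z) := fun ha hb hu =>
    (M.measurable_edgeFn n).comp (ha.prodMk (hb.prodMk hu))
  exact measurable_triad q (h (by fun_prop) (by fun_prop) (by fun_prop))
    (h (by fun_prop) (by fun_prop) (by fun_prop)) (h (by fun_prop) (by fun_prop) (by fun_prop))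

lemma rootedTriad_nonneg (M : SparseGraphonModel P p) (n : ℕ) (q : Bool × Bool × Bool)
    (x : unitInterval)
    (U : (unitInterval × unitInterval) × unitInterval × unitInterval × unitInterval) :
    0 ≤ M.rootedTriad n q x U :=
  triad_nonneg q (M.edgeFn_nonneg _ _ _ _) (M.edgeFn_nonneg _ _ _ _) (M.edgeFn_nonneg _ _ _ _)

lemma rootedTriad_le_one (M : SparseGraphonModel P p) (n : ℕ) (q : Bool × Bool × Bool)
    (x : unitInterval)
    (U : (unitInterval × unitInterval) × unitInterval × unitInterval × unitInterval) :
    M.rootedTriad n q x U ≤ 1 := by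
  unfold rootedTriad
  simpa using triad_le_pow q (M.edgeFn_nonneg _ _ _ _)
      (M.edgeFn_nonneg _ _ _ _) (M.edgeFn_nonneg _ _ _ _) (M.edgeFn_le_one n x U.1.1 U.2.1)
      (M.edgeFn_le_one n U.1.1 U.1.2 U.2.2.1) (M.edgeFn_le_one n U.1.2 x U.2.2.2)

lemma measurable_triadData (M : SparseGraphonModel P p) (i j k : ℕ) :
    Measurable (M.triadData i j k) :=
  ((M.measurable_ξ _).prodMk (M.measurable_ξ _)).prodMk ((M.measurable_edgeVar _).prodMk
    ((M.measurable_edgeVar _).prodMk (M.measurable_edgeVar _)))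

/-- The indices of the sources that enter `triadData`. -/
def triadSources (i j k : ℕ) : Set Source :=
  {.inl j, .inl k, .inr (pairIdx i j), .inr (pairIdx j k), .inr (pairIdx k i)}

lemma measurable_triadData_sigmaOf (M : SparseGraphonModel P p) {i j k : ℕ} {S : Set Source}
    (hS : triadSources i j k ⊆ S) : Measurable[M.sigmaOf S] (M.triadData i j k) := by
  refine Measurable.prodMk (Measurable.prodMk ?_ ?_)
    (Measurable.prodMk ?_ (Measurable.prodMk ?_ ?_))
  · exact M.measurable_ξ_sigmaOf (hS (by simp [triadSources]))
  · exact M.measurable_ξ_sigmaOf (hS (by simp [triadSources]))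
  · exact M.measurable_edgeVar_sigmaOf (hS (by simp [triadSources]))
  · exact M.measurable_edgeVar_sigmaOf (hS (by simp [triadSources]))
  · exact M.measurable_edgeVar_sigmaOf (hS (by simp [triadSources]))

lemma map_prodMk_of_disjoint [IsProbabilityMeasure P] (M : SparseGraphonModel P p)
    {S T : Set Source} (hST : Disjoint S T)
    {β γ : Type*} [MeasurableSpace β] [MeasurableSpace γ] {f : Ω → β} {g : Ω → γ}
    (hf : Measurable[M.sigmaOf S] f) (hg : Measurable[M.sigmaOf T] g) :
    P.map (fun ω => (f ω, g ω)) = (P.map f).prod (P.map g) := by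
  have hle : ∀ S, M.sigmaOf S ≤ ‹MeasurableSpace Ω› := fun S =>
    iSup₂_le fun s _ => M.sourceAlgebra_le s
  exact (indepFun_iff_map_prod_eq_prod_map_map (hf.mono (hle S) le_rfl).aemeasurable
    (hg.mono (hle T) le_rfl).aemeasurable).1 (M.indepFun_of_disjoint hST hf hg)

lemma map_triadData [IsProbabilityMeasure P] (M : SparseGraphonModel P p) {i j k : ℕ}
    (hij : i ≠ j) (hjk : j ≠ k) (hki : k ≠ i) : P.map (M.triadData i j k) = volume := by
  have h1 : pairIdx i j ≠ pairIdx j k := by rw [Ne, pairIdx_eq_iff hij hjk]; omega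
  have h2 : pairIdx i j ≠ pairIdx k i := by rw [Ne, pairIdx_eq_iff hij hki]; omega
  have h3 : pairIdx j k ≠ pairIdx k i := by rw [Ne, pairIdx_eq_iff hjk hki]; omega
  have hξ : P.map (fun ω => (M.ξ j ω, M.ξ k ω)) = volume := by
    rw [M.map_prodMk_of_disjoint (S := {.inl j}) (T := {.inl k}) (by simpa using hjk)
      (M.measurable_ξ_sigmaOf (by simp)) (M.measurable_ξ_sigmaOf (by simp)), M.map_ξ, M.map_ξ]
    rfl
  have hη : P.map (fun ω => (M.edgeVar (pairIdx j k) ω, M.edgeVar (pairIdx k i) ω)) = volume := by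
    rw [M.map_prodMk_of_disjoint (S := {.inr (pairIdx j k)}) (T := {.inr (pairIdx k i)})
      (by simpa using h3) (M.measurable_edgeVar_sigmaOf (by simp))
      (M.measurable_edgeVar_sigmaOf (by simp)), M.map_edgeVar, M.map_edgeVar]
    rfl
  have hη' : P.map (fun ω => (M.edgeVar (pairIdx i j) ω, M.edgeVar (pairIdx j k) ω,
      M.edgeVar (pairIdx k i) ω)) = volume := by
    rw [M.map_prodMk_of_disjoint (S := {.inr (pairIdx i j)})
      (T := {.inr (pairIdx j k), .inr (pairIdx k i)})
      (by simp [h1, h2]) (M.measurable_edgeVar_sigmaOf (by simp))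
      ((M.measurable_edgeVar_sigmaOf (by simp)).prodMk (M.measurable_edgeVar_sigmaOf (by simp))),
      M.map_edgeVar, hη]
    rfl
  unfold triadData
  rw [M.map_prodMk_of_disjoint (S := {.inl j, .inl k})
      (T := {.inr (pairIdx i j), .inr (pairIdx j k), .inr (pairIdx k i)}) (by simp)
      ((M.measurable_ξ_sigmaOf (by simp)).prodMk (M.measurable_ξ_sigmaOf (by simp)))
      ((M.measurable_edgeVar_sigmaOf (by simp)).prodMk
        ((M.measurable_edgeVar_sigmaOf (by simp)).prodMk (M.measurable_edgeVar_sigmaOf (by simp)))),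
      hξ, hη']
  rfl

lemma disjoint_triadSources {i j k j' k' : ℕ} (hij : i ≠ j) (hjk : j ≠ k) (hki : k ≠ i)
    (hij' : i ≠ j') (hjk' : j' ≠ k') (hki' : k' ≠ i) (h1 : j ≠ j') (h2 : j ≠ k') (h3 : k ≠ j')
    (h4 : k ≠ k') : Disjoint (triadSources i j k) (triadSources i j' k') := by
  have hq : ∀ {j k : ℕ} {e : {e : ℕ × ℕ // e.1 < e.2}},
      e = pairIdx i j ∨ e = pairIdx j k ∨ e = pairIdx k i →
        e ∈ triadEdges (true, true, true) i j k :=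
    fun h => mem_triadEdges.2 (by simpa using h)
  rw [Set.disjoint_left]
  rintro (v | e) hv hv'
  · simp only [triadSources, Set.mem_insert_iff, Set.mem_singleton_iff, Sum.inl.injEq, reduceCtorEq,
      or_false] at hv hv'
    omega
  · simp only [triadSources, Set.mem_insert_iff, Set.mem_singleton_iff, Sum.inr.injEq, reduceCtorEq,
      false_or] at hv hv'
    obtain ⟨e1, e2⟩ := endpoints_of_mem_triadEdges hij hjk hki (hq hv)
    obtain ⟨e3, e4⟩ := endpoints_of_mem_triadEdges hij' hjk' hki' (hq hv')
    have he := e.2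
    clear hv hv' hq
    have hroot : ∀ v, (v = i ∨ v = j ∨ v = k) → (v = i ∨ v = j' ∨ v = k') → v = i := by omega
    have := hroot _ e1 e3
    have := hroot _ e2 e4
    omega

/-- The latent values of `w` on the edges of a triangle with root position `x` obey the bounds of
`w`, for almost every `x`. -/
lemma ae_ae_w_bounds (M : SparseGraphonModel P p) {c C : ℝ}
    (hw : ∀ᵐ z ∂(volume : Measure (unitInterval × unitInterval)),
      c ≤ M.w z.1 z.2 ∧ M.w z.1 z.2 ≤ C) :
    ∀ᵐ x : unitInterval, ∀ᵐ yz : unitInterval × unitInterval,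
      (c ≤ M.w x yz.1 ∧ M.w x yz.1 ≤ C) ∧ (c ≤ M.w yz.1 yz.2 ∧ M.w yz.1 yz.2 ≤ C) ∧
        (c ≤ M.w yz.2 x ∧ M.w yz.2 x ≤ C) := by
  have h := Measure.ae_ae_of_ae_prod hw
  filter_upwards [h] with x hx
  have h1 : ∀ᵐ yz : unitInterval × unitInterval, c ≤ M.w x yz.1 ∧ M.w x yz.1 ≤ C :=
    Measure.quasiMeasurePreserving_fst.ae hx
  have h2 : ∀ᵐ yz : unitInterval × unitInterval, c ≤ M.w x yz.2 ∧ M.w x yz.2 ≤ C :=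
    Measure.quasiMeasurePreserving_snd.ae hx
  filter_upwards [h1, h2, hw] with yz h1 h2 h3
  exact ⟨h1, h3, by rw [M.w_symm]; exact h2⟩

lemma measurable_triad_w (M : SparseGraphonModel P p) (q : Bool × Bool × Bool) :
    Measurable fun z : unitInterval × unitInterval × unitInterval =>
      triad q (M.w z.1 z.2.1) (M.w z.2.1 z.2.2) (M.w z.2.2 z.1) :=
  measurable_triad q
    (M.measurable_w.comp (measurable_fst.prodMk (measurable_fst.comp measurable_snd)))
    (M.measurable_w.comp measurable_snd)
    (M.measurable_w.comp ((measurable_snd.comp measurable_snd).prodMk measurable_fst))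

/-- For almost every root position, the latent density is a genuine (integrable) integral over
pairs, with the bounds inherited from `w`. -/
lemma ae_latentTriad (M : SparseGraphonModel P p) {c C : ℝ} (hc : 0 < c)
    (hw : ∀ᵐ z ∂(volume : Measure (unitInterval × unitInterval)),
      c ≤ M.w z.1 z.2 ∧ M.w z.1 z.2 ≤ C) (q : Bool × Bool × Bool) :
    ∀ᵐ x : unitInterval,
      Integrable (fun yz : unitInterval × unitInterval =>
        triad q (M.w x yz.1) (M.w yz.1 yz.2) (M.w yz.2 x)) ∧
      M.latentTriad q x = ∫ yz : unitInterval × unitInterval,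
        triad q (M.w x yz.1) (M.w yz.1 yz.2) (M.w yz.2 x) ∧
      c ^ triadSize q ≤ M.latentTriad q x ∧ M.latentTriad q x ≤ C ^ triadSize q := by
  filter_upwards [M.ae_ae_w_bounds hw] with x hx
  have hmeas : Measurable fun yz : unitInterval × unitInterval =>
      triad q (M.w x yz.1) (M.w yz.1 yz.2) (M.w yz.2 x) :=
    (M.measurable_triad_w q).comp measurable_prodMk_left
  have hb : ∀ᵐ yz : unitInterval × unitInterval,
      c ^ triadSize q ≤ triad q (M.w x yz.1) (M.w yz.1 yz.2) (M.w yz.2 x) ∧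
      triad q (M.w x yz.1) (M.w yz.1 yz.2) (M.w yz.2 x) ≤ C ^ triadSize q := by
    filter_upwards [hx] with yz h
    exact ⟨pow_le_triad q hc.le h.1.1 h.2.1.1 h.2.2.1,
      triad_le_pow q (hc.le.trans h.1.1) (hc.le.trans h.2.1.1) (hc.le.trans h.2.2.1)
        h.1.2 h.2.1.2 h.2.2.2⟩
  have hint : Integrable (fun yz : unitInterval × unitInterval =>
      triad q (M.w x yz.1) (M.w yz.1 yz.2) (M.w yz.2 x)) := by
    refine Integrable.of_bound hmeas.aestronglyMeasurable (C ^ triadSize q) ?_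
    filter_upwards [hb] with yz h
    rw [Real.norm_eq_abs, abs_of_nonneg ((pow_nonneg hc.le _).trans h.1)]
    exact h.2
  have heq : M.latentTriad q x = ∫ yz : unitInterval × unitInterval,
      triad q (M.w x yz.1) (M.w yz.1 yz.2) (M.w yz.2 x) := by
    rw [latentTriad, Measure.volume_eq_prod, integral_prod _ hint]
  refine ⟨hint, heq, ?_, ?_⟩
  · rw [heq]
    calc c ^ triadSize q = ∫ _ : unitInterval × unitInterval, c ^ triadSize q := by simp
      _ ≤ _ := integral_mono_ae (integrable_const _) hint (hb.mono fun _ h => h.1)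
  · rw [heq]
    calc _ ≤ ∫ _ : unitInterval × unitInterval, C ^ triadSize q :=
          integral_mono_ae hint (integrable_const _) (hb.mono fun _ h => h.2)
      _ = _ := by simp

/-- The conditional mean of a rooted subgraph indicator: integrating out the edge variables
replaces every edge indicator by `ρ w`. -/
lemma ae_integral_rootedTriad (M : SparseGraphonModel P p) {c C : ℝ} (hc : 0 < c)
    (hw : ∀ᵐ z ∂(volume : Measure (unitInterval × unitInterval)),
      c ≤ M.w z.1 z.2 ∧ M.w z.1 z.2 ≤ C) {n : ℕ} (hn : M.ρ n * C ≤ 1) (q : Bool × Bool × Bool) :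
    ∀ᵐ x : unitInterval, ∫ U, M.rootedTriad n q x U = M.ρ n ^ triadSize q * M.latentTriad q x := by
  filter_upwards [M.ae_ae_w_bounds hw, M.ae_latentTriad hc hw q] with x hx hlat
  have hint : Integrable (M.rootedTriad n q x) := by
    refine Integrable.of_bound
      ((M.measurable_rootedTriad n q).comp measurable_prodMk_left).aestronglyMeasurable 1 ?_
    refine Eventually.of_forall fun U => ?_
    rw [Real.norm_eq_abs, abs_of_nonneg (M.rootedTriad_nonneg n q x U)]
    exact M.rootedTriad_le_one n q x U
  rw [Measure.volume_eq_prod, integral_prod _ hint, hlat.2.1, ← integral_const_mul]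
  refine integral_congr_ae ?_
  filter_upwards [hx] with yz h
  have hρ := M.ρ_pos n
  have hb : ∀ a b, (c ≤ M.w a b ∧ M.w a b ≤ C) →
      ∫ u, M.edgeFn n a b u = M.ρ n * M.w a b := fun a b hab =>
    M.integral_edgeFn n (mul_nonneg hρ.le (hc.le.trans hab.1))
      ((mul_le_mul_of_nonneg_left hab.2 hρ.le).trans hn)
  have hprod := integral_prod_mul (μ := (volume : Measure unitInterval))
    (ν := (volume : Measure (unitInterval × unitInterval)))
    (fun u => if q.1 then M.edgeFn n x yz.1 u else 1)
    (fun v => (if q.2.1 then M.edgeFn n yz.1 yz.2 v.1 else 1) *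
      (if q.2.2 then M.edgeFn n yz.2 x v.2 else 1))
  have hprod' := integral_prod_mul (μ := (volume : Measure unitInterval))
    (ν := (volume : Measure unitInterval))
    (fun u => if q.2.1 then M.edgeFn n yz.1 yz.2 u else 1)
    (fun v => if q.2.2 then M.edgeFn n yz.2 x v else 1)
  have hif : ∀ (r : Bool) (a b : unitInterval), (c ≤ M.w a b ∧ M.w a b ≤ C) →
      ∫ u, (if r then M.edgeFn n a b u else 1) = if r then M.ρ n * M.w a b else 1 := by
    intro r a b hab
    cases r
    · simp
    · simpa using hb a b hab
  rw [Measure.volume_eq_prod, hprod', hif _ _ _ h.1, hif _ _ _ h.2.1, hif _ _ _ h.2.2] at hprod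
  rw [← triad_mul]
  simp only [rootedTriad, triad, mul_assoc] at hprod ⊢
  exact hprod

/-- Since `w ≤ C`, an edge forces its edge variable to be at most `ρ C`. -/
lemma ae_edgeVar_le_of_adj_ne_zero [IsProbabilityMeasure P] (M : SparseGraphonModel P p) {c C : ℝ}
    (hw : ∀ᵐ z ∂(volume : Measure (unitInterval × unitInterval)),
      c ≤ M.w z.1 z.2 ∧ M.w z.1 z.2 ≤ C) (n : ℕ) :
    ∀ᵐ ω ∂P, ∀ i j, i ≠ j → M.adj n ω i j ≠ 0 →
      (M.edgeVar (pairIdx i j) ω : ℝ) ≤ M.ρ n * C := by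
  refine ae_all_iff.2 fun i => ae_all_iff.2 fun j => ?_
  by_cases hij : i = j
  · exact Eventually.of_forall fun ω h => absurd hij h
  filter_upwards [M.w_bounds_ξ hw hij] with ω hω _ h
  rw [M.adj_eq_edgeFn n hij] at h
  unfold edgeFn at h
  have h' : (M.edgeVar (pairIdx i j) ω : ℝ) ≤ min (M.ρ n * M.w (M.ξ i ω) (M.ξ j ω)) 1 := by
    by_contra hcon
    exact h (if_neg hcon)
  exact (h'.trans (min_le_left _ _)).trans (mul_le_mul_of_nonneg_left hω.2 (M.ρ_pos n).le)

lemma measure_edgeVar_le (M : SparseGraphonModel P p) {b : ℝ} (hb : 0 ≤ b) (hb1 : b ≤ 1)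
    (T : Finset {e : ℕ × ℕ // e.1 < e.2}) :
    P.real {ω | ∀ e ∈ T, (M.edgeVar e ω : ℝ) ≤ b} = b ^ T.card := by
  have h := M.iIndepFun_η.measure_inter_preimage_eq_mul T (sets := fun _ => {u | (u : ℝ) ≤ b})
    fun e _ => measurableSet_le measurable_subtype_coe measurable_const
  have hset : {ω | ∀ e ∈ T, (M.edgeVar e ω : ℝ) ≤ b} =
      ⋂ e ∈ T, (M.η e.1.1 e.1.2) ⁻¹' {u | (u : ℝ) ≤ b} := by
    ext ω; simp [edgeVar]
  have hone : ∀ e : {e : ℕ × ℕ // e.1 < e.2},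
      P ((M.η e.1.1 e.1.2) ⁻¹' {u | (u : ℝ) ≤ b}) = ENNReal.ofReal b := by
    intro e
    rw [← Measure.map_apply (M.measurable_η _ _)
      (measurableSet_le measurable_subtype_coe measurable_const), M.map_η _ _ e.2,
      volume_coe_le hb hb1]
  rw [measureReal_def, hset, h, Finset.prod_congr rfl fun e _ => hone e, Finset.prod_const,
    ENNReal.toReal_pow, ENNReal.toReal_ofReal hb]

lemma edgeVar_le_of_triad_ne_zero (M : SparseGraphonModel P p) {n : ℕ} {b : ℝ} {ω : Ω}
    (hω : ∀ i j, i ≠ j → M.adj n ω i j ≠ 0 → (M.edgeVar (pairIdx i j) ω : ℝ) ≤ b)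
    {q : Bool × Bool × Bool} {i j k : ℕ} (hij : i ≠ j) (hjk : j ≠ k) (hki : k ≠ i)
    (h : triad q (M.adj n ω i j) (M.adj n ω j k) (M.adj n ω k i) ≠ 0) :
    ∀ e ∈ triadEdges q i j k, (M.edgeVar e ω : ℝ) ≤ b := by
  unfold triad at h
  obtain ⟨h12, h3⟩ := mul_ne_zero_iff.1 h
  obtain ⟨h1, h2⟩ := mul_ne_zero_iff.1 h12
  intro e he
  rcases mem_triadEdges.1 he with ⟨hq, rfl⟩ | ⟨hq, rfl⟩ | ⟨hq, rfl⟩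
  · exact hω _ _ hij (by simpa [hq] using h1)
  · exact hω _ _ hjk (by simpa [hq] using h2)
  · exact hω _ _ hki (by simpa [hq] using h3)

/-- Two rooted subgraph indicators are simultaneously non-zero with probability at most
`(ρ C) ^ t`, if the union of their edge sets has at least `t` elements. -/
lemma integral_triad_mul_triad_le [IsProbabilityMeasure P] (M : SparseGraphonModel P p)
    {c C : ℝ} (hc : 0 < c) (hcC : c ≤ C)
    (hw : ∀ᵐ z ∂(volume : Measure (unitInterval × unitInterval)),
      c ≤ M.w z.1 z.2 ∧ M.w z.1 z.2 ≤ C) {n : ℕ} (hn : M.ρ n * C ≤ 1) (q : Bool × Bool × Bool)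
    {i j k j' k' t : ℕ} (hij : i ≠ j) (hjk : j ≠ k) (hki : k ≠ i) (hij' : i ≠ j') (hjk' : j' ≠ k')
    (hki' : k' ≠ i) (ht : t ≤ (triadEdges q i j k ∪ triadEdges q i j' k').card) :
    ∫ ω, triad q (M.adj n ω i j) (M.adj n ω j k) (M.adj n ω k i) *
      triad q (M.adj n ω i j') (M.adj n ω j' k') (M.adj n ω k' i) ∂P ≤ (M.ρ n * C) ^ t := by
  have hb : 0 ≤ M.ρ n * C := mul_nonneg (M.ρ_pos n).le (hc.le.trans hcC)
  set T := triadEdges q i j k ∪ triadEdges q i j' k' with hT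
  have hmeasT : MeasurableSet {ω | ∀ e ∈ T, (M.edgeVar e ω : ℝ) ≤ M.ρ n * C} := by
    simp only [Set.ofPred_forall]
    exact Finset.measurableSet_biInter _ fun e _ => measurableSet_le
      (measurable_subtype_coe.comp (M.measurable_edgeVar e)) measurable_const
  calc _ ≤ ∫ ω, {ω | ∀ e ∈ T, (M.edgeVar e ω : ℝ) ≤ M.ρ n * C}.indicator
          (fun _ => (1 : ℝ)) ω ∂P := by
        refine integral_mono_of_nonneg (Eventually.of_forall fun ω => ?_)
          ((integrable_const _).indicator hmeasT) ?_
        · simp only [M.triad_adj_eq n q hij hjk hki, M.triad_adj_eq n q hij' hjk' hki']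
          exact mul_nonneg (M.rootedTriad_nonneg _ _ _ _) (M.rootedTriad_nonneg _ _ _ _)
        · filter_upwards [M.ae_edgeVar_le_of_adj_ne_zero hw n] with ω hω
          by_cases h0 : triad q (M.adj n ω i j) (M.adj n ω j k) (M.adj n ω k i) *
            triad q (M.adj n ω i j') (M.adj n ω j' k') (M.adj n ω k' i) = 0
          · simp only [h0]
            exact Set.indicator_nonneg (fun _ _ => zero_le_one) _
          · have hmem : ω ∈ {ω | ∀ e ∈ T, (M.edgeVar e ω : ℝ) ≤ M.ρ n * C} := by
              intro e he
              rcases Finset.mem_union.1 he with he | he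
              · exact M.edgeVar_le_of_triad_ne_zero hω hij hjk hki (left_ne_zero_of_mul h0) e he
              · exact M.edgeVar_le_of_triad_ne_zero hω hij' hjk' hki' (right_ne_zero_of_mul h0) e he
            rw [Set.indicator_of_mem hmem, M.triad_adj_eq n q hij hjk hki,
              M.triad_adj_eq n q hij' hjk' hki']
            exact mul_le_one₀ (M.rootedTriad_le_one _ _ _ _) (M.rootedTriad_nonneg _ _ _ _)
              (M.rootedTriad_le_one _ _ _ _)
    _ = (M.ρ n * C) ^ T.card := by
        rw [integral_indicator_const _ hmeasT, M.measure_edgeVar_le hb hn, smul_eq_mul, mul_one]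
    _ ≤ (M.ρ n * C) ^ t := pow_le_pow_of_le_one hb hn ht

/-- The deviation of a rooted subgraph indicator from its conditional mean given the position of
the root. -/
def triadDev (M : SparseGraphonModel P p) (n : ℕ) (q : Bool × Bool × Bool) (i j k : ℕ)
    (ω : Ω) : ℝ :=
  triad q (M.adj n ω i j) (M.adj n ω j k) (M.adj n ω k i) -
    ∫ U, M.rootedTriad n q (M.ξ i ω) U

lemma integral_rootedTriad_mem (M : SparseGraphonModel P p) (n : ℕ) (q : Bool × Bool × Bool)
    (x : unitInterval) :
    0 ≤ ∫ U, M.rootedTriad n q x U ∧ ∫ U, M.rootedTriad n q x U ≤ 1 := by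
  refine ⟨integral_nonneg fun U => M.rootedTriad_nonneg n q x U, ?_⟩
  calc _ ≤ ∫ _ : (unitInterval × unitInterval) × unitInterval × unitInterval × unitInterval,
        (1 : ℝ) := integral_mono_of_nonneg (Eventually.of_forall (M.rootedTriad_nonneg n q x))
        (integrable_const _) (Eventually.of_forall (M.rootedTriad_le_one n q x))
    _ = 1 := by simp

lemma measurable_integral_rootedTriad (M : SparseGraphonModel P p) (n : ℕ)
    (q : Bool × Bool × Bool) : Measurable fun x => ∫ U, M.rootedTriad n q x U :=
  ((M.measurable_rootedTriad n q).stronglyMeasurable.integral_prod_right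
    (ν := (volume : Measure ((unitInterval × unitInterval) × unitInterval × unitInterval ×
      unitInterval)))).measurable

lemma measurable_triad_adj (M : SparseGraphonModel P p) (n : ℕ) (q : Bool × Bool × Bool)
    (i j k : ℕ) :
    Measurable fun ω => triad q (M.adj n ω i j) (M.adj n ω j k) (M.adj n ω k i) :=
  measurable_triad q (M.measurable_adj _ _ _) (M.measurable_adj _ _ _) (M.measurable_adj _ _ _)

lemma memLp_triadDev [IsProbabilityMeasure P] (M : SparseGraphonModel P p) (n : ℕ)
    (q : Bool × Bool × Bool) (i j k : ℕ) :
    MemLp (M.triadDev n q i j k) 2 P := by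
  refine MemLp.of_bound (C := 2) ?_ ?_
  · exact ((M.measurable_triad_adj n q i j k).sub
      ((M.measurable_integral_rootedTriad n q).comp (M.measurable_ξ i))).aestronglyMeasurable
  · refine Eventually.of_forall fun ω => ?_
    obtain ⟨h1, h2⟩ := M.integral_rootedTriad_mem n q (M.ξ i ω)
    have h3 := triad_nonneg q (M.adj_nonneg n i j ω) (M.adj_nonneg n j k ω) (M.adj_nonneg n k i ω)
    have h4 := triad_le_pow q (M.adj_nonneg n i j ω) (M.adj_nonneg n j k ω) (M.adj_nonneg n k i ω)
      (M.adj_le_one n i j ω) (M.adj_le_one n j k ω) (M.adj_le_one n k i ω)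
    rw [one_pow] at h4
    rw [Real.norm_eq_abs, abs_le, triadDev]
    constructor <;> linarith

lemma integral_triadDev_mul_eq_zero [IsProbabilityMeasure P] (M : SparseGraphonModel P p)
    (n : ℕ) (q : Bool × Bool × Bool) {i j k j' k' : ℕ} (hij : i ≠ j) (hjk : j ≠ k) (hki : k ≠ i) (hij' : i ≠ j') (hjk' : j' ≠ k')
    (hki' : k' ≠ i) (h1 : j ≠ j') (h2 : j ≠ k') (h3 : k ≠ j') (h4 : k ≠ k') :
    ∫ ω, M.triadDev n q i j k ω * M.triadDev n q i j' k' ω ∂P = 0 := by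
  simp only [triadDev, M.triad_adj_eq n q hij hjk hki, M.triad_adj_eq n q hij' hjk' hki']
  refine integral_centered_mul_eq_zero (M.measurable_ξ i) (M.measurable_triadData i j k)
    (M.measurable_triadData i j' k') (M.map_triadData hij hjk hki) (M.map_triadData hij' hjk' hki')
    ?_ ?_ (M.measurable_rootedTriad n q)
  · exact M.indepFun_of_disjoint (disjoint_triadSources hij hjk hki hij' hjk' hki' h1 h2 h3 h4)
      (M.measurable_triadData_sigmaOf subset_rfl) (M.measurable_triadData_sigmaOf subset_rfl)
  · refine M.indepFun_of_disjoint (S := {.inl i}) (T := triadSources i j k ∪ triadSources i j' k')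
      ?_ (M.measurable_ξ_sigmaOf (by simp))
      ((M.measurable_triadData_sigmaOf Set.subset_union_left).prodMk
        (M.measurable_triadData_sigmaOf Set.subset_union_right))
    simp [triadSources, hij, hki.symm, hij', hki'.symm]

/-- Covariance bound for overlapping rooted subgraph indicators. -/
lemma integral_triadDev_mul_le [IsProbabilityMeasure P] (M : SparseGraphonModel P p)
    {c C : ℝ} (hc : 0 < c) (hcC : c ≤ C)
    (hw : ∀ᵐ z ∂(volume : Measure (unitInterval × unitInterval)),
      c ≤ M.w z.1 z.2 ∧ M.w z.1 z.2 ≤ C) {n : ℕ} (hn : M.ρ n * C ≤ 1) (q : Bool × Bool × Bool)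
    {i j k j' k' t : ℕ} (hij : i ≠ j) (hjk : j ≠ k) (hki : k ≠ i) (hij' : i ≠ j') (hjk' : j' ≠ k')
    (hki' : k' ≠ i) (ht : t ≤ (triadEdges q i j k ∪ triadEdges q i j' k').card)
    (htq : t ≤ 2 * triadSize q) :
    ∫ ω, M.triadDev n q i j k ω * M.triadDev n q i j' k' ω ∂P ≤ 2 * (M.ρ n * C) ^ t := by
  have hb : 0 ≤ M.ρ n * C := mul_nonneg (M.ρ_pos n).le (hc.le.trans hcC)
  have hmean : ∀ᵐ ω ∂P, ∫ U, M.rootedTriad n q (M.ξ i ω) U ≤ (M.ρ n * C) ^ triadSize q := by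
    have h : ∀ᵐ x, ∫ U, M.rootedTriad n q x U ≤ (M.ρ n * C) ^ triadSize q := by
      filter_upwards [M.ae_integral_rootedTriad hc hw hn q, M.ae_latentTriad hc hw q] with x h1 h2
      rw [h1, mul_pow]
      exact mul_le_mul_of_nonneg_left h2.2.2.2 (pow_nonneg (M.ρ_pos n).le _)
    rw [← M.map_ξ i] at h
    exact ae_of_ae_map (M.measurable_ξ i).aemeasurable h
  have hint : Integrable (fun ω => triad q (M.adj n ω i j) (M.adj n ω j k) (M.adj n ω k i) *
      triad q (M.adj n ω i j') (M.adj n ω j' k') (M.adj n ω k' i)) P := by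
    refine Integrable.of_bound ((M.measurable_triad_adj n q i j k).mul
      (M.measurable_triad_adj n q i j' k')).aestronglyMeasurable 1
      (Eventually.of_forall fun ω => ?_)
    rw [M.triad_adj_eq n q hij hjk hki, M.triad_adj_eq n q hij' hjk' hki', Real.norm_eq_abs,
      abs_of_nonneg (mul_nonneg (M.rootedTriad_nonneg _ _ _ _) (M.rootedTriad_nonneg _ _ _ _))]
    exact mul_le_one₀ (M.rootedTriad_le_one _ _ _ _) (M.rootedTriad_nonneg _ _ _ _)
      (M.rootedTriad_le_one _ _ _ _)
  calc ∫ ω, M.triadDev n q i j k ω * M.triadDev n q i j' k' ω ∂P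
      ≤ ∫ ω, (triad q (M.adj n ω i j) (M.adj n ω j k) (M.adj n ω k i) *
          triad q (M.adj n ω i j') (M.adj n ω j' k') (M.adj n ω k' i) + (M.ρ n * C) ^ t) ∂P := by
        refine integral_mono_ae ((M.memLp_triadDev n q i j k).integrable_mul
          (M.memLp_triadDev n q i j' k')) (hint.add (integrable_const _)) ?_
        filter_upwards [hmean] with ω hω
        have h0 := (M.integral_rootedTriad_mem n q (M.ξ i ω)).1
        have hF := M.rootedTriad_nonneg n q (M.ξ i ω) (M.triadData i j k ω)
        have hF' := M.rootedTriad_nonneg n q (M.ξ i ω) (M.triadData i j' k' ω)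
        have hsq : (∫ U, M.rootedTriad n q (M.ξ i ω) U) * (∫ U, M.rootedTriad n q (M.ξ i ω) U) ≤
            (M.ρ n * C) ^ t := by
          calc _ ≤ (M.ρ n * C) ^ triadSize q * (M.ρ n * C) ^ triadSize q :=
                mul_le_mul hω hω h0 (pow_nonneg hb _)
            _ = (M.ρ n * C) ^ (2 * triadSize q) := by rw [← pow_add, two_mul]
            _ ≤ _ := pow_le_pow_of_le_one hb hn htq
        simp only [triadDev, M.triad_adj_eq n q hij hjk hki, M.triad_adj_eq n q hij' hjk' hki']
        nlinarith [mul_nonneg h0 hF, mul_nonneg h0 hF']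
    _ ≤ 2 * (M.ρ n * C) ^ t := by
        rw [integral_add hint (integrable_const _)]
        have := M.integral_triad_mul_triad_le hc hcC hw hn q hij hjk hki hij' hjk' hki' ht
        simp only [integral_const, probReal_univ, smul_eq_mul, one_mul]
        linarith

/-- The conditional variance of a rooted subgraph count with `s + 1` edges: only overlapping pairs
of subgraphs contribute, `O(|J|³)` of them with at least `2 s + 1` edges in total and `O(|J|²)`
with `s + 1` edges. -/
lemma integral_sq_sum_triadDev_le [IsProbabilityMeasure P] (M : SparseGraphonModel P p)
    {c C : ℝ} (hc : 0 < c) (hcC : c ≤ C)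
    (hw : ∀ᵐ z ∂(volume : Measure (unitInterval × unitInterval)),
      c ≤ M.w z.1 z.2 ∧ M.w z.1 z.2 ≤ C) {n : ℕ} (hn : M.ρ n * C ≤ 1) {q : Bool × Bool × Bool}
    {s : ℕ} (hq : triadSize q = s + 1) {J : Finset ℕ} {i : ℕ} (hi : i ∉ J) :
    ∫ ω, (∑ e ∈ J.offDiag, M.triadDev n q i e.1 e.2 ω) ^ 2 ∂P ≤
      8 * (M.ρ n * C) ^ (2 * s + 1) * (J.card : ℝ) ^ 3 +
        4 * (M.ρ n * C) ^ (s + 1) * (J.card : ℝ) ^ 2 := by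
  have hb : 0 ≤ M.ρ n * C := mul_nonneg (M.ρ_pos n).le (hc.le.trans hcC)
  set b1 := 2 * (M.ρ n * C) ^ (2 * s + 1) with hb1
  set b2 := 2 * (M.ρ n * C) ^ (s + 1) with hb2
  have hb1' : 0 ≤ b1 := by positivity
  have hb2' : 0 ≤ b2 := by positivity
  let B : ℕ × ℕ → ℕ × ℕ → ℝ := fun e e' =>
    (if e.1 = e'.1 then b1 else 0) + (if e.1 = e'.2 then b1 else 0) +
      (if e.2 = e'.1 then b1 else 0) + (if e.2 = e'.2 then b1 else 0) +
      ((if e.1 = e'.1 then (if e.2 = e'.2 then b2 else 0) else 0) +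
        (if e.1 = e'.2 then (if e.2 = e'.1 then b2 else 0) else 0))
  have hite : ∀ (Q : Prop) [Decidable Q] (b : ℝ), 0 ≤ b → 0 ≤ if Q then b else 0 := by
    intro Q _ b hb; split_ifs <;> [exact hb; exact le_rfl]
  have hBnn : ∀ e e', 0 ≤ B e e' := fun e e' => by
    have h1 := hite (e.1 = e'.1) b1 hb1'
    have h2 := hite (e.1 = e'.2) b1 hb1'
    have h3 := hite (e.2 = e'.1) b1 hb1'
    have h4 := hite (e.2 = e'.2) b1 hb1'
    have h5 := hite (e.1 = e'.1) _ (hite (e.2 = e'.2) b2 hb2')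
    have h6 := hite (e.1 = e'.2) _ (hite (e.2 = e'.1) b2 hb2')
    simp only [B]
    linarith
  refine (integral_sq_sum_le J.offDiag (B := B)
    (fun e _ => M.memLp_triadDev n q i e.1 e.2) ?_).trans ?_
  · rintro ⟨j, k⟩ he ⟨j', k'⟩ he'
    obtain ⟨hj, hk, hjk⟩ := Finset.mem_offDiag.1 he
    obtain ⟨hj', hk', hjk'⟩ := Finset.mem_offDiag.1 he'
    simp only at hj hk hjk hj' hk' hjk'
    have hij : i ≠ j := fun h => hi (h ▸ hj)
    have hki : k ≠ i := fun h => hi (h ▸ hk)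
    have hij' : i ≠ j' := fun h => hi (h ▸ hj')
    have hki' : k' ≠ i := fun h => hi (h ▸ hk')
    have h1 := hite (j = j') b1 hb1'
    have h2 := hite (j = k') b1 hb1'
    have h3 := hite (k = j') b1 hb1'
    have h4 := hite (k = k') b1 hb1'
    have h5 := hite (j = j') _ (hite (k = k') b2 hb2')
    have h6 := hite (j = k') _ (hite (k = j') b2 hb2')
    by_cases hsame : (j = j' ∧ k = k') ∨ (j = k' ∧ k = j')
    · have hle := M.integral_triadDev_mul_le hc hcC hw hn q (t := s + 1) hij hjk hki hij' hjk' hki'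
        (by rw [← hq, ← card_triadEdges q hij hjk hki]
            exact Finset.card_le_card Finset.subset_union_left) (by omega)
      refine hle.trans ?_
      rw [← hb2]
      simp only [B]
      rcases hsame with ⟨e1, e2⟩ | ⟨e1, e2⟩
      · rw [if_pos e1, if_pos e2] at h5
        simp only [if_pos e1, if_pos e2] at *
        linarith
      · simp only [if_pos e1, if_pos e2] at *
        linarith
    · by_cases hany : j = j' ∨ j = k' ∨ k = j' ∨ k = k'
      · have hle := M.integral_triadDev_mul_le hc hcC hw hn q (t := 2 * s + 1) hij hjk hki hij' hjk'
          hki' (le_card_triadEdges_union hq hij hjk hki hij' hjk' hki' hsame) (by omega)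
        refine hle.trans ?_
        rw [← hb1]
        simp only [B]
        rcases hany with e | e | e | e
        · rw [if_pos e] at h1 ⊢
          linarith
        · rw [if_pos e] at h2
          rw [if_pos e (e := (0 : ℝ))]
          linarith
        · rw [if_pos e] at h3
          rw [if_pos e (e := (0 : ℝ))]
          linarith
        · rw [if_pos e] at h4
          rw [if_pos e (e := (0 : ℝ))]
          linarith
      · push Not at hany
        rw [M.integral_triadDev_mul_eq_zero n q hij hjk hki hij' hjk' hki' hany.1 hany.2.1
          hany.2.2.1 hany.2.2.2]
        exact hBnn _ _
  · have hsub : J.offDiag ⊆ J ×ˢ J := fun e he => by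
      obtain ⟨h1, h2, -⟩ := Finset.mem_offDiag.1 he
      exact Finset.mem_product.2 ⟨h1, h2⟩
    calc ∑ e ∈ J.offDiag, ∑ e' ∈ J.offDiag, B e e'
        ≤ ∑ e ∈ J ×ˢ J, ∑ e' ∈ J ×ˢ J, B e e' := by
          refine (Finset.sum_le_sum_of_subset_of_nonneg hsub fun e _ _ =>
            Finset.sum_nonneg fun e' _ => hBnn e e').trans ?_
          exact Finset.sum_le_sum fun e _ =>
            Finset.sum_le_sum_of_subset_of_nonneg hsub fun e' _ _ => hBnn e e'
      _ = 4 * b1 * (J.card : ℝ) ^ 3 + 2 * b2 * (J.card : ℝ) ^ 2 := by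
          have e1 : ∀ x ∈ J, ∀ b : ℝ, (∑ y ∈ J, if x = y then b else 0) = b := fun x hx b => by
            simp [hx]
          have e2 : ∀ x ∈ J, ∀ f : ℕ → ℝ, (∑ y ∈ J, if x = y then f y else 0) = f x :=
            fun x hx f => by simp [hx]
          simp only [B, Finset.sum_product, Finset.sum_add_distrib]
          have r1 : ∑ x ∈ J, ∑ y ∈ J, ∑ x' ∈ J, ∑ _y' ∈ J, (if x = x' then b1 else 0) =
              b1 * (J.card : ℝ) ^ 3 := by
            rw [Finset.sum_congr rfl fun x hx => Finset.sum_congr rfl fun y hy => by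
              rw [Finset.sum_comm, Finset.sum_congr rfl fun z _ => e1 x hx b1]]
            simp only [Finset.sum_const, nsmul_eq_mul]; ring
          have r2 : ∑ x ∈ J, ∑ y ∈ J, ∑ x' ∈ J, ∑ y' ∈ J, (if x = y' then b1 else 0) =
              b1 * (J.card : ℝ) ^ 3 := by
            rw [Finset.sum_congr rfl fun x hx => Finset.sum_congr rfl fun y hy => by
              rw [Finset.sum_congr rfl fun z _ => e1 x hx b1]]
            simp only [Finset.sum_const, nsmul_eq_mul]; ring
          have r3 : ∑ x ∈ J, ∑ y ∈ J, ∑ x' ∈ J, ∑ _y' ∈ J, (if y = x' then b1 else 0) =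
              b1 * (J.card : ℝ) ^ 3 := by
            rw [Finset.sum_congr rfl fun x hx => Finset.sum_congr rfl fun y hy => by
              rw [Finset.sum_comm, Finset.sum_congr rfl fun z _ => e1 y hy b1]]
            simp only [Finset.sum_const, nsmul_eq_mul]; ring
          have r4 : ∑ x ∈ J, ∑ y ∈ J, ∑ x' ∈ J, ∑ y' ∈ J, (if y = y' then b1 else 0) =
              b1 * (J.card : ℝ) ^ 3 := by
            rw [Finset.sum_congr rfl fun x hx => Finset.sum_congr rfl fun y hy => by
              rw [Finset.sum_congr rfl fun z _ => e1 y hy b1]]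
            simp only [Finset.sum_const, nsmul_eq_mul]; ring
          have r5 : ∑ x ∈ J, ∑ y ∈ J, ∑ x' ∈ J, ∑ y' ∈ J,
              (if x = x' then (if y = y' then b2 else 0) else 0) = b2 * (J.card : ℝ) ^ 2 := by
            rw [Finset.sum_congr rfl fun x hx => Finset.sum_congr rfl fun y hy => by
              rw [Finset.sum_comm, Finset.sum_congr rfl fun z _ =>
                e2 x hx (fun _ => if y = z then b2 else 0), e1 y hy b2]]
            simp only [Finset.sum_const, nsmul_eq_mul]; ring
          have r6 : ∑ x ∈ J, ∑ y ∈ J, ∑ x' ∈ J, ∑ y' ∈ J,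
              (if x = y' then (if y = x' then b2 else 0) else 0) = b2 * (J.card : ℝ) ^ 2 := by
            rw [Finset.sum_congr rfl fun x hx => Finset.sum_congr rfl fun y hy => by
              rw [Finset.sum_congr rfl fun z _ =>
                e2 x hx (fun _ => if y = z then b2 else 0), e1 y hy b2]]
            simp only [Finset.sum_const, nsmul_eq_mul]; ring
          rw [r1, r2, r3, r4, r5, r6]
          ring
      _ = _ := by rw [hb1, hb2]; ring

end

/-! ### Weighted degrees -/

section

variable {Ω : Type*} [MeasurableSpace Ω] {P : Measure Ω} {p d : ℕ}

/-- The sources, other than the position of `i`, that determine the contribution of `j` to a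
weighted degree of `i`. -/
def nbrData (M : SparseGraphonModel P p) (i j : ℕ) (ω : Ω) :
    (EuclideanSpace ℝ (Fin p) × unitInterval) × unitInterval :=
  ((M.X j ω, M.ξ j ω), M.edgeVar (pairIdx i j) ω)

/-- The contribution of a node to a degree weighted by `g (X j)`. -/
def weightedEdge (M : SparseGraphonModel P p) (n : ℕ) (g : EuclideanSpace ℝ (Fin p) → ℝ)
    (x : unitInterval) (U : (EuclideanSpace ℝ (Fin p) × unitInterval) × unitInterval) : ℝ :=
  M.edgeFn n x U.1.2 U.2 * g U.1.1

/-- The law of `nbrData`. -/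
def nbrLaw (M : SparseGraphonModel P p) :
    Measure ((EuclideanSpace ℝ (Fin p) × unitInterval) × unitInterval) :=
  (P.map fun ω => (M.X 0 ω, M.ξ 0 ω)).prod volume

instance [IsProbabilityMeasure P] (M : SparseGraphonModel P p) : IsProbabilityMeasure M.nbrLaw := by
  have : IsProbabilityMeasure (P.map fun ω => (M.X 0 ω, M.ξ 0 ω)) :=
    Measure.isProbabilityMeasure_map ((M.measurable_X 0).prodMk (M.measurable_ξ 0)).aemeasurable
  unfold nbrLaw
  infer_instance

/-- The mean of `w (x, ξ) g (X)`. -/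
def latentNbr (M : SparseGraphonModel P p) (g : EuclideanSpace ℝ (Fin p) → ℝ)
    (x : unitInterval) : ℝ :=
  ∫ ω, M.w x (M.ξ 0 ω) * g (M.X 0 ω) ∂P

lemma measurable_nbrData (M : SparseGraphonModel P p) (i j : ℕ) : Measurable (M.nbrData i j) :=
  ((M.measurable_X j).prodMk (M.measurable_ξ j)).prodMk (M.measurable_edgeVar _)

lemma measurable_nbrData_sigmaOf (M : SparseGraphonModel P p) {i j : ℕ} {S : Set Source}
    (hj : .inl j ∈ S) (hij : .inr (pairIdx i j) ∈ S) : Measurable[M.sigmaOf S] (M.nbrData i j) :=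
  ((M.measurable_X_sigmaOf hj).prodMk (M.measurable_ξ_sigmaOf hj)).prodMk
    (M.measurable_edgeVar_sigmaOf hij)

lemma identDistrib_X_ξ (M : SparseGraphonModel P p) (j : ℕ) :
    IdentDistrib (fun ω => (M.X j ω, M.ξ j ω)) (fun ω => (M.X 0 ω, M.ξ 0 ω)) P P :=
  (M.identDistrib_triple j).comp measurable_snd

lemma map_nbrData [IsProbabilityMeasure P] (M : SparseGraphonModel P p) (i j : ℕ) :
    P.map (M.nbrData i j) = M.nbrLaw := by
  unfold nbrData nbrLaw
  rw [M.map_prodMk_of_disjoint (S := {.inl j}) (T := {.inr (pairIdx i j)}) (by simp)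
    ((M.measurable_X_sigmaOf (by simp)).prodMk (M.measurable_ξ_sigmaOf (by simp)))
    (M.measurable_edgeVar_sigmaOf (by simp)), M.map_edgeVar, (M.identDistrib_X_ξ j).map_eq]

lemma measurable_weightedEdge (M : SparseGraphonModel P p) (n : ℕ)
    {g : EuclideanSpace ℝ (Fin p) → ℝ} (hg : Measurable g) :
    Measurable (Function.uncurry (M.weightedEdge n g)) := by
  have h : Measurable fun z : unitInterval × (EuclideanSpace ℝ (Fin p) × unitInterval) ×
      unitInterval => M.edgeFn n z.1 z.2.1.2 z.2.2 :=
    (M.measurable_edgeFn n).comp (f := fun z : unitInterval ×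
      (EuclideanSpace ℝ (Fin p) × unitInterval) × unitInterval => (z.1, z.2.1.2, z.2.2))
      (by fun_prop)
  exact h.mul (hg.comp (by fun_prop))

lemma ae_ae_w_ξ_bounds (M : SparseGraphonModel P p) {c C : ℝ}
    (hw : ∀ᵐ z ∂(volume : Measure (unitInterval × unitInterval)),
      c ≤ M.w z.1 z.2 ∧ M.w z.1 z.2 ≤ C) :
    ∀ᵐ x : unitInterval, ∀ᵐ ω ∂P, c ≤ M.w x (M.ξ 0 ω) ∧ M.w x (M.ξ 0 ω) ≤ C := by
  filter_upwards [Measure.ae_ae_of_ae_prod hw] with x hx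
  rw [← M.map_ξ 0] at hx
  exact ae_of_ae_map (M.measurable_ξ 0).aemeasurable hx

lemma measurable_w_left (M : SparseGraphonModel P p) (x : unitInterval) : Measurable (M.w x) :=
  M.measurable_w.comp measurable_prodMk_left

lemma ae_latentNbr (M : SparseGraphonModel P p) {c C : ℝ} (hc : 0 < c)
    (hw : ∀ᵐ z ∂(volume : Measure (unitInterval × unitInterval)),
      c ≤ M.w z.1 z.2 ∧ M.w z.1 z.2 ≤ C) {g : EuclideanSpace ℝ (Fin p) → ℝ} (hg : Measurable g)
    (hgi : Integrable (fun ω => g (M.X 0 ω)) P) :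
    ∀ᵐ x : unitInterval, Integrable (fun ω => M.w x (M.ξ 0 ω) * g (M.X 0 ω)) P ∧
      |M.latentNbr g x| ≤ C * ∫ ω, |g (M.X 0 ω)| ∂P := by
  filter_upwards [M.ae_ae_w_ξ_bounds hw] with x hx
  have hb : ∀ᵐ ω ∂P, ‖M.w x (M.ξ 0 ω) * g (M.X 0 ω)‖ ≤ C * |g (M.X 0 ω)| := by
    filter_upwards [hx] with ω h
    rw [norm_mul, Real.norm_eq_abs, Real.norm_eq_abs, abs_of_nonneg (hc.le.trans h.1)]
    exact mul_le_mul_of_nonneg_right h.2 (abs_nonneg _)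
  have hm : Measurable fun ω => M.w x (M.ξ 0 ω) * g (M.X 0 ω) :=
    ((M.measurable_w_left x).comp (M.measurable_ξ 0)).mul (hg.comp (M.measurable_X 0))
  refine ⟨(hgi.abs.const_mul C).mono' hm.aestronglyMeasurable hb, ?_⟩
  rw [← integral_const_mul]
  exact norm_integral_le_of_norm_le (hgi.abs.const_mul C) hb

/-- The conditional mean of a weighted edge given the position of the root. -/
lemma ae_integral_weightedEdge [IsProbabilityMeasure P] (M : SparseGraphonModel P p) {c C : ℝ}
    (hc : 0 < c) (hw : ∀ᵐ z ∂(volume : Measure (unitInterval × unitInterval)),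
      c ≤ M.w z.1 z.2 ∧ M.w z.1 z.2 ≤ C) {n : ℕ} (hn : M.ρ n * C ≤ 1)
    {g : EuclideanSpace ℝ (Fin p) → ℝ} (hg : Measurable g)
    (hgi : Integrable (fun ω => g (M.X 0 ω)) P) :
    ∀ᵐ x : unitInterval, ∫ U, M.weightedEdge n g x U ∂M.nbrLaw = M.ρ n * M.latentNbr g x := by
  filter_upwards [M.ae_ae_w_ξ_bounds hw] with x hx
  have hXξ : Measurable fun ω => (M.X 0 ω, M.ξ 0 ω) := (M.measurable_X 0).prodMk (M.measurable_ξ 0)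
  have hprob : IsProbabilityMeasure (P.map fun ω => (M.X 0 ω, M.ξ 0 ω)) :=
    Measure.isProbabilityMeasure_map hXξ.aemeasurable
  have hρ := M.ρ_pos n
  have hg' : Integrable (fun U : (EuclideanSpace ℝ (Fin p) × unitInterval) × unitInterval =>
      g U.1.1) M.nbrLaw := by
    have h1 : Integrable (fun z : EuclideanSpace ℝ (Fin p) × unitInterval => g z.1)
        (P.map fun ω => (M.X 0 ω, M.ξ 0 ω)) :=
      (integrable_map_measure (hg.comp measurable_fst).aestronglyMeasurable hXξ.aemeasurable).2 hgi
    exact h1.comp_fst _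
  have hmeas : Measurable (M.weightedEdge n g x) :=
    (M.measurable_weightedEdge n hg).comp measurable_prodMk_left
  have hint : Integrable (M.weightedEdge n g x) M.nbrLaw := by
    refine hg'.abs.mono' hmeas.aestronglyMeasurable (Eventually.of_forall fun U => ?_)
    rw [weightedEdge, norm_mul, Real.norm_eq_abs, Real.norm_eq_abs,
      abs_of_nonneg (M.edgeFn_nonneg _ _ _ _)]
    exact mul_le_of_le_one_left (abs_nonneg _) (M.edgeFn_le_one _ _ _ _)
  rw [nbrLaw] at hint ⊢
  rw [integral_prod _ hint]
  simp only [weightedEdge, integral_mul_const]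
  have hmeas' : Measurable fun z : EuclideanSpace ℝ (Fin p) × unitInterval =>
      (∫ u, M.edgeFn n x z.2 u) * g z.1 := by
    have h1 : Measurable fun z : (EuclideanSpace ℝ (Fin p) × unitInterval) × unitInterval =>
        M.edgeFn n x z.1.2 z.2 :=
      (M.measurable_edgeFn n).comp (f := fun z : (EuclideanSpace ℝ (Fin p) × unitInterval) ×
        unitInterval => (x, z.1.2, z.2)) (by fun_prop)
    exact (h1.stronglyMeasurable.integral_prod_right'
      (ν := (volume : Measure unitInterval))).measurable.mul (hg.comp measurable_fst)
  rw [integral_map hXξ.aemeasurable hmeas'.aestronglyMeasurable, latentNbr, ← integral_const_mul]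
  refine integral_congr_ae ?_
  filter_upwards [hx] with ω h
  rw [M.integral_edgeFn n (mul_nonneg hρ.le (hc.le.trans h.1))
    ((mul_le_mul_of_nonneg_left h.2 hρ.le).trans hn), mul_assoc]

/-- The deviation of a weighted edge from its conditional mean given the position of the root. -/
def nbrDev (M : SparseGraphonModel P p) (n : ℕ) (g : EuclideanSpace ℝ (Fin p) → ℝ) (i j : ℕ)
    (ω : Ω) : ℝ :=
  M.adj n ω i j * g (M.X j ω) - ∫ U, M.weightedEdge n g (M.ξ i ω) U ∂M.nbrLaw

lemma integral_nbrDev_mul_eq_zero [IsProbabilityMeasure P] (M : SparseGraphonModel P p) (n : ℕ)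
    {g : EuclideanSpace ℝ (Fin p) → ℝ} (hg : Measurable g) {i j k : ℕ} (hij : i ≠ j) (hik : i ≠ k)
    (hjk : j ≠ k) : ∫ ω, M.nbrDev n g i j ω * M.nbrDev n g i k ω ∂P = 0 := by
  simp only [nbrDev, M.adj_eq_edgeFn n hij, M.adj_eq_edgeFn n hik]
  have hne : pairIdx i j ≠ pairIdx i k := by rw [Ne, pairIdx_eq_iff hij hik]; omega
  refine integral_centered_mul_eq_zero (M.measurable_ξ i) (M.measurable_nbrData i j)
    (M.measurable_nbrData i k) (M.map_nbrData i j) (M.map_nbrData i k) ?_ ?_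
    (M.measurable_weightedEdge n hg)
  · refine M.indepFun_of_disjoint (S := {.inl j, .inr (pairIdx i j)})
      (T := {.inl k, .inr (pairIdx i k)}) (by simp [hne.symm, hjk.symm])
      (M.measurable_nbrData_sigmaOf (by simp) (by simp))
      (M.measurable_nbrData_sigmaOf (by simp) (by simp))
  · exact M.indepFun_of_disjoint (S := {.inl i})
      (T := {.inl j, .inr (pairIdx i j), .inl k, .inr (pairIdx i k)}) (by simp [hij, hik])
      (M.measurable_ξ_sigmaOf (by simp))
      ((M.measurable_nbrData_sigmaOf (by simp) (by simp)).prodMk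
        (M.measurable_nbrData_sigmaOf (by simp) (by simp)))

lemma identDistrib_X (M : SparseGraphonModel P p) (j : ℕ) : IdentDistrib (M.X j) (M.X 0) P P :=
  (M.identDistrib_X_ξ j).comp measurable_fst

lemma memLp_adj_mul (M : SparseGraphonModel P p) (n : ℕ) {g : EuclideanSpace ℝ (Fin p) → ℝ}
    (hg : Measurable g) (hg2 : MemLp (fun ω => g (M.X 0 ω)) 2 P) (i j : ℕ) :
    MemLp (fun ω => M.adj n ω i j * g (M.X j ω)) 2 P := by
  have hgj : MemLp (fun ω => g (M.X j ω)) 2 P :=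
    ((M.identDistrib_X j).comp hg).memLp_iff.2 hg2
  refine hgj.mono ((M.measurable_adj n i j).mul (hg.comp (M.measurable_X j))).aestronglyMeasurable
    (Eventually.of_forall fun ω => ?_)
  rw [norm_mul, Real.norm_eq_abs (M.adj n ω i j), abs_of_nonneg (M.adj_nonneg n i j ω)]
  exact mul_le_of_le_one_left (norm_nonneg _) (M.adj_le_one n i j ω)

variable [IsProbabilityMeasure P]

lemma ae_sq_integral_weightedEdge_le (M : SparseGraphonModel P p) {c C : ℝ}
    (hc : 0 < c) (hcC : c ≤ C) (hw : ∀ᵐ z ∂(volume : Measure (unitInterval × unitInterval)),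
      c ≤ M.w z.1 z.2 ∧ M.w z.1 z.2 ≤ C) {n : ℕ} (hn : M.ρ n * C ≤ 1)
    {g : EuclideanSpace ℝ (Fin p) → ℝ} (hg : Measurable g)
    (hgi : Integrable (fun ω => g (M.X 0 ω)) P) (i : ℕ) :
    ∀ᵐ ω ∂P, (∫ U, M.weightedEdge n g (M.ξ i ω) U ∂M.nbrLaw) ^ 2 ≤
      M.ρ n * C * (∫ ω, |g (M.X 0 ω)| ∂P) ^ 2 := by
  have h : ∀ᵐ x, (∫ U, M.weightedEdge n g x U ∂M.nbrLaw) ^ 2 ≤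
      M.ρ n * C * (∫ ω, |g (M.X 0 ω)| ∂P) ^ 2 := by
    filter_upwards [M.ae_integral_weightedEdge hc hw hn hg hgi, M.ae_latentNbr hc hw hg hgi]
      with x h1 h2
    have hb : 0 ≤ M.ρ n * C := mul_nonneg (M.ρ_pos n).le (hc.le.trans hcC)
    have h3 : |∫ U, M.weightedEdge n g x U ∂M.nbrLaw| ≤
        M.ρ n * C * ∫ ω, |g (M.X 0 ω)| ∂P := by
      rw [h1, abs_mul, abs_of_pos (M.ρ_pos n), mul_assoc]
      exact mul_le_mul_of_nonneg_left h2.2 (M.ρ_pos n).le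
    calc _ = |∫ U, M.weightedEdge n g x U ∂M.nbrLaw| ^ 2 := (sq_abs _).symm
      _ ≤ (M.ρ n * C * ∫ ω, |g (M.X 0 ω)| ∂P) ^ 2 := pow_le_pow_left₀ (abs_nonneg _) h3 2
      _ = (M.ρ n * C) * ((M.ρ n * C) * (∫ ω, |g (M.X 0 ω)| ∂P) ^ 2) := by ring
      _ ≤ (M.ρ n * C) * (1 * (∫ ω, |g (M.X 0 ω)| ∂P) ^ 2) := by gcongr
      _ = _ := by ring
  rw [← M.map_ξ i] at h
  exact ae_of_ae_map (M.measurable_ξ i).aemeasurable h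

lemma memLp_nbrDev (M : SparseGraphonModel P p) {c C : ℝ}
    (hc : 0 < c) (hcC : c ≤ C) (hw : ∀ᵐ z ∂(volume : Measure (unitInterval × unitInterval)),
      c ≤ M.w z.1 z.2 ∧ M.w z.1 z.2 ≤ C) {n : ℕ} (hn : M.ρ n * C ≤ 1)
    {g : EuclideanSpace ℝ (Fin p) → ℝ} (hg : Measurable g)
    (hg2 : MemLp (fun ω => g (M.X 0 ω)) 2 P) (i j : ℕ) : MemLp (M.nbrDev n g i j) 2 P := by
  refine (M.memLp_adj_mul n hg hg2 i j).sub ?_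
  have hmeas : Measurable fun x => ∫ U, M.weightedEdge n g x U ∂M.nbrLaw :=
    ((M.measurable_weightedEdge n hg).stronglyMeasurable.integral_prod_right
      (ν := M.nbrLaw)).measurable
  refine MemLp.of_bound (hmeas.comp (M.measurable_ξ i)).aestronglyMeasurable
    (Real.sqrt (M.ρ n * C * (∫ ω, |g (M.X 0 ω)| ∂P) ^ 2)) ?_
  filter_upwards [M.ae_sq_integral_weightedEdge_le hc hcC hw hn hg (hg2.integrable (by norm_num)) i]
    with ω h
  exact Real.abs_le_sqrt h

lemma integral_sq_nbrDev_le (M : SparseGraphonModel P p) {c C : ℝ}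
    (hc : 0 < c) (hcC : c ≤ C) (hw : ∀ᵐ z ∂(volume : Measure (unitInterval × unitInterval)),
      c ≤ M.w z.1 z.2 ∧ M.w z.1 z.2 ≤ C) {n : ℕ} (hn : M.ρ n * C ≤ 1)
    {g : EuclideanSpace ℝ (Fin p) → ℝ} (hg : Measurable g)
    (hg2 : MemLp (fun ω => g (M.X 0 ω)) 2 P) {i j : ℕ} (hij : i ≠ j) :
    ∫ ω, M.nbrDev n g i j ω * M.nbrDev n g i j ω ∂P ≤
      2 * (M.ρ n * C) * (∫ ω, g (M.X 0 ω) ^ 2 ∂P + (∫ ω, |g (M.X 0 ω)| ∂P) ^ 2) := by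
  have hb : 0 ≤ M.ρ n * C := mul_nonneg (M.ρ_pos n).le (hc.le.trans hcC)
  set G := (∫ ω, |g (M.X 0 ω)| ∂P) ^ 2 with hG
  let S : Set unitInterval := {u | (u : ℝ) ≤ M.ρ n * C}
  have hS : MeasurableSet S := measurableSet_le measurable_subtype_coe measurable_const
  have hgj : MemLp (fun ω => g (M.X j ω)) 2 P :=
    ((M.identDistrib_X j).comp hg).memLp_iff.2 hg2
  have hmS : Measurable (S.indicator fun _ => (1 : ℝ)) := measurable_const.indicator hS
  have hind : IndepFun (fun ω => S.indicator (fun _ => (1 : ℝ)) (M.edgeVar (pairIdx i j) ω))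
      (fun ω => g (M.X j ω) ^ 2) P := by
    refine M.indepFun_of_disjoint (S := {.inr (pairIdx i j)}) (T := {.inl j}) (by simp)
      (hmS.comp (M.measurable_edgeVar_sigmaOf (by simp))) ?_
    exact (hg.pow_const 2).comp (M.measurable_X_sigmaOf (by simp))
  have hprod : ∫ ω, S.indicator (fun _ => (1 : ℝ)) (M.edgeVar (pairIdx i j) ω) *
      g (M.X j ω) ^ 2 ∂P = M.ρ n * C * ∫ ω, g (M.X 0 ω) ^ 2 ∂P := by
    rw [hind.integral_fun_mul_eq_mul_integral
      (hmS.comp (M.measurable_edgeVar _)).aestronglyMeasurable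
      ((hg.comp (M.measurable_X j)).pow_const 2).aestronglyMeasurable]
    congr 1
    · have := integral_map (M.measurable_edgeVar (pairIdx i j)).aemeasurable (μ := P)
        (f := S.indicator fun _ => (1 : ℝ)) hmS.aestronglyMeasurable
      rw [← this, M.map_edgeVar, integral_indicator_const _ hS, measureReal_def,
        volume_coe_le hb hn, ENNReal.toReal_ofReal hb, smul_eq_mul, mul_one]
    · exact ((M.identDistrib_X j).comp (hg.pow_const 2)).integral_eq
  have hint : Integrable (fun ω => S.indicator (fun _ => (1 : ℝ)) (M.edgeVar (pairIdx i j) ω) *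
      g (M.X j ω) ^ 2) P := by
    refine hgj.integrable_sq.mono ((hmS.comp (M.measurable_edgeVar _)).mul
      ((hg.comp (M.measurable_X j)).pow_const 2)).aestronglyMeasurable
      (Eventually.of_forall fun ω => ?_)
    rw [norm_mul]
    refine mul_le_of_le_one_left (norm_nonneg _) ?_
    rw [Set.indicator_apply]
    split_ifs <;> simp
  have hdev := M.memLp_nbrDev hc hcC hw hn hg hg2 i j
  calc ∫ ω, M.nbrDev n g i j ω * M.nbrDev n g i j ω ∂P
      ≤ ∫ ω, (2 * (S.indicator (fun _ => (1 : ℝ)) (M.edgeVar (pairIdx i j) ω) *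
          g (M.X j ω) ^ 2) + 2 * (M.ρ n * C * G)) ∂P := by
        refine integral_mono_ae (hdev.integrable_mul hdev)
          ((hint.const_mul 2).add (integrable_const _)) ?_
        filter_upwards [M.ae_edgeVar_le_of_adj_ne_zero hw n,
          M.ae_sq_integral_weightedEdge_le hc hcC hw hn hg (hg2.integrable (by norm_num)) i]
          with ω h1 h2
        have h3 : (M.adj n ω i j * g (M.X j ω)) ^ 2 ≤
            S.indicator (fun _ => (1 : ℝ)) (M.edgeVar (pairIdx i j) ω) * g (M.X j ω) ^ 2 := by
          rw [mul_pow]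
          refine mul_le_mul_of_nonneg_right ?_ (sq_nonneg _)
          by_cases h0 : M.adj n ω i j = 0
          · rw [h0, zero_pow two_ne_zero]
            exact Set.indicator_nonneg (fun _ _ => zero_le_one) _
          · rw [Set.indicator_of_mem (show M.edgeVar (pairIdx i j) ω ∈ S from h1 i j hij h0)]
            exact pow_le_one₀ (M.adj_nonneg n i j ω) (M.adj_le_one n i j ω)
        simp only [nbrDev]
        nlinarith [sq_nonneg (M.adj n ω i j * g (M.X j ω) +
          ∫ U, M.weightedEdge n g (M.ξ i ω) U ∂M.nbrLaw)]
    _ = _ := by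
        rw [integral_add (hint.const_mul 2) (integrable_const _), integral_const_mul, hprod]
        simp only [integral_const, probReal_univ, smul_eq_mul, one_mul]
        ring

/-- Deviations at different neighbors are orthogonal, so that the conditional variance of a weighted
degree is of the order of the mean degree. -/
lemma integral_sq_sum_nbrDev_le (M : SparseGraphonModel P p) {c C : ℝ}
    (hc : 0 < c) (hcC : c ≤ C) (hw : ∀ᵐ z ∂(volume : Measure (unitInterval × unitInterval)),
      c ≤ M.w z.1 z.2 ∧ M.w z.1 z.2 ≤ C) {n : ℕ} (hn : M.ρ n * C ≤ 1)
    {g : EuclideanSpace ℝ (Fin p) → ℝ} (hg : Measurable g)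
    (hg2 : MemLp (fun ω => g (M.X 0 ω)) 2 P) {J : Finset ℕ} {i : ℕ} (hi : i ∉ J) :
    ∫ ω, (∑ j ∈ J, M.nbrDev n g i j ω) ^ 2 ∂P ≤
      2 * (M.ρ n * C) * (∫ ω, g (M.X 0 ω) ^ 2 ∂P + (∫ ω, |g (M.X 0 ω)| ∂P) ^ 2) * J.card := by
  set b := 2 * (M.ρ n * C) * (∫ ω, g (M.X 0 ω) ^ 2 ∂P + (∫ ω, |g (M.X 0 ω)| ∂P) ^ 2)
  refine (integral_sq_sum_le J (B := fun j k => if j = k then b else 0)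
    (fun j _ => M.memLp_nbrDev hc hcC hw hn hg hg2 i j) ?_).trans ?_
  · intro j hj k hk
    have hij : i ≠ j := fun h => hi (h ▸ hj)
    have hik : i ≠ k := fun h => hi (h ▸ hk)
    by_cases hjk : j = k
    · subst hjk
      simpa using M.integral_sq_nbrDev_le hc hcC hw hn hg hg2 hij
    · simpa [hjk] using (M.integral_nbrDev_mul_eq_zero n hg hij hik hjk).le
  · rw [Finset.sum_congr rfl fun j hj => by
      rw [Finset.sum_ite_eq, if_pos hj]]
    simp [mul_comm]

end

/-! ### Tail bounds for the network covariates -/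

section

variable {Ω : Type*} [MeasurableSpace Ω] {P : Measure Ω} {p d : ℕ}

/-- Chebyshev's inequality. -/
lemma measureReal_lt_abs_le [IsFiniteMeasure P] {S : Ω → ℝ} (hS : MemLp S 2 P) {B t : ℝ}
    (hB : ∫ ω, S ω ^ 2 ∂P ≤ B) (ht : 0 < t) : P.real {ω | t < |S ω|} ≤ B / t ^ 2 := by
  have h := mul_meas_ge_le_integral_of_nonneg (μ := P) (f := fun ω => S ω ^ 2)
    (Eventually.of_forall fun ω => sq_nonneg _) hS.integrable_sq (t ^ 2)
  have hsub : P.real {ω | t < |S ω|} ≤ P.real {ω | t ^ 2 ≤ S ω ^ 2} := by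
    refine measureReal_mono fun ω hω => ?_
    have h1 : t < |S ω| := hω
    have h2 : t ^ 2 ≤ |S ω| ^ 2 := pow_le_pow_left₀ ht.le h1.le 2
    rwa [sq_abs] at h2
  rw [le_div_iff₀ (by positivity)]
  nlinarith [mul_le_mul_of_nonneg_left hsub (sq_nonneg t)]

/-- Normalized rooted subgraph count. -/
def triadRatio (M : SparseGraphonModel P p) (n : ℕ) (q : Bool × Bool × Bool) (J : Finset ℕ) (i : ℕ)
    (ω : Ω) : ℝ :=
  (∑ e ∈ J.offDiag, triad q (M.adj n ω i e.1) (M.adj n ω e.1 e.2) (M.adj n ω e.2 i)) /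
    ((J.card : ℝ) * (J.card - 1) * M.ρ n ^ triadSize q)

/-- Normalized weighted degree. -/
def nbrRatio (M : SparseGraphonModel P p) (n : ℕ) (g : EuclideanSpace ℝ (Fin p) → ℝ)
    (J : Finset ℕ) (i : ℕ) (ω : Ω) : ℝ :=
  (∑ j ∈ J, M.adj n ω i j * g (M.X j ω)) / (J.card * M.ρ n)

section

variable [IsProbabilityMeasure P]

lemma measureReal_triadRatio_le (M : SparseGraphonModel P p) {c C : ℝ} (hc : 0 < c) (hcC : c ≤ C)
    (hw : ∀ᵐ z ∂(volume : Measure (unitInterval × unitInterval)),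
      c ≤ M.w z.1 z.2 ∧ M.w z.1 z.2 ≤ C) {n : ℕ} (hn : M.ρ n * C ≤ 1) {q : Bool × Bool × Bool}
    {s : ℕ} (hq : triadSize q = s + 1) {J : Finset ℕ} (hJ : 2 ≤ J.card) {i : ℕ} (hi : i ∉ J)
    {t : ℝ} (ht : 0 < t) :
    P.real {ω | t < |M.triadRatio n q J i ω - M.latentTriad q (M.ξ i ω)|} ≤
      (32 * C ^ (2 * s + 1) / (J.card * M.ρ n) +
        16 * C ^ (s + 1) / ((J.card : ℝ) ^ 2 * M.ρ n ^ (s + 1))) / t ^ 2 := by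
  have hρ := M.ρ_pos n
  have hC : 0 < C := hc.trans_le hcC
  have hN : (2 : ℝ) ≤ J.card := by exact_mod_cast hJ
  set N : ℝ := (J.card : ℝ) with hNdef
  have hN1 : 0 < N - 1 := by linarith
  have hN0 : 0 < N := by linarith
  set τ := t * (N * (N - 1) * M.ρ n ^ (s + 1)) with hτ
  have hden : 0 < N * (N - 1) * M.ρ n ^ (s + 1) := by positivity
  have hτ0 : 0 < τ := by positivity
  have hcard : (J.offDiag.card : ℝ) = N * (N - 1) := by
    rw [Finset.offDiag_card, Nat.cast_sub (Nat.le_mul_self _), Nat.cast_mul]; ring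
  have hmean : ∀ᵐ ω ∂P, ∫ U, M.rootedTriad n q (M.ξ i ω) U =
      M.ρ n ^ (s + 1) * M.latentTriad q (M.ξ i ω) := by
    have h := M.ae_integral_rootedTriad hc hw hn q
    rw [← M.map_ξ i, hq] at h
    exact ae_of_ae_map (M.measurable_ξ i).aemeasurable h
  have hmem : MemLp (fun ω => ∑ e ∈ J.offDiag, M.triadDev n q i e.1 e.2 ω) 2 P :=
    memLp_finsetSum _ fun e _ => M.memLp_triadDev n q i e.1 e.2
  have htail := measureReal_lt_abs_le hmem
    (M.integral_sq_sum_triadDev_le hc hcC hw hn hq hi) hτ0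
  calc P.real {ω | t < |M.triadRatio n q J i ω - M.latentTriad q (M.ξ i ω)|}
      ≤ P.real {ω | τ < |∑ e ∈ J.offDiag, M.triadDev n q i e.1 e.2 ω|} := by
        refine ENNReal.toReal_mono (measure_ne_top _ _) (measure_mono_ae ?_)
        filter_upwards [hmean] with ω hω hlt
        change t < _ at hlt
        change τ < _
        have hsum : ∑ e ∈ J.offDiag, M.triadDev n q i e.1 e.2 ω =
            (M.triadRatio n q J i ω - M.latentTriad q (M.ξ i ω)) *
              (N * (N - 1) * M.ρ n ^ (s + 1)) := by
          simp only [triadDev, Finset.sum_sub_distrib, Finset.sum_const, nsmul_eq_mul, hω, hcard]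
          rw [sub_mul, triadRatio, hq, div_mul_cancel₀ _ hden.ne']
          ring
        rw [hsum, abs_mul, abs_of_pos hden, hτ]
        exact mul_lt_mul_of_pos_right hlt hden
    _ ≤ _ := htail
    _ ≤ _ := by
        have hN2 : N / 2 ≤ N - 1 := by linarith
        have h1 : (t * (N * (N / 2) * M.ρ n ^ (s + 1))) ^ 2 ≤ τ ^ 2 := by
          rw [hτ]; gcongr
        have hpos : 0 < (t * (N * (N / 2) * M.ρ n ^ (s + 1))) ^ 2 := by positivity
        refine (div_le_div_of_nonneg_left (by positivity) hpos h1).trans (le_of_eq ?_)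
        rw [mul_pow (M.ρ n), mul_pow (M.ρ n)]
        field_simp
        ring

lemma measureReal_nbrRatio_le (M : SparseGraphonModel P p) {c C : ℝ} (hc : 0 < c) (hcC : c ≤ C)
    (hw : ∀ᵐ z ∂(volume : Measure (unitInterval × unitInterval)),
      c ≤ M.w z.1 z.2 ∧ M.w z.1 z.2 ≤ C) {n : ℕ} (hn : M.ρ n * C ≤ 1)
    {g : EuclideanSpace ℝ (Fin p) → ℝ} (hg : Measurable g)
    (hg2 : MemLp (fun ω => g (M.X 0 ω)) 2 P) {J : Finset ℕ} (hJ : 1 ≤ J.card) {i : ℕ} (hi : i ∉ J)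
    {t : ℝ} (ht : 0 < t) :
    P.real {ω | t < |M.nbrRatio n g J i ω - M.latentNbr g (M.ξ i ω)|} ≤
      2 * C * (∫ ω, g (M.X 0 ω) ^ 2 ∂P + (∫ ω, |g (M.X 0 ω)| ∂P) ^ 2) / (J.card * M.ρ n) /
        t ^ 2 := by
  have hρ := M.ρ_pos n
  have hN0 : (0 : ℝ) < J.card := by exact_mod_cast hJ
  set N : ℝ := (J.card : ℝ) with hNdef
  have hden : 0 < N * M.ρ n := by positivity
  have hmean : ∀ᵐ ω ∂P, ∫ U, M.weightedEdge n g (M.ξ i ω) U ∂M.nbrLaw =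
      M.ρ n * M.latentNbr g (M.ξ i ω) := by
    have h := M.ae_integral_weightedEdge hc hw hn hg (hg2.integrable (by norm_num))
    rw [← M.map_ξ i] at h
    exact ae_of_ae_map (M.measurable_ξ i).aemeasurable h
  have hmem : MemLp (fun ω => ∑ j ∈ J, M.nbrDev n g i j ω) 2 P :=
    memLp_finsetSum _ fun j _ => M.memLp_nbrDev hc hcC hw hn hg hg2 i j
  have htail := measureReal_lt_abs_le hmem
    (M.integral_sq_sum_nbrDev_le hc hcC hw hn hg hg2 hi) (mul_pos ht hden)
  calc P.real {ω | t < |M.nbrRatio n g J i ω - M.latentNbr g (M.ξ i ω)|}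
      ≤ P.real {ω | t * (N * M.ρ n) < |∑ j ∈ J, M.nbrDev n g i j ω|} := by
        refine ENNReal.toReal_mono (measure_ne_top _ _) (measure_mono_ae ?_)
        filter_upwards [hmean] with ω hω hlt
        change t < _ at hlt
        change t * (N * M.ρ n) < _
        have hsum : ∑ j ∈ J, M.nbrDev n g i j ω =
            (M.nbrRatio n g J i ω - M.latentNbr g (M.ξ i ω)) * (N * M.ρ n) := by
          simp only [nbrDev, Finset.sum_sub_distrib, Finset.sum_const, nsmul_eq_mul, hω]
          rw [sub_mul, nbrRatio, div_mul_cancel₀ _ hden.ne']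
          ring
        rw [hsum, abs_mul, abs_of_pos hden]
        exact mul_lt_mul_of_pos_right hlt hden
    _ ≤ _ := htail
    _ = _ := by
        rw [← hNdef]
        field_simp

end

/-- Stability of a quotient whose denominator is bounded away from zero. -/
lemma abs_div_sub_div_le {a b α β A κ t : ℝ} (hκ : 0 < κ) (hβ : κ ≤ β) (hα : |α| ≤ A)
    (ha : |a - α| ≤ t) (hb : |b - β| ≤ t) (ht : t ≤ κ / 2) :
    |a / b - α / β| ≤ (2 / κ + 2 * A / κ ^ 2) * t := by
  have ht0 : 0 ≤ t := (abs_nonneg _).trans ha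
  have hb' : κ / 2 ≤ b := by linarith [(abs_le.1 hb).1]
  have hβ0 : 0 < β := hκ.trans_le hβ
  have hb0 : 0 < b := (half_pos hκ).trans_le hb'
  have hA : 0 ≤ A := (abs_nonneg _).trans hα
  have h : a / b - α / β = (a - α) / b - α * (b - β) / (b * β) := by
    field_simp; ring
  have h1 : |(a - α) / b| ≤ t / (κ / 2) := by
    rw [abs_div, abs_of_pos hb0]
    exact div_le_div₀ ht0 ha (by positivity) hb'
  have h2 : |α * (b - β) / (b * β)| ≤ A * t / (κ / 2 * κ) := by
    rw [abs_div, abs_mul, abs_of_pos (mul_pos hb0 hβ0)]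
    exact div_le_div₀ (by positivity) (mul_le_mul hα hb (abs_nonneg _) hA) (by positivity)
      (mul_le_mul hb' hβ hκ.le hb0.le)
  rw [h]
  refine (abs_sub _ _).trans ((add_le_add h1 h2).trans (le_of_eq ?_))
  field_simp

/-- A sum over ordered pairs as a sum over unordered pairs. -/
lemma sum_offDiag_eq (J : Finset ℕ) (G : ℕ → ℕ → ℝ) :
    ∑ e ∈ J.offDiag, G e.1 e.2 = ∑ k ∈ J, ∑ j ∈ J with j < k, (G j k + G k j) := by
  have h1 : ∑ e ∈ J.offDiag, G e.1 e.2 =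
      ∑ j ∈ J, ∑ k ∈ J, ((if j < k then G j k else 0) + (if k < j then G j k else 0)) := by
    have hJ : J.offDiag = {e ∈ J ×ˢ J | e.1 ≠ e.2} := by ext; simp [and_assoc]
    rw [← Finset.sum_product', hJ, Finset.sum_filter]
    refine Finset.sum_congr rfl fun e _ => ?_
    rcases lt_trichotomy e.1 e.2 with h | h | h
    · simp [h, h.ne, h.not_gt]
    · simp [h]
    · simp [h, h.ne', h.not_gt]
  simp_rw [h1, Finset.sum_add_distrib, Finset.sum_filter]
  rw [Finset.sum_comm]

lemma sum_offDiag_erase_range (n i : ℕ) (G : ℕ → ℕ → ℝ) :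
    ∑ e ∈ ((Finset.range n).erase i).offDiag, G e.1 e.2 = pairSum n i fun j k => G j k + G k j := by
  rw [sum_offDiag_eq, pairSum]
  refine Finset.sum_congr rfl fun k hk => Finset.sum_congr ?_ fun _ _ => rfl
  have hk' := Finset.mem_range.1 (Finset.mem_of_mem_erase hk)
  ext j
  simp only [Finset.mem_filter, Finset.mem_erase, Finset.mem_range]
  omega

lemma sum_offDiag_range (n : ℕ) (G : ℕ → ℕ → ℝ) :
    ∑ e ∈ (Finset.range n).offDiag, G e.1 e.2 =
      ∑ k ∈ Finset.range n, ∑ j ∈ Finset.range k, (G j k + G k j) := by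
  rw [sum_offDiag_eq]
  refine Finset.sum_congr rfl fun k hk => Finset.sum_congr ?_ fun _ _ => rfl
  have hk' := Finset.mem_range.1 hk
  ext j
  simp only [Finset.mem_filter, Finset.mem_range]
  omega

lemma two_mul_choose_two (n : ℕ) : 2 * ((n.choose 2 : ℕ) : ℝ) = n * (n - 1) := by
  rw [Nat.cast_choose_two]; ring

/-- The edge density relative to `ρ` is a normalized subgraph count; it has no root, and the node
`n` outside of the graph serves as one. -/
lemma edgeDensity_eq (M : SparseGraphonModel P p) {n : ℕ} (hn : 2 ≤ n) (ω : Ω) :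
    edgeDensity n (M.adj n ω) =
      M.ρ n * M.triadRatio n (false, true, false) (Finset.range n) n ω := by
  have hρ := M.ρ_pos n
  have hn' : (2 : ℝ) ≤ n := by exact_mod_cast hn
  have hn1 : (0 : ℝ) < (n : ℝ) - 1 := by linarith
  have hn0 : (0 : ℝ) < n := by linarith
  have hsum : ∑ e ∈ (Finset.range n).offDiag, M.adj n ω e.1 e.2 =
      2 * ∑ k ∈ Finset.range n, ∑ j ∈ Finset.range k, M.adj n ω j k := by
    rw [sum_offDiag_range, Finset.mul_sum]
    refine Finset.sum_congr rfl fun k _ => ?_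
    rw [Finset.mul_sum]
    exact Finset.sum_congr rfl fun j _ => by rw [M.adj_comm n k j]; ring
  have hch : ((n.choose 2 : ℕ) : ℝ) = n * (n - 1) / 2 := by
    linarith [two_mul_choose_two n]
  simp only [triadRatio, triad, triadSize, edgeDensity, hch, Finset.card_range]
  simp only [Bool.false_eq_true, if_false, if_true, one_mul, mul_one, hsum, zero_add, add_zero,
    pow_one]
  field_simp

lemma pairSum_eq (M : SparseGraphonModel P p) {n i : ℕ} (hn : 3 ≤ n) (hi : i < n)
    (q : Bool × Bool × Bool) (ω : Ω) :
    (pairSum n i fun j k => triad q (M.adj n ω i j) (M.adj n ω j k) (M.adj n ω k i) +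
      triad q (M.adj n ω i k) (M.adj n ω k j) (M.adj n ω j i)) =
    2 * (((n - 1).choose 2 : ℕ) : ℝ) * M.ρ n ^ triadSize q *
      M.triadRatio n q ((Finset.range n).erase i) i ω := by
  have hρ := M.ρ_pos n
  have hcard : ((((Finset.range n).erase i).card : ℕ) : ℝ) = (n : ℝ) - 1 := by
    rw [Finset.card_erase_of_mem (Finset.mem_range.2 hi), Finset.card_range,
      Nat.cast_sub (by omega), Nat.cast_one]
  have hn' : (3 : ℝ) ≤ n := by exact_mod_cast hn
  have h1 : (0 : ℝ) < (n : ℝ) - 1 := by linarith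
  have h2 : (0 : ℝ) < (n : ℝ) - 1 - 1 := by linarith
  rw [← sum_offDiag_erase_range n i
    fun j k => triad q (M.adj n ω i j) (M.adj n ω j k) (M.adj n ω k i), two_mul_choose_two,
    Nat.cast_sub (by omega), Nat.cast_one, triadRatio, hcard]
  field_simp

lemma pairSum_congr {n i : ℕ} {F G : ℕ → ℕ → ℝ} (h : ∀ j k, F j k = G j k) :
    pairSum n i F = pairSum n i G := by
  unfold pairSum; simp only [h]

lemma pairSum_add (n i : ℕ) (F G : ℕ → ℕ → ℝ) :
    (pairSum n i fun j k => F j k + G j k) = pairSum n i F + pairSum n i G := by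
  simp only [pairSum, Finset.sum_add_distrib]

lemma pairSum_mul (n i : ℕ) (r : ℝ) (F : ℕ → ℕ → ℝ) :
    (pairSum n i fun j k => r * F j k) = r * pairSum n i F := by
  simp only [pairSum, Finset.mul_sum]

/-- Local transitivity in terms of normalized subgraph counts: the powers of `ρ` and the binomial
coefficients cancel. -/
lemma localTransitivity_eq (M : SparseGraphonModel P p) {n i : ℕ} (hn : 3 ≤ n) (hi : i < n) (ω : Ω)
    (hD : M.triadRatio n (false, true, false) (Finset.range n) n ω ≠ 0) :
    localTransitivity n (M.adj n ω) i =
      3 * M.triadRatio n (true, true, true) ((Finset.range n).erase i) i ω /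
        (M.triadRatio n (false, true, false) (Finset.range n) n ω *
          (M.triadRatio n (true, false, true) ((Finset.range n).erase i) i ω +
            M.triadRatio n (true, true, false) ((Finset.range n).erase i) i ω +
            M.triadRatio n (false, true, true) ((Finset.range n).erase i) i ω)) := by
  have hρ := (M.ρ_pos n).ne'
  have hch : (((n - 1).choose 2 : ℕ) : ℝ) ≠ 0 := by
    exact_mod_cast (Nat.choose_pos (by omega)).ne'
  have e0 := M.pairSum_eq hn hi (true, true, true) ω
  have e1 := M.pairSum_eq hn hi (true, false, true) ω
  have e2 := M.pairSum_eq hn hi (true, true, false) ω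
  have e3 := M.pairSum_eq hn hi (false, true, true) ω
  simp only [triad, triadSize, Bool.false_eq_true, if_false, if_true, one_mul, mul_one]
    at e0 e1 e2 e3
  have hT : 2 * (pairSum n i fun j k => M.adj n ω i j * M.adj n ω j k * M.adj n ω k i) =
      2 * (((n - 1).choose 2 : ℕ) : ℝ) * M.ρ n ^ 3 *
        M.triadRatio n (true, true, true) ((Finset.range n).erase i) i ω := by
    rw [← pairSum_mul]
    refine Eq.trans (pairSum_congr fun j k => ?_) e0
    rw [M.adj_comm n i k, M.adj_comm n k j, M.adj_comm n j i]; ring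
  have hV : 2 * (pairSum n i fun j k => M.adj n ω i j * M.adj n ω i k +
      M.adj n ω j i * M.adj n ω j k + M.adj n ω k i * M.adj n ω k j) =
      2 * (((n - 1).choose 2 : ℕ) : ℝ) * M.ρ n ^ 2 *
        (M.triadRatio n (true, false, true) ((Finset.range n).erase i) i ω +
            M.triadRatio n (true, true, false) ((Finset.range n).erase i) i ω +
            M.triadRatio n (false, true, true) ((Finset.range n).erase i) i ω) := by
    rw [← pairSum_mul, mul_add, mul_add]
    refine Eq.trans ?_ (congrArg₂ (· + ·) (congrArg₂ (· + ·) e1 e2) e3)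
    rw [← pairSum_add, ← pairSum_add]
    refine pairSum_congr fun j k => ?_
    rw [M.adj_comm n k i, M.adj_comm n k j, M.adj_comm n j i]; ring
  have hT' : (pairSum n i fun j k => M.adj n ω i j * M.adj n ω j k * M.adj n ω k i) =
      (((n - 1).choose 2 : ℕ) : ℝ) * M.ρ n ^ 3 *
        M.triadRatio n (true, true, true) ((Finset.range n).erase i) i ω := by linarith
  have hV' : (pairSum n i fun j k => M.adj n ω i j * M.adj n ω i k +
      M.adj n ω j i * M.adj n ω j k + M.adj n ω k i * M.adj n ω k j) =
      (((n - 1).choose 2 : ℕ) : ℝ) * M.ρ n ^ 2 *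
        (M.triadRatio n (true, false, true) ((Finset.range n).erase i) i ω +
            M.triadRatio n (true, true, false) ((Finset.range n).erase i) i ω +
            M.triadRatio n (false, true, true) ((Finset.range n).erase i) i ω) := by linarith
  rw [localTransitivity, hT', hV', M.edgeDensity_eq (by omega)]
  set D := M.triadRatio n (false, true, false) (Finset.range n) n ω
  set V := M.triadRatio n (true, false, true) ((Finset.range n).erase i) i ω +
            M.triadRatio n (true, true, false) ((Finset.range n).erase i) i ω +
            M.triadRatio n (false, true, true) ((Finset.range n).erase i) i ω
  by_cases hV0 : V = 0
  · simp [hV0]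
  · field_simp

end

/-! ### The noiseless network covariates -/

section

variable {Ω : Type*} [MeasurableSpace Ω] {P : Measure Ω} {p d : ℕ}

/-- Order of the mean squared error of a network covariate. -/
def noiseRate (M : SparseGraphonModel P p) : CompositeCovariate p → ℕ → ℝ
  | .transitivity => fun n => 1 / M.lam n + n / M.lam n ^ 3
  | .neighborAverage _ => fun n => 1 / M.lam n

lemma measurable_latentCovariate [IsProbabilityMeasure P] (M : SparseGraphonModel P p)
    (κ : CompositeCovariate p) : Measurable fun x => M.latentCovariate x κ := by
  cases κ with
  | transitivity =>
    have key : ∀ F : unitInterval × unitInterval × unitInterval → ℝ, Measurable F →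
        Measurable fun x => ∫ y, ∫ z, F (x, y, z) := by
      intro F hF
      have h1 : Measurable fun xy : unitInterval × unitInterval => ∫ z, F (xy.1, xy.2, z) :=
        (StronglyMeasurable.integral_prod_right' (ν := (volume : Measure unitInterval))
          (f := fun z : (unitInterval × unitInterval) × unitInterval => F (z.1.1, z.1.2, z.2))
          (hF.comp (by fun_prop)).stronglyMeasurable).measurable
      exact (h1.stronglyMeasurable.integral_prod_right'
        (ν := (volume : Measure unitInterval))).measurable
    have hw : ∀ {a b : unitInterval × unitInterval × unitInterval → unitInterval},
        Measurable a → Measurable b → Measurable fun t => M.w (a t) (b t) :=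
      fun ha hb => M.measurable_w.comp (ha.prodMk hb)
    refine Measurable.div (Measurable.const_mul (key (fun t => M.w t.1 t.2.1 * M.w t.2.1 t.2.2 *
      M.w t.2.2 t.1) ?_) 3) (key (fun t => M.w t.1 t.2.1 * M.w t.1 t.2.2 +
        M.w t.2.1 t.1 * M.w t.2.1 t.2.2 + M.w t.2.2 t.1 * M.w t.2.2 t.2.1) ?_)
    · exact ((hw (by fun_prop) (by fun_prop)).mul (hw (by fun_prop) (by fun_prop))).mul
        (hw (by fun_prop) (by fun_prop))
    · exact (((hw (by fun_prop) (by fun_prop)).mul (hw (by fun_prop) (by fun_prop))).add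
        ((hw (by fun_prop) (by fun_prop)).mul (hw (by fun_prop) (by fun_prop)))).add
        ((hw (by fun_prop) (by fun_prop)).mul (hw (by fun_prop) (by fun_prop)))
  | neighborAverage k =>
    have h0 : Measurable fun z : unitInterval × Ω => M.w z.1 (M.ξ 0 z.2) :=
      M.measurable_w.comp (measurable_fst.prodMk ((M.measurable_ξ 0).comp measurable_snd))
    have hX : Measurable fun ω => M.X 0 ω k :=
      (EuclideanSpace.proj (𝕜 := ℝ) k).continuous.measurable.comp (M.measurable_X 0)
    exact ((h0.mul (hX.comp measurable_snd)).stronglyMeasurable.integral_prod_right'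
      (ν := P)).measurable.div (h0.stronglyMeasurable.integral_prod_right' (ν := P)).measurable

lemma ae_latentCovariate_transitivity (M : SparseGraphonModel P p) {c C : ℝ} (hc : 0 < c)
    (hw : ∀ᵐ z ∂(volume : Measure (unitInterval × unitInterval)),
      c ≤ M.w z.1 z.2 ∧ M.w z.1 z.2 ≤ C) :
    ∀ᵐ x, M.latentCovariate x .transitivity = 3 * M.latentTriad (true, true, true) x /
      (M.latentTriad (true, false, true) x + M.latentTriad (true, true, false) x +
        M.latentTriad (false, true, true) x) := by
  filter_upwards [M.ae_latentTriad hc hw (true, false, true),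
    M.ae_latentTriad hc hw (true, true, false),
    M.ae_latentTriad hc hw (false, true, true)] with x h1 h2 h3
  have hsum := (h1.1.add h2.1).add h3.1
  rw [h1.2.1, h2.2.1, h3.2.1, ← integral_add' h1.1 h2.1, ← integral_add' (h1.1.add h2.1) h3.1]
  have hprod := integral_prod _ hsum
  rw [← Measure.volume_eq_prod] at hprod
  have hrw : ∀ y z : unitInterval, M.w x y * M.w x z + M.w y x * M.w y z + M.w z x * M.w z y =
      triad (true, false, true) (M.w x y) (M.w y z) (M.w z x) +
      triad (true, true, false) (M.w x y) (M.w y z) (M.w z x) +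
      triad (false, true, true) (M.w x y) (M.w y z) (M.w z x) := by
    intro y z
    simp only [triad, Bool.false_eq_true, if_false, if_true, one_mul, mul_one]
    rw [M.w_symm x z, M.w_symm y x, M.w_symm z y]; ring
  simp only [Pi.add_apply] at hprod
  simp only [latentCovariate, hrw, Pi.add_apply]
  rw [hprod]
  simp [latentTriad, triad]

lemma latentCovariate_neighborAverage (M : SparseGraphonModel P p) (k : Fin p) (x : unitInterval) :
    M.latentCovariate x (.neighborAverage k) =
      M.latentNbr (fun v => v k) x / M.latentNbr (fun _ => 1) x := by
  simp [latentCovariate, latentNbr]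

lemma latentTriad_edge (M : SparseGraphonModel P p) (x : unitInterval) :
    M.latentTriad (false, true, false) x = 1 := by
  simpa [latentTriad, triad] using M.integral_w

lemma memLp_coord (M : SparseGraphonModel P p) (hX : MemLp (M.X 0) 4 P) (k : Fin p) :
    MemLp (fun ω => M.X 0 ω k) 4 P :=
  (EuclideanSpace.proj (𝕜 := ℝ) k).comp_memLp' hX

variable [IsProbabilityMeasure P]

lemma ae_le_latentNbr_one (M : SparseGraphonModel P p) {c C : ℝ} (hc : 0 < c)
    (hw : ∀ᵐ z ∂(volume : Measure (unitInterval × unitInterval)),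
      c ≤ M.w z.1 z.2 ∧ M.w z.1 z.2 ≤ C) : ∀ᵐ x, c ≤ M.latentNbr (fun _ => 1) x := by
  filter_upwards [M.ae_ae_w_ξ_bounds hw, M.ae_latentNbr hc hw (g := fun _ => 1) measurable_const
    (integrable_const _)] with x h1 h2
  calc c = ∫ _, c ∂P := by simp
    _ ≤ _ := integral_mono_ae (integrable_const _) h2.1 (h1.mono fun ω h => by simpa using h.1)

/-- The noiseless covariate is almost surely bounded. -/
lemma exists_ae_abs_latentCovariate_le (M : SparseGraphonModel P p) {c C : ℝ} (hc : 0 < c)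
    (hw : ∀ᵐ z ∂(volume : Measure (unitInterval × unitInterval)),
      c ≤ M.w z.1 z.2 ∧ M.w z.1 z.2 ≤ C) (hX : MemLp (M.X 0) 4 P) (κ : CompositeCovariate p) :
    ∃ K, ∀ᵐ x, |M.latentCovariate x κ| ≤ K := by
  cases κ with
  | transitivity =>
    refine ⟨3 * C ^ 3 / (3 * c ^ 2), ?_⟩
    filter_upwards [M.ae_latentCovariate_transitivity hc hw,
      M.ae_latentTriad hc hw (true, true, true), M.ae_latentTriad hc hw (true, false, true),
      M.ae_latentTriad hc hw (true, true, false), M.ae_latentTriad hc hw (false, true, true)]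
      with x h h0 h1 h2 h3
    have h0' := h0.2.2
    have h1' := h1.2.2.1
    have h2' := h2.2.2.1
    have h3' := h3.2.2.1
    simp only [triadSize, Bool.false_eq_true, if_false, if_true] at h0' h1' h2' h3'
    norm_num at h0' h1' h2' h3'
    have hpos : 0 < c ^ 3 := by positivity
    rw [h, abs_div, abs_of_nonneg (by linarith), abs_of_nonneg (by nlinarith [sq_nonneg c])]
    exact div_le_div₀ (by linarith) (by linarith) (by positivity) (by linarith)
  | neighborAverage k =>
    have hg : Measurable fun v : EuclideanSpace ℝ (Fin p) => v k :=
      (EuclideanSpace.proj (𝕜 := ℝ) k).continuous.measurable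
    have hgi : Integrable (fun ω => M.X 0 ω k) P :=
      (M.memLp_coord hX k).integrable (by norm_num)
    refine ⟨C * (∫ ω, |M.X 0 ω k| ∂P) / c, ?_⟩
    filter_upwards [M.ae_le_latentNbr_one hc hw, M.ae_latentNbr hc hw hg hgi] with x h1 h2
    rw [M.latentCovariate_neighborAverage, abs_div, abs_of_pos (hc.trans_le h1)]
    exact div_le_div₀ ((abs_nonneg _).trans h2.2) h2.2 hc h1

end

/-! ### Noise rates of the network covariates -/

section

variable {Ω : Type*} [MeasurableSpace Ω] {P : Measure Ω} {p d : ℕ}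

lemma card_erase_range {n i : ℕ} : n ≤ ((Finset.range n).erase i).card + 1 := by
  have := Finset.pred_card_le_card_erase (s := Finset.range n) (a := i)
  rw [Finset.card_range] at this
  omega

lemma ae_ξ_of_ae (M : SparseGraphonModel P p) {Q : unitInterval → Prop} (h : ∀ᵐ x, Q x) (i : ℕ) :
    ∀ᵐ ω ∂P, Q (M.ξ i ω) := by
  rw [← M.map_ξ i] at h
  exact ae_of_ae_map (M.measurable_ξ i).aemeasurable h

lemma neighborhoodAverage_eq (M : SparseGraphonModel P p) {n : ℕ} (hn : 2 ≤ n) (i : ℕ) (k : Fin p)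
    (ω : Ω) : neighborhoodAverage n (M.adj n ω) (fun j => M.X j ω k) i =
      M.nbrRatio n (fun v => v k) ((Finset.range n).erase i) i ω /
        M.nbrRatio n (fun _ => 1) ((Finset.range n).erase i) i ω := by
  have hcard : (((Finset.range n).erase i).card : ℝ) ≠ 0 := by
    have := card_erase_range (n := n) (i := i)
    exact_mod_cast (show ((Finset.range n).erase i).card ≠ 0 by omega)
  simp only [nbrRatio, mul_one]
  rw [div_div_div_cancel_right₀ (mul_ne_zero hcard (M.ρ_pos n).ne'), neighborhoodAverage]

lemma le_of_notMem_lt {α : Type*} {f : α → ℝ} {t : ℝ} {x : α} (h : x ∉ {x | t < f x}) : f x ≤ t :=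
  not_lt.1 h

variable [IsProbabilityMeasure P]

lemma measureReal_triadRatio_le_rate (M : SparseGraphonModel P p) {c C : ℝ} (hc : 0 < c)
    (hcC : c ≤ C) (hw : ∀ᵐ z ∂(volume : Measure (unitInterval × unitInterval)),
      c ≤ M.w z.1 z.2 ∧ M.w z.1 z.2 ≤ C) {n : ℕ} (hn : M.ρ n * C ≤ 1) (hn3 : 3 ≤ n)
    (hlam : 1 ≤ M.lam n) {q : Bool × Bool × Bool} {s : ℕ} (hq : triadSize q = s + 1) (hs : s ≤ 2)
    {J : Finset ℕ} (hJ : n ≤ J.card + 1) {i : ℕ} (hi : i ∉ J) {t : ℝ} (ht : 0 < t) :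
    P.real {ω | t < |M.triadRatio n q J i ω - M.latentTriad q (M.ξ i ω)|} ≤
      128 * (1 + C) ^ 5 * M.noiseRate .transitivity n / t ^ 2 := by
  refine (M.measureReal_triadRatio_le hc hcC hw hn hq (by omega) hi ht).trans ?_
  have hρ := M.ρ_pos n
  have hC : 0 < C := hc.trans_le hcC
  have hn3' : (3 : ℝ) ≤ n := by exact_mod_cast hn3
  have hn0 : (0 : ℝ) < n := by linarith
  have hJ' : (n : ℝ) / 2 ≤ J.card := by
    have : (n : ℝ) ≤ J.card + 1 := by exact_mod_cast hJ
    linarith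
  set N : ℝ := (J.card : ℝ)
  have hl : M.lam n = n * M.ρ n := rfl
  have hl0 : 0 < n * M.ρ n := by positivity
  rw [hl] at hlam
  have hone : (1 : ℝ) ≤ 1 + C := by linarith
  have hpow : ∀ k ≤ 5, C ^ k ≤ (1 + C) ^ 5 := fun k hk =>
    (pow_le_pow_left₀ hC.le (by linarith) k).trans (pow_le_pow_right₀ hone hk)
  have h1 : 32 * C ^ (2 * s + 1) / (N * M.ρ n) ≤ 64 * (1 + C) ^ 5 * (1 / (n * M.ρ n)) := by
    calc 32 * C ^ (2 * s + 1) / (N * M.ρ n) ≤ 32 * (1 + C) ^ 5 / (n / 2 * M.ρ n) := by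
          gcongr
          exact hpow _ (by omega)
      _ = _ := by field_simp; ring
  have h2 : 16 * C ^ (s + 1) / (N ^ 2 * M.ρ n ^ (s + 1)) ≤
      64 * (1 + C) ^ 5 * (1 / ((n : ℝ) ^ 2 * M.ρ n ^ (s + 1))) := by
    calc 16 * C ^ (s + 1) / (N ^ 2 * M.ρ n ^ (s + 1)) ≤
          16 * (1 + C) ^ 5 / ((n / 2 : ℝ) ^ 2 * M.ρ n ^ (s + 1)) := by
          gcongr
          exact hpow _ (by omega)
      _ = _ := by field_simp; ring
  have h3 : 1 / ((n : ℝ) ^ 2 * M.ρ n ^ (s + 1)) ≤ 1 / (n * M.ρ n) + n / (n * M.ρ n) ^ 3 := by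
    have hA : 0 ≤ 1 / (n * M.ρ n) := by positivity
    have hB : 0 ≤ n / (n * M.ρ n) ^ 3 := by positivity
    interval_cases s
    · have : 1 / ((n : ℝ) ^ 2 * M.ρ n ^ (0 + 1)) ≤ 1 / (n * M.ρ n) := by
        refine one_div_le_one_div_of_le hl0 ?_
        rw [zero_add, pow_one, sq, mul_assoc]
        exact le_mul_of_one_le_left hl0.le (by linarith)
      linarith
    · have : 1 / ((n : ℝ) ^ 2 * M.ρ n ^ (1 + 1)) ≤ 1 / (n * M.ρ n) := by
        refine one_div_le_one_div_of_le hl0 ?_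
        rw [← mul_pow, sq]
        exact le_mul_of_one_le_left hl0.le hlam
      linarith
    · have : 1 / ((n : ℝ) ^ 2 * M.ρ n ^ (2 + 1)) = n / (n * M.ρ n) ^ 3 := by
        field_simp
      linarith
  refine div_le_div_of_nonneg_right ?_ (by positivity)
  have h4 : M.noiseRate .transitivity n = 1 / (n * M.ρ n) + n / (n * M.ρ n) ^ 3 := rfl
  rw [h4]
  have hB : 0 ≤ n / (n * M.ρ n) ^ 3 := by positivity
  have hK : 0 < 64 * (1 + C) ^ 5 := by positivity
  nlinarith [mul_le_mul_of_nonneg_left h3 hK.le, mul_nonneg hK.le hB]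

lemma measureReal_nbrRatio_le_rate (M : SparseGraphonModel P p) {c C : ℝ} (hc : 0 < c)
    (hcC : c ≤ C) (hw : ∀ᵐ z ∂(volume : Measure (unitInterval × unitInterval)),
      c ≤ M.w z.1 z.2 ∧ M.w z.1 z.2 ≤ C) {n : ℕ} (hn : M.ρ n * C ≤ 1) (hn3 : 3 ≤ n)
    {g : EuclideanSpace ℝ (Fin p) → ℝ} (hg : Measurable g)
    (hg2 : MemLp (fun ω => g (M.X 0 ω)) 2 P) {J : Finset ℕ} (hJ : n ≤ J.card + 1) {i : ℕ}
    (hi : i ∉ J) {t : ℝ} (ht : 0 < t) :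
    P.real {ω | t < |M.nbrRatio n g J i ω - M.latentNbr g (M.ξ i ω)|} ≤
      4 * C * (∫ ω, g (M.X 0 ω) ^ 2 ∂P + (∫ ω, |g (M.X 0 ω)| ∂P) ^ 2) * (1 / M.lam n) / t ^ 2 := by
  refine (M.measureReal_nbrRatio_le hc hcC hw hn hg hg2 (by omega) hi ht).trans ?_
  have hρ := M.ρ_pos n
  have hC : 0 < C := hc.trans_le hcC
  have hn3' : (3 : ℝ) ≤ n := by exact_mod_cast hn3
  have hJ' : (n : ℝ) / 2 ≤ J.card := by
    have : (n : ℝ) ≤ J.card + 1 := by exact_mod_cast hJ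
    linarith
  have hG : 0 ≤ ∫ ω, g (M.X 0 ω) ^ 2 ∂P + (∫ ω, |g (M.X 0 ω)| ∂P) ^ 2 :=
    add_nonneg (integral_nonneg fun _ => sq_nonneg _) (sq_nonneg _)
  refine div_le_div_of_nonneg_right ?_ (by positivity)
  calc _ ≤ 2 * C * (∫ ω, g (M.X 0 ω) ^ 2 ∂P + (∫ ω, |g (M.X 0 ω)| ∂P) ^ 2) /
        (n / 2 * M.ρ n) := by gcongr
    _ = _ := by
      rw [show M.lam n = n * M.ρ n from rfl]
      field_simp
      ring

/-- Chebyshev-type tail bound for a neighborhood average, uniformly in the root. -/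
lemma exists_tail_neighborAverage (M : SparseGraphonModel P p) {c C : ℝ} (hc : 0 < c)
    (hcC : c ≤ C) (hw : ∀ᵐ z ∂(volume : Measure (unitInterval × unitInterval)),
      c ≤ M.w z.1 z.2 ∧ M.w z.1 z.2 ≤ C) (hX : MemLp (M.X 0) 4 P) (k : Fin p) :
    ∃ K > 0, ∃ t₀ > 0, ∀ᶠ n in atTop, ∀ i < n, ∀ t, 0 < t → t ≤ t₀ →
      P.real {ω | K * t < |M.covariateHat n i ω (.neighborAverage k) -
        M.latentCovariate (M.ξ i ω) (.neighborAverage k)|} ≤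
        K * M.noiseRate (.neighborAverage k) n / t ^ 2 := by
  have hC : 0 < C := hc.trans_le hcC
  have hg : Measurable fun v : EuclideanSpace ℝ (Fin p) => v k :=
    (EuclideanSpace.proj (𝕜 := ℝ) k).continuous.measurable
  have hg2 : MemLp (fun ω => M.X 0 ω k) 2 P :=
    (M.memLp_coord hX k).mono_exponent (by norm_num)
  have hgi : Integrable (fun ω => M.X 0 ω k) P := hg2.integrable (by norm_num)
  have h12 : MemLp (fun ω => (fun _ : EuclideanSpace ℝ (Fin p) => (1 : ℝ)) (M.X 0 ω)) 2 P :=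
    memLp_const 1
  set G := ∫ ω, M.X 0 ω k ^ 2 ∂P + (∫ ω, |M.X 0 ω k| ∂P) ^ 2 with hG
  have hG0 : 0 ≤ G := add_nonneg (integral_nonneg fun _ => sq_nonneg _) (sq_nonneg _)
  set A := C * ∫ ω, |M.X 0 ω k| ∂P with hA
  have hA0 : 0 ≤ A := mul_nonneg hC.le (integral_nonneg fun _ => abs_nonneg _)
  set K1 := 2 / c + 2 * A / c ^ 2 with hK1
  have hK1' : 0 < K1 := by positivity
  refine ⟨K1 + 4 * C * (G + 2), by positivity, c / 2, by positivity, ?_⟩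
  have hρC : ∀ᶠ n in atTop, M.ρ n * C < 1 := by
    have := M.ρ_tendsto.mul_const C
    rw [zero_mul] at this
    exact this.eventually_lt_const zero_lt_one
  filter_upwards [hρC, eventually_ge_atTop 3] with n hn hn3 i hi t ht ht0
  have hJ := card_erase_range (n := n) (i := i)
  have hmem : i ∉ (Finset.range n).erase i := Finset.notMem_erase i _
  have b1 := M.measureReal_nbrRatio_le_rate hc hcC hw hn.le hn3 hg hg2 hJ hmem ht
  have b2 := M.measureReal_nbrRatio_le_rate hc hcC hw hn.le hn3 (g := fun _ => 1)
    measurable_const h12 hJ hmem ht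
  set S1 := {ω | t < |M.nbrRatio n (fun v => v k) ((Finset.range n).erase i) i ω -
    M.latentNbr (fun v => v k) (M.ξ i ω)|}
  set S2 := {ω | t < |M.nbrRatio n (fun _ => 1) ((Finset.range n).erase i) i ω -
    M.latentNbr (fun _ => 1) (M.ξ i ω)|}
  have hsub : P.real {ω | (K1 + 4 * C * (G + 2)) * t <
      |M.covariateHat n i ω (.neighborAverage k) -
        M.latentCovariate (M.ξ i ω) (.neighborAverage k)|} ≤ P.real (S1 ∪ S2) := by
    refine ENNReal.toReal_mono (measure_ne_top _ _) (measure_mono_ae ?_)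
    filter_upwards [M.ae_ξ_of_ae (M.ae_le_latentNbr_one hc hw) i,
      M.ae_ξ_of_ae (M.ae_latentNbr hc hw hg hgi) i] with ω h1 h2 hlt
    change _ < _ at hlt
    by_contra hcon
    have hcon' : ω ∉ S1 ∧ ω ∉ S2 := by
      constructor <;> intro h
      · exact hcon (Or.inl h)
      · exact hcon (Or.inr h)
    have e1 := le_of_notMem_lt hcon'.1
    have e2 := le_of_notMem_lt hcon'.2
    have := abs_div_sub_div_le hc h1 h2.2 e1 e2 ht0
    rw [M.latentCovariate_neighborAverage] at hlt
    simp only [covariateHat] at hlt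
    rw [M.neighborhoodAverage_eq (by omega)] at hlt
    have hpos : 0 ≤ 4 * C * (G + 2) * t := by positivity
    nlinarith
  have hl0 : 0 < 1 / M.lam n := by
    have : (0 : ℝ) < n := by exact_mod_cast (by omega : 0 < n)
    have := M.ρ_pos n
    unfold lam; positivity
  refine hsub.trans ((measureReal_union_le _ _).trans ((add_le_add b1 b2).trans ?_))
  rw [← hG, ← add_div]
  refine div_le_div_of_nonneg_right ?_ (by positivity)
  simp only [one_pow, abs_one, integral_const, probReal_univ, smul_eq_mul, mul_one, noiseRate]
  nlinarith [mul_pos hK1' hl0]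

/-- Chebyshev-type tail bound for a local transitivity, uniformly in the root. -/
lemma exists_tail_transitivity (M : SparseGraphonModel P p) {c C : ℝ} (hc : 0 < c)
    (hcC : c ≤ C) (hw : ∀ᵐ z ∂(volume : Measure (unitInterval × unitInterval)),
      c ≤ M.w z.1 z.2 ∧ M.w z.1 z.2 ≤ C) (hlam : Tendsto M.lam atTop atTop) :
    ∃ K > 0, ∃ t₀ > 0, ∀ᶠ n in atTop, ∀ i < n, ∀ t, 0 < t → t ≤ t₀ →
      P.real {ω | K * t < |M.covariateHat n i ω .transitivity -
        M.latentCovariate (M.ξ i ω) .transitivity|} ≤ K * M.noiseRate .transitivity n / t ^ 2 := by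
  have hC : 0 < C := hc.trans_le hcC
  set B := 3 * C ^ 2 + 6 with hB
  have hB0 : 0 < B := by positivity
  set κ := 3 * c ^ 2 with hκ
  have hκ0 : 0 < κ := by positivity
  set K1 := 2 / κ + 2 * (3 * C ^ 3) / κ ^ 2 with hK1
  have hK1' : 0 < K1 := by positivity
  refine ⟨K1 * B + 5 * (128 * (1 + C) ^ 5), by positivity, min (1 / 2) (κ / 2 / B),
    by positivity, ?_⟩
  have hρC : ∀ᶠ n in atTop, M.ρ n * C < 1 := by
    have := M.ρ_tendsto.mul_const C
    rw [zero_mul] at this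
    exact this.eventually_lt_const zero_lt_one
  filter_upwards [hρC, eventually_ge_atTop 3, hlam.eventually_ge_atTop 1]
    with n hn hn3 hl i hi t ht ht0
  have ht1 : t ≤ 1 / 2 := ht0.trans (min_le_left _ _)
  have ht2 : B * t ≤ κ / 2 := by
    have := (le_div_iff₀ hB0).1 (ht0.trans (min_le_right _ _))
    linarith
  have hJ := card_erase_range (n := n) (i := i)
  have hmem : i ∉ (Finset.range n).erase i := Finset.notMem_erase i _
  have b0 := M.measureReal_triadRatio_le_rate hc hcC hw hn.le hn3 hl (q := (true, true, true))
    (s := 2) rfl le_rfl hJ hmem ht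
  have b1 := M.measureReal_triadRatio_le_rate hc hcC hw hn.le hn3 hl (q := (true, false, true))
    (s := 1) rfl (by norm_num) hJ hmem ht
  have b2 := M.measureReal_triadRatio_le_rate hc hcC hw hn.le hn3 hl (q := (true, true, false))
    (s := 1) rfl (by norm_num) hJ hmem ht
  have b3 := M.measureReal_triadRatio_le_rate hc hcC hw hn.le hn3 hl (q := (false, true, true))
    (s := 1) rfl (by norm_num) hJ hmem ht
  have b4 := M.measureReal_triadRatio_le_rate hc hcC hw hn.le hn3 hl (q := (false, true, false))
    (s := 0) rfl (by norm_num) (J := Finset.range n) (i := n) (by simp) (by simp) ht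
  simp only [M.latentTriad_edge] at b4
  set S0 := {ω | t < |M.triadRatio n (true, true, true) ((Finset.range n).erase i) i ω -
    M.latentTriad (true, true, true) (M.ξ i ω)|}
  set S1 := {ω | t < |M.triadRatio n (true, false, true) ((Finset.range n).erase i) i ω -
    M.latentTriad (true, false, true) (M.ξ i ω)|}
  set S2 := {ω | t < |M.triadRatio n (true, true, false) ((Finset.range n).erase i) i ω -
    M.latentTriad (true, true, false) (M.ξ i ω)|}
  set S3 := {ω | t < |M.triadRatio n (false, true, true) ((Finset.range n).erase i) i ω -
    M.latentTriad (false, true, true) (M.ξ i ω)|}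
  set S4 := {ω | t < |M.triadRatio n (false, true, false) (Finset.range n) n ω - 1|}
  have hsub : P.real {ω | (K1 * B + 5 * (128 * (1 + C) ^ 5)) * t <
      |M.covariateHat n i ω .transitivity - M.latentCovariate (M.ξ i ω) .transitivity|} ≤
        P.real (S0 ∪ S1 ∪ S2 ∪ S3 ∪ S4) := by
    refine ENNReal.toReal_mono (measure_ne_top _ _) (measure_mono_ae ?_)
    filter_upwards [M.ae_ξ_of_ae (M.ae_latentCovariate_transitivity hc hw) i,
      M.ae_ξ_of_ae (M.ae_latentTriad hc hw (true, true, true)) i,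
      M.ae_ξ_of_ae (M.ae_latentTriad hc hw (true, false, true)) i,
      M.ae_ξ_of_ae (M.ae_latentTriad hc hw (true, true, false)) i,
      M.ae_ξ_of_ae (M.ae_latentTriad hc hw (false, true, true)) i] with ω h h0 h1 h2 h3 hlt
    change _ < _ at hlt
    by_contra hcon
    have hcon' : ω ∉ S0 ∪ S1 ∪ S2 ∪ S3 ∪ S4 := hcon
    simp only [Set.mem_union, not_or] at hcon'
    obtain ⟨⟨⟨⟨e0, e1⟩, e2⟩, e3⟩, e4⟩ := hcon'
    replace e0 := le_of_notMem_lt e0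
    replace e1 := le_of_notMem_lt e1
    replace e2 := le_of_notMem_lt e2
    replace e3 := le_of_notMem_lt e3
    replace e4 := le_of_notMem_lt e4
    obtain ⟨-, -, h0l, h0u⟩ := h0
    obtain ⟨-, -, h1l, h1u⟩ := h1
    obtain ⟨-, -, h2l, h2u⟩ := h2
    obtain ⟨-, -, h3l, h3u⟩ := h3
    simp only [triadSize, Bool.false_eq_true, if_false, if_true] at h0l h0u h1l h1u h2l h2u h3l h3u
    norm_num at h0l h0u h1l h1u h2l h2u h3l h3u
    have hD : M.triadRatio n (false, true, false) (Finset.range n) n ω ≠ 0 := by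
      intro hD
      rw [hD] at e4
      norm_num at e4
      linarith
    rw [h] at hlt
    simp only [covariateHat] at hlt
    rw [M.localTransitivity_eq hn3 hi ω hD] at hlt
    set T := M.triadRatio n (true, true, true) ((Finset.range n).erase i) i ω
    set V1 := M.triadRatio n (true, false, true) ((Finset.range n).erase i) i ω
    set V2 := M.triadRatio n (true, true, false) ((Finset.range n).erase i) i ω
    set V3 := M.triadRatio n (false, true, true) ((Finset.range n).erase i) i ω
    set D := M.triadRatio n (false, true, false) (Finset.range n) n ω
    set f0 := M.latentTriad (true, true, true) (M.ξ i ω)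
    set f1 := M.latentTriad (true, false, true) (M.ξ i ω)
    set f2 := M.latentTriad (true, true, false) (M.ξ i ω)
    set f3 := M.latentTriad (false, true, true) (M.ξ i ω)
    have hc3 : 0 < c ^ 3 := by positivity
    have hα : |3 * f0| ≤ 3 * C ^ 3 := by
      rw [abs_of_nonneg (by linarith)]; linarith
    have ha : |3 * T - 3 * f0| ≤ B * t := by
      rw [← mul_sub, abs_mul, abs_of_pos (by norm_num : (0 : ℝ) < 3)]
      have : 0 ≤ C ^ 2 * t := by positivity
      rw [hB]; linarith
    have hV : |V1 + V2 + V3 - (f1 + f2 + f3)| ≤ 3 * t := by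
      rw [abs_le] at e1 e2 e3 ⊢
      constructor <;> linarith [e1.1, e1.2, e2.1, e2.2, e3.1, e3.2]
    have hVabs : |V1 + V2 + V3| ≤ 3 * C ^ 2 + 3 := by
      rw [abs_le] at hV ⊢
      have : 0 < c ^ 2 := by positivity
      constructor <;> linarith [hV.1, hV.2]
    have hb : |D * (V1 + V2 + V3) - (f1 + f2 + f3)| ≤ B * t := by
      have e : D * (V1 + V2 + V3) - (f1 + f2 + f3) =
          (D - 1) * (V1 + V2 + V3) + (V1 + V2 + V3 - (f1 + f2 + f3)) := by ring
      rw [e]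
      refine (abs_add_le _ _).trans ?_
      rw [abs_mul]
      have := mul_le_mul e4 hVabs (abs_nonneg _) ht.le
      rw [hB]
      linarith
    have := abs_div_sub_div_le hκ0 (by rw [hκ]; linarith) hα ha hb ht2
    have hpos : 0 ≤ 5 * (128 * (1 + C) ^ 5) * t := by positivity
    nlinarith
  refine hsub.trans ?_
  have hrate : 0 ≤ M.noiseRate .transitivity n := by
    have : 0 < M.lam n := by linarith
    simp only [noiseRate]
    positivity
  have hu : P.real (S0 ∪ S1 ∪ S2 ∪ S3 ∪ S4) ≤
      5 * (128 * (1 + C) ^ 5 * M.noiseRate .transitivity n / t ^ 2) := by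
    have u1 := measureReal_union_le (μ := P) (S0 ∪ S1 ∪ S2 ∪ S3) S4
    have u2 := measureReal_union_le (μ := P) (S0 ∪ S1 ∪ S2) S3
    have u3 := measureReal_union_le (μ := P) (S0 ∪ S1) S2
    have u4 := measureReal_union_le (μ := P) S0 S1
    linarith
  refine hu.trans ?_
  rw [← mul_div_assoc]
  refine div_le_div_of_nonneg_right ?_ (by positivity)
  nlinarith [mul_nonneg (mul_pos hK1' hB0).le hrate]

/-- Chebyshev-type tail bound for a network covariate, uniformly in the root. -/
lemma exists_tail_covariate (M : SparseGraphonModel P p) {c C : ℝ} (hc : 0 < c)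
    (hcC : c ≤ C) (hw : ∀ᵐ z ∂(volume : Measure (unitInterval × unitInterval)),
      c ≤ M.w z.1 z.2 ∧ M.w z.1 z.2 ≤ C) (hX : MemLp (M.X 0) 4 P)
    (hlam : Tendsto M.lam atTop atTop) (κ : CompositeCovariate p) :
    ∃ K > 0, ∃ t₀ > 0, ∀ᶠ n in atTop, ∀ i < n, ∀ t, 0 < t → t ≤ t₀ →
      P.real {ω | K * t < |M.covariateHat n i ω κ - M.latentCovariate (M.ξ i ω) κ|} ≤
        K * M.noiseRate κ n / t ^ 2 := by
  cases κ with
  | transitivity => exact M.exists_tail_transitivity hc hcC hw hlam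
  | neighborAverage k => exact M.exists_tail_neighborAverage hc hcC hw hX k

end

/-! ### The maximal noise of the network covariates -/

section

variable {Ω : Type*} [MeasurableSpace Ω] {P : Measure Ω} {p d : ℕ}

lemma lam_nonneg (M : SparseGraphonModel P p) (n : ℕ) : 0 ≤ M.lam n :=
  mul_nonneg (Nat.cast_nonneg n) (M.ρ_pos n).le

lemma noiseRate_nonneg (M : SparseGraphonModel P p) (κ : CompositeCovariate p) (n : ℕ) :
    0 ≤ M.noiseRate κ n := by
  have := M.lam_nonneg n
  cases κ <;> simp only [noiseRate] <;> positivity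

lemma SizeCondition.isLittleO_lam {M : SparseGraphonModel P p} {m : ℕ → ℕ}
    {κ : CompositeCovariate p} (h : M.SizeCondition m κ) :
    (fun n => (m n : ℝ) ^ 2) =o[atTop] M.lam := by
  cases κ with
  | transitivity =>
    refine IsLittleO.trans_isBigO h (IsBigO.of_bound 1 (Eventually.of_forall fun n => ?_))
    have h0 := M.lam_nonneg n
    have h1 : 0 ≤ M.lam n ^ 3 / n := by positivity
    rw [one_mul, Real.norm_eq_abs, Real.norm_eq_abs, abs_of_nonneg (le_min h0 h1),
      abs_of_nonneg h0]
    exact min_le_left _ _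
  | neighborAverage k => exact h

lemma SizeCondition.tendsto_lam {M : SparseGraphonModel P p} {m : ℕ → ℕ}
    {κ : CompositeCovariate p} (h : M.SizeCondition m κ) (hm : Tendsto m atTop atTop) :
    Tendsto M.lam atTop atTop := by
  have hm2 : Tendsto (fun n => (m n : ℝ) ^ 2) atTop atTop :=
    (tendsto_pow_atTop two_ne_zero).comp (tendsto_natCast_atTop_atTop.comp hm)
  refine tendsto_atTop_mono' _ ?_ hm2
  filter_upwards [h.isLittleO_lam.bound zero_lt_one] with n hn
  rwa [one_mul, Real.norm_eq_abs, Real.norm_eq_abs, abs_of_nonneg (M.lam_nonneg n),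
    abs_of_nonneg (by positivity)] at hn

lemma SizeCondition.isLittleO_id {M : SparseGraphonModel P p} {m : ℕ → ℕ}
    {κ : CompositeCovariate p} (h : M.SizeCondition m κ) :
    (fun n => (m n : ℝ)) =o[atTop] fun n : ℕ => (n : ℝ) := by
  have h1 : (fun n => (m n : ℝ)) =O[atTop] fun n => (m n : ℝ) ^ 2 := by
    refine IsBigO.of_bound 1 (Eventually.of_forall fun n => ?_)
    rw [one_mul, Real.norm_eq_abs, Real.norm_eq_abs, abs_of_nonneg (by positivity),
      abs_of_nonneg (by positivity)]
    exact_mod_cast Nat.le_self_pow two_ne_zero (m n)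
  have h2 : M.lam =O[atTop] fun n : ℕ => (n : ℝ) := by
    refine IsBigO.of_bound 1 ?_
    filter_upwards [M.ρ_tendsto.eventually_lt_const zero_lt_one] with n hn
    rw [one_mul, Real.norm_eq_abs, Real.norm_eq_abs, abs_of_nonneg (M.lam_nonneg n),
      abs_of_nonneg (by positivity)]
    exact mul_le_of_le_one_right (by positivity) hn.le
  exact h1.trans_isLittleO (h.isLittleO_lam.trans_isBigO h2)

lemma SizeCondition.tendsto_noiseRate {M : SparseGraphonModel P p} {m : ℕ → ℕ}
    {κ : CompositeCovariate p} (h : M.SizeCondition m κ) :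
    Tendsto (fun n => (m n : ℝ) ^ 2 * M.noiseRate κ n) atTop (𝓝 0) := by
  have h1 := h.isLittleO_lam.tendsto_div_nhds_zero
  cases κ with
  | transitivity =>
    have h2 : (fun n => (m n : ℝ) ^ 2) =o[atTop] fun n => M.lam n ^ 3 / n := by
      refine IsLittleO.trans_isBigO h (IsBigO.of_bound 1 (Eventually.of_forall fun n => ?_))
      have h0 := M.lam_nonneg n
      have h1 : 0 ≤ M.lam n ^ 3 / n := by positivity
      rw [one_mul, Real.norm_eq_abs, Real.norm_eq_abs, abs_of_nonneg (le_min h0 h1),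
        abs_of_nonneg h1]
      exact min_le_right _ _
    have h3 := h1.add h2.tendsto_div_nhds_zero
    rw [add_zero] at h3
    refine h3.congr fun n => ?_
    simp only [noiseRate]
    rw [div_div_eq_mul_div]
    ring
  | neighborAverage k =>
    refine h1.congr fun n => ?_
    simp only [noiseRate]
    ring

lemma exists_lt_of_lt_maxNoise (M : SparseGraphonModel P p) (kind : Fin d → CompositeCovariate p)
    (n m : ℕ) {ω : Ω} {t : ℝ} (ht : 0 ≤ t) (h : d * t < M.maxNoise kind n m ω) :
    ∃ i < m, ∃ j, t < |M.covariateHat n i ω (kind j) - M.latentCovariate (M.ξ i ω) (kind j)| := by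
  have hnn : (⟨d * t, by positivity⟩ : ℝ≥0) <
      (Finset.range m).sup fun i => ‖M.Zhat kind n i ω - M.Z kind i ω‖₊ := h
  obtain ⟨i, hi, hlt⟩ := Finset.lt_sup_iff.1 hnn
  refine ⟨i, Finset.mem_range.1 hi, ?_⟩
  by_contra hcon
  push Not at hcon
  have hlt' : d * t < ‖M.Zhat kind n i ω - M.Z kind i ω‖ := hlt
  have hsum : ‖M.Zhat kind n i ω - M.Z kind i ω‖ ≤ ∑ j, |(M.Zhat kind n i ω - M.Z kind i ω) j| := by
    rw [EuclideanSpace.norm_eq]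
    refine Real.sqrt_le_iff.2 ⟨Finset.sum_nonneg fun _ _ => abs_nonneg _, ?_⟩
    simp only [Real.norm_eq_abs]
    exact Finset.sum_sq_le_sq_sum_of_nonneg fun _ _ => abs_nonneg _
  have hle : ∑ j, |(M.Zhat kind n i ω - M.Z kind i ω) j| ≤ ∑ _j : Fin d, t :=
    Finset.sum_le_sum fun j _ => hcon j
  rw [Finset.sum_const, Finset.card_univ, Fintype.card_fin, nsmul_eq_mul] at hle
  linarith

lemma maxNoise_nonneg (M : SparseGraphonModel P p) (kind : Fin d → CompositeCovariate p)
    (n m : ℕ) (ω : Ω) : 0 ≤ M.maxNoise kind n m ω :=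
  NNReal.coe_nonneg _

/-- A union bound over the `m` nodes and the `d` coordinates turns the tail bounds for single
covariates into a rate for the maximal noise that is negligible compared to `m ^ (-1 / 2)`. -/
lemma exists_rate_maxNoise [IsProbabilityMeasure P] (M : SparseGraphonModel P p)
    (kind : Fin d → CompositeCovariate p) (hd : 0 < d) {c C : ℝ} (hc : 0 < c)
    (hcC : c ≤ C) (hw : ∀ᵐ z ∂(volume : Measure (unitInterval × unitInterval)),
      c ≤ M.w z.1 z.2 ∧ M.w z.1 z.2 ≤ C) (hX : MemLp (M.X 0) 4 P)
    {m : ℕ → ℕ} (hm : Tendsto m atTop atTop) (hsize : ∀ j, M.SizeCondition m (kind j)) :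
    ∃ a : ℕ → ℝ, (∀ n, 0 < a n) ∧ Tendsto a atTop (𝓝 0) ∧
      IsBigOInProbability P (fun n => M.maxNoise kind n (m n)) a ∧
      a =o[atTop] fun n => (m n : ℝ) ^ (-(1 / 2) : ℝ) := by
  have hlam := (hsize ⟨0, hd⟩).tendsto_lam hm
  have hmR : Tendsto (fun n => (m n : ℝ)) atTop atTop := tendsto_natCast_atTop_atTop.comp hm
  have hm1 : ∀ᶠ n in atTop, (1 : ℝ) ≤ m n := hmR.eventually_ge_atTop 1
  set R : ℕ → ℝ := fun n => ∑ j, M.noiseRate (kind j) n with hR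
  have hR0 : ∀ n, 0 ≤ R n := fun n => Finset.sum_nonneg fun j _ => M.noiseRate_nonneg _ n
  have hRt : Tendsto (fun n => (m n : ℝ) ^ 2 * R n) atTop (𝓝 0) := by
    have := tendsto_finsetSum Finset.univ fun j _ => (hsize j).tendsto_noiseRate
    simp only [Finset.sum_const_zero, ← Finset.mul_sum] at this
    exact this
  have hRt' : Tendsto (fun n => (m n : ℝ) * R n) atTop (𝓝 0) := by
    refine squeeze_zero' (Eventually.of_forall fun n => mul_nonneg (by positivity) (hR0 n)) ?_ hRt
    filter_upwards [hm1] with n hn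
    refine mul_le_mul_of_nonneg_right ?_ (hR0 n)
    rw [sq]
    exact le_mul_of_one_le_left (by positivity) hn
  have hinv : Tendsto (fun n => 1 / ((m n : ℝ) + 1)) atTop (𝓝 0) :=
    tendsto_one_div_add_atTop_nhds_zero_nat.comp hm
  -- The second summand makes `a` positive and is itself `o (m ^ (-1 / 2))`.
  set a : ℕ → ℝ := fun n => Real.sqrt (m n * R n) + 1 / ((m n : ℝ) + 1) with ha
  have ha_pos : ∀ n, 0 < a n := fun n => by simp only [ha]; positivity
  have ha0 : Tendsto a atTop (𝓝 0) := by
    have h1 := (Real.continuous_sqrt.tendsto 0).comp hRt'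
    rw [Real.sqrt_zero] at h1
    have h2 := h1.add hinv
    rw [add_zero] at h2
    exact h2
  have ha_sq : ∀ n, m n * R n ≤ a n ^ 2 := fun n => by
    have h0 : 0 ≤ (m n : ℝ) * R n := mul_nonneg (by positivity) (hR0 n)
    have h1 : Real.sqrt (m n * R n) ≤ a n := by
      simp only [ha]
      have : 0 < 1 / ((m n : ℝ) + 1) := by positivity
      linarith
    calc _ = Real.sqrt (m n * R n) ^ 2 := (Real.sq_sqrt h0).symm
      _ ≤ _ := pow_le_pow_left₀ (Real.sqrt_nonneg _) h1 2
  refine ⟨a, ha_pos, ha0, ?_, ?_⟩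
  · choose K hK t₀ ht₀ htail using fun j => M.exists_tail_covariate hc hcC hw hX hlam (kind j)
    intro ε hε
    set Ks := ∑ j, K j with hKs
    have hKle : ∀ j, K j ≤ Ks := fun j =>
      Finset.single_le_sum (fun j _ => (hK j).le) (Finset.mem_univ j)
    have hKs0 : 0 < Ks := (hK ⟨0, hd⟩).trans_le (hKle _)
    -- `s ≥ 1` and `s ≥ Ks / ε` give `Ks / s ^ 2 ≤ ε`.
    set s := 1 + Ks / ε with hs
    have hs1 : 1 ≤ s := by rw [hs]; linarith [div_pos hKs0 hε]
    have hsK : Ks / s ^ 2 ≤ ε := by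
      rw [div_le_iff₀ (by positivity)]
      have h1 : Ks ≤ ε * s := by rw [hs, mul_add, mul_div_cancel₀ _ hε.ne']; linarith
      nlinarith
    refine ⟨d * (Ks * s), ?_⟩
    have hsmall : ∀ᶠ n in atTop, ∀ j, s * a n ≤ t₀ j := by
      refine eventually_all.2 fun j => ?_
      have := ha0.const_mul s
      rw [mul_zero] at this
      exact (this.eventually_lt_const (ht₀ j)).mono fun n hn => hn.le
    have hmn : ∀ᶠ n in atTop, m n ≤ n := by
      filter_upwards [(hsize ⟨0, hd⟩).isLittleO_id.bound zero_lt_one] with n hn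
      simp only [one_mul, Real.norm_natCast] at hn
      exact_mod_cast hn
    filter_upwards [eventually_all.2 htail, hsmall, hmn] with n hn hsn hmn
    have hsa : 0 < s * a n := mul_pos (by linarith) (ha_pos n)
    have hsub : {ω | d * (Ks * s) * a n < |M.maxNoise kind n (m n) ω|} ⊆
        ⋃ i ∈ Finset.range (m n), ⋃ j ∈ (Finset.univ : Finset (Fin d)), {ω | K j * (s * a n) <
          |M.covariateHat n i ω (kind j) - M.latentCovariate (M.ξ i ω) (kind j)|} := by
      intro ω hω
      have hω' : d * (Ks * (s * a n)) < M.maxNoise kind n (m n) ω := by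
        have : d * (Ks * s) * a n < |M.maxNoise kind n (m n) ω| := hω
        rw [abs_of_nonneg (M.maxNoise_nonneg _ _ _ _)] at this
        linarith
      obtain ⟨i, hi, j, hij⟩ := M.exists_lt_of_lt_maxNoise kind n (m n) (by positivity) hω'
      simp only [Set.mem_iUnion]
      refine ⟨i, Finset.mem_range.2 hi, j, Finset.mem_univ j, ?_⟩
      exact (mul_le_mul_of_nonneg_right (hKle j) hsa.le).trans_lt hij
    have hbound : P.real {ω | d * (Ks * s) * a n < |M.maxNoise kind n (m n) ω|} ≤ ε := by
      calc _ ≤ _ := measureReal_mono hsub (measure_ne_top _ _)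
        _ ≤ ∑ i ∈ Finset.range (m n), ∑ j, P.real {ω | K j * (s * a n) <
            |M.covariateHat n i ω (kind j) - M.latentCovariate (M.ξ i ω) (kind j)|} :=
          (measureReal_biUnion_finset_le _ _).trans
            (Finset.sum_le_sum fun i _ => measureReal_biUnion_finset_le _ _)
        _ ≤ ∑ i ∈ Finset.range (m n), ∑ j, Ks * M.noiseRate (kind j) n / (s * a n) ^ 2 := by
          refine Finset.sum_le_sum fun i hi => Finset.sum_le_sum fun j _ => ?_
          refine (hn j i ((Finset.mem_range.1 hi).trans_le hmn) _ hsa (hsn j)).trans ?_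
          refine div_le_div_of_nonneg_right ?_ (by positivity)
          exact mul_le_mul_of_nonneg_right (hKle j) (M.noiseRate_nonneg _ _)
        _ = Ks / s ^ 2 * (m n * R n / a n ^ 2) := by
          rw [Finset.sum_const, Finset.card_range, nsmul_eq_mul, ← Finset.sum_div, ← Finset.mul_sum]
          have := (ha_pos n).ne'
          field_simp
          rfl
        _ ≤ Ks / s ^ 2 * 1 := by
          refine mul_le_mul_of_nonneg_left ?_ (by positivity)
          exact (div_le_one (pow_pos (ha_pos n) 2)).2 (ha_sq n)
        _ ≤ ε := by rwa [mul_one]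
    rw [measureReal_def] at hbound
    exact ENNReal.le_ofReal_iff_toReal_le (measure_ne_top _ _) hε.le |>.2 hbound
  · have hmpos : ∀ᶠ n in atTop, (0 : ℝ) < m n := hm1.mono fun n hn => by linarith
    refine isLittleO_of_tendsto' ?_ ?_
    · filter_upwards [hmpos] with n hn h0
      exact absurd h0 (Real.rpow_pos_of_pos hn _).ne'
    · have h1 : Tendsto (fun n => Real.sqrt ((m n : ℝ) ^ 2 * R n)) atTop (𝓝 0) := by
        have h1 := (Real.continuous_sqrt.tendsto 0).comp hRt
        rwa [Real.sqrt_zero] at h1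
      have h2 : Tendsto (fun n => 1 / Real.sqrt (m n : ℝ)) atTop (𝓝 0) := by
        simp only [one_div]
        exact tendsto_inv_atTop_zero.comp (Real.tendsto_sqrt_atTop.comp hmR)
      have h3 := h1.add h2
      rw [add_zero] at h3
      refine squeeze_zero' (Eventually.of_forall fun n => div_nonneg (ha_pos n).le
        (Real.rpow_nonneg (by positivity) _)) ?_ h3
      filter_upwards [hmpos] with n hn
      have hsq : Real.sqrt (m n : ℝ) * Real.sqrt (m n) = m n := Real.mul_self_sqrt hn.le
      have hs0 : 0 < Real.sqrt (m n : ℝ) := Real.sqrt_pos.2 hn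
      rw [Real.rpow_neg hn.le, ← Real.sqrt_eq_rpow, div_inv_eq_mul]
      simp only [ha]
      rw [add_mul]
      refine add_le_add (le_of_eq ?_) ?_
      · rw [← Real.sqrt_mul (mul_nonneg hn.le (hR0 n))]
        congr 1; ring
      · rw [div_mul_eq_mul_div, one_mul, div_le_div_iff₀ (by linarith) hs0, hsq]
        linarith

/-- The maximal noise is negligible at the scale `m ^ (-1 / 2)` of the central limit theorem. -/
lemma tendsto_sqrt_mul_maxNoise [IsProbabilityMeasure P] (M : SparseGraphonModel P p)
    (kind : Fin d → CompositeCovariate p) {m : ℕ → ℕ} (hm : Tendsto m atTop atTop) {a : ℕ → ℝ}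
    (hO : IsBigOInProbability P (fun n => M.maxNoise kind n (m n)) a)
    (ha : a =o[atTop] fun n => (m n : ℝ) ^ (-(1 / 2) : ℝ)) {ε : ℝ} (hε : 0 < ε) :
    Tendsto (fun n => P.real {ω | ε < Real.sqrt (m n) * M.maxNoise kind n (m n) ω}) atTop
      (𝓝 0) := by
  have hmR : Tendsto (fun n => (m n : ℝ)) atTop atTop := tendsto_natCast_atTop_atTop.comp hm
  rw [Metric.tendsto_nhds]
  intro δ hδ
  obtain ⟨K, hK⟩ := hO (δ / 2) (by positivity)
  have hb := ha.bound (c := ε / (|K| + 1)) (by positivity)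
  filter_upwards [hK, hb, hmR.eventually_gt_atTop 0] with n hn hbn hmn
  have hs0 : 0 < Real.sqrt (m n : ℝ) := Real.sqrt_pos.2 hmn
  have hbn' : Real.sqrt (m n) * |a n| ≤ ε / (|K| + 1) := by
    rw [Real.norm_eq_abs, Real.norm_eq_abs, Real.rpow_neg hmn.le, ← Real.sqrt_eq_rpow,
      abs_of_pos (inv_pos.2 hs0)] at hbn
    calc _ ≤ Real.sqrt (m n) * (ε / (|K| + 1) * (Real.sqrt (m n))⁻¹) := by gcongr
      _ = _ := by field_simp
  have hsub : {ω | ε < Real.sqrt (m n) * M.maxNoise kind n (m n) ω} ⊆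
      {ω | K * a n < |M.maxNoise kind n (m n) ω|} := by
    intro ω hω
    have hω' : ε < Real.sqrt (m n) * M.maxNoise kind n (m n) ω := hω
    change K * a n < |M.maxNoise kind n (m n) ω|
    rw [abs_of_nonneg (M.maxNoise_nonneg _ _ _ _)]
    have h1 : Real.sqrt (m n) * (K * a n) ≤ ε := by
      have h2 : K * a n ≤ (|K| + 1) * |a n| := by
        calc K * a n ≤ |K * a n| := le_abs_self _
          _ = |K| * |a n| := abs_mul _ _
          _ ≤ _ := by gcongr; linarith
      calc _ ≤ Real.sqrt (m n) * ((|K| + 1) * |a n|) := by gcongr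
        _ = (|K| + 1) * (Real.sqrt (m n) * |a n|) := by ring
        _ ≤ (|K| + 1) * (ε / (|K| + 1)) := by gcongr
        _ = ε := by field_simp
    exact lt_of_mul_lt_mul_left (h1.trans_lt hω') hs0.le
  rw [Real.dist_eq, sub_zero, abs_of_nonneg measureReal_nonneg]
  calc _ ≤ _ := measureReal_mono hsub (measure_ne_top _ _)
    _ ≤ δ / 2 := by
      rw [measureReal_def]
      exact ENNReal.toReal_le_of_le_ofReal (by positivity) hn
    _ < δ := by linarith

end

end SparseGraphonModel

/-! ### The multivariate central limit theorem and the delta method -/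

section

variable {Ω : Type*} [MeasurableSpace Ω] {P : Measure Ω} {ι κ : Type*} [Fintype ι] [Fintype κ]

lemma variance_dotProduct [IsProbabilityMeasure P] {U : Ω → κ → ℝ}
    (hU : ∀ a, MemLp (fun ω => U ω a) 2 P) (s : κ → ℝ) :
    Var[fun ω => s ⬝ᵥ U ω; P] =
      s ⬝ᵥ (Matrix.of fun a b => cov[fun ω => U ω a, fun ω => U ω b; P]) *ᵥ s := by
  have hs : ∀ a, MemLp (fun ω => s a * U ω a) 2 P := fun a => (hU a).const_mul _
  simp only [dotProduct, Matrix.mulVec, Matrix.of_apply]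
  rw [← covariance_self (memLp_finsetSum _ fun a _ => hs a).aestronglyMeasurable.aemeasurable,
    covariance_fun_sum_fun_sum hs hs]
  refine Finset.sum_congr rfl fun a _ => ?_
  rw [Finset.mul_sum]
  refine Finset.sum_congr rfl fun b _ => ?_
  rw [covariance_const_mul_left, covariance_const_mul_right]
  ring

lemma posSemidef_covariance [IsProbabilityMeasure P] {U : Ω → κ → ℝ}
    (hU : ∀ a, MemLp (fun ω => U ω a) 2 P) :
    (Matrix.of fun a b => cov[fun ω => U ω a, fun ω => U ω b; P]).PosSemidef := by
  refine Matrix.PosSemidef.of_dotProduct_mulVec_nonneg ?_ fun s => ?_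
  · ext a b
    simp [covariance_comm]
  · rw [star_trivial, ← variance_dotProduct hU]
    exact variance_nonneg _ _

lemma posSemidef_mul_covariance_mul_transpose [IsProbabilityMeasure P] {U : Ω → κ → ℝ}
    (hU : ∀ a, MemLp (fun ω => U ω a) 2 P) (A : Matrix ι κ ℝ) :
    (A * (Matrix.of fun a b => cov[fun ω => U ω a, fun ω => U ω b; P]) * Aᵀ).PosSemidef := by
  have h := (posSemidef_covariance hU).mul_mul_conjTranspose_same A
  rwa [Matrix.conjTranspose_eq_transpose_of_trivial] at h

/-- The central limit theorem for a linear image of an i.i.d. sequence of square integrable random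
vectors; by Lévy's theorem it suffices to apply the central limit theorem on the line to the linear
forms of the vectors. -/
lemma tendstoInDistribution_mulVec [DecidableEq ι] [IsProbabilityMeasure P] {U : ℕ → Ω → κ → ℝ}
    (hmeas : ∀ i, Measurable (U i)) (hindep : iIndepFun U P)
    (hident : ∀ i, IdentDistrib (U i) (U 0) P P) (hU : ∀ a, MemLp (fun ω => U 0 ω a) 2 P)
    (A : Matrix ι κ ℝ) :
    TendstoInDistribution
      (fun (n : ℕ) ω => WithLp.toLp 2
        (A *ᵥ ((√n)⁻¹ • (∑ k ∈ Finset.range n, U k ω - (n : ℝ) • fun a => ∫ ω, U 0 ω a ∂P))))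
      atTop id (fun _ => P) (multivariateGaussian 0
        (A * (Matrix.of fun a b => cov[fun ω => U 0 ω a, fun ω => U 0 ω b; P]) * Aᵀ)) := by
  have hS := posSemidef_mul_covariance_mul_transpose hU A
  set μ : κ → ℝ := fun a => ∫ ω, U 0 ω a ∂P with hμ
  have hmeas' : ∀ n : ℕ, Measurable fun ω => WithLp.toLp 2
      (A *ᵥ ((√n)⁻¹ • (∑ k ∈ Finset.range n, U k ω - (n : ℝ) • μ))) := by
    intro n
    refine (MeasurableEquiv.toLp 2 (ι → ℝ)).measurable.comp ?_
    refine (Continuous.matrix_mulVec continuous_const continuous_id).measurable.comp ?_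
    have h1 : Measurable fun ω => ∑ k ∈ Finset.range n, U k ω - (n : ℝ) • μ :=
      (Finset.measurable_fun_sum _ fun k _ => hmeas k).sub_const _
    exact h1.const_smul (√(n : ℝ))⁻¹
  refine ⟨fun n => (hmeas' n).aemeasurable, aemeasurable_id, ?_⟩
  refine ProbabilityMeasure.tendsto_iff_tendsto_charFun.2 fun t => ?_
  set s : κ → ℝ := (t : ι → ℝ) ᵥ* A with hs
  set x : ℕ → Ω → ℝ := fun k ω => s ⬝ᵥ U k ω with hx
  have hdot : Measurable fun u : κ → ℝ => s ⬝ᵥ u :=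
    (Continuous.dotProduct continuous_const continuous_id).measurable
  have hxL : MemLp (x 0) 2 P := memLp_finsetSum _ fun a _ => (hU a).const_mul _
  have hxi : iIndepFun x P := hindep.comp (fun _ u => s ⬝ᵥ u) fun _ => hdot
  have hxd : ∀ i, IdentDistrib (x i) (x 0) P P := fun i => (hident i).comp hdot
  have hmean : P[x 0] = s ⬝ᵥ μ := by
    simp only [hx, dotProduct, hμ]
    rw [integral_finsetSum _ fun a _ => ((hU a).integrable one_le_two).const_mul _]
    simp only [integral_const_mul]
  have hclt := (tendstoInDistribution_inv_sqrt_mul_sum_sub (Y := id)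
    (P' := gaussianReal 0 Var[x 0; P].toNNReal) HasLaw.id hxL hxi hxd).tendsto
  have h1 := ProbabilityMeasure.tendsto_iff_tendsto_charFun.1 hclt 1
  have hvar : Var[x 0; P] = t.ofLp ⬝ᵥ
      (A * (Matrix.of fun a b => cov[fun ω => U 0 ω a, fun ω => U 0 ω b; P]) * Aᵀ) *ᵥ t.ofLp := by
    rw [hx, variance_dotProduct hU, hs, ← Matrix.mulVec_mulVec, ← Matrix.mulVec_mulVec,
      Matrix.mulVec_transpose, Matrix.dotProduct_mulVec t.ofLp A]
  have hlim : charFun (gaussianReal 0 Var[x 0; P].toNNReal) 1 = charFun (multivariateGaussian 0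
      (A * (Matrix.of fun a b => cov[fun ω => U 0 ω a, fun ω => U 0 ω b; P]) * Aᵀ)) t := by
    rw [charFun_gaussianReal, charFun_multivariateGaussian hS, ← hvar,
      Real.coe_toNNReal _ (variance_nonneg _ _)]
    simp
  simp only [ProbabilityMeasure.coe_mk, Measure.map_id] at h1 ⊢
  rw [hlim] at h1
  refine h1.congr fun n => ?_
  have hxm : Measurable fun ω => (√(n : ℝ))⁻¹ * (∑ k ∈ Finset.range n, x k ω - n * P[x 0]) :=
    ((Finset.measurable_fun_sum _ fun k _ => hdot.comp (hmeas k)).sub_const _).const_mul _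
  rw [charFun_apply, charFun_apply, integral_map hxm.aemeasurable (by fun_prop),
    integral_map (hmeas' n).aemeasurable (by fun_prop)]
  refine integral_congr_ae (Eventually.of_forall fun ω => ?_)
  have hinner : inner ℝ (WithLp.toLp 2
      (A *ᵥ ((√(n : ℝ))⁻¹ • (∑ k ∈ Finset.range n, U k ω - (n : ℝ) • μ)))) t =
      (√(n : ℝ))⁻¹ * (∑ k ∈ Finset.range n, x k ω - n * P[x 0]) := by
    rw [EuclideanSpace.inner_eq_star_dotProduct, star_trivial, Matrix.dotProduct_mulVec, ← hs,
      dotProduct_smul, dotProduct_sub, dotProduct_sum, dotProduct_smul, hmean]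
    rfl
  simp only [hinner]
  simp

/-- The sums of an i.i.d. sequence of square integrable random vectors are stochastically bounded at
the scale of the central limit theorem. -/
lemma exists_measureReal_lt_norm_sum_le [IsProbabilityMeasure P] {U : ℕ → Ω → κ → ℝ}
    (hindep : iIndepFun U P) (hident : ∀ i, IdentDistrib (U i) (U 0) P P)
    (hU : ∀ a, MemLp (fun ω => U 0 ω a) 2 P) {δ : ℝ} (hδ : 0 < δ) :
    ∃ B, ∀ n : ℕ, P.real {ω | B < ‖(√(n : ℝ))⁻¹ •
      (∑ k ∈ Finset.range n, U k ω - (n : ℝ) • fun a => ∫ ω, U 0 ω a ∂P)‖} ≤ δ := by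
  set v := ∑ a, Var[fun ω => U 0 ω a; P] with hv
  have hv0 : 0 ≤ v := Finset.sum_nonneg fun a _ => variance_nonneg _ _
  -- Chebyshev gives the bound `v / B ^ 2`, which is at most `δ` as `B ≥ 1` and `B ≥ v / δ`.
  refine ⟨1 + v / δ, fun n => ?_⟩
  set B := 1 + v / δ with hB
  have hB1 : 1 ≤ B := by rw [hB]; linarith [div_nonneg hv0 hδ.le]
  have hvB : v / B ^ 2 ≤ δ := by
    rw [div_le_iff₀ (by positivity)]
    have h1 : v ≤ δ * B := by rw [hB, mul_add, mul_div_cancel₀ _ hδ.ne']; linarith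
    nlinarith
  have hUd : ∀ i a, IdentDistrib (fun ω => U i ω a) (fun ω => U 0 ω a) P P := fun i a =>
    (hident i).comp (measurable_pi_apply a)
  have hUi : ∀ i a, MemLp (fun ω => U i ω a) 2 P := fun i a => (hUd i a).memLp_iff.2 (hU a)
  set S : κ → Ω → ℝ := fun a ω => (√(n : ℝ))⁻¹ * ∑ k ∈ Finset.range n, U k ω a with hS
  have hSL : ∀ a, MemLp (S a) 2 P := fun a =>
    (memLp_finsetSum _ fun k _ => hUi k a).const_mul _
  have hSm : ∀ a, P[S a] = (√(n : ℝ))⁻¹ * (n * ∫ ω, U 0 ω a ∂P) := by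
    intro a
    simp only [hS]
    rw [integral_const_mul, integral_finsetSum _ fun k _ => (hUi k a).integrable one_le_two]
    congr 1
    rw [Finset.sum_congr rfl fun k _ => (hUd k a).integral_eq]
    simp
  have hSv : ∀ a, Var[S a; P] ≤ Var[fun ω => U 0 ω a; P] := by
    intro a
    have hpair : Set.Pairwise (Finset.range n : Set ℕ) fun i j =>
        (fun ω => U i ω a) ⟂ᵢ[P] (fun ω => U j ω a) := fun i _ j _ hij =>
      (hindep.indepFun hij).comp (measurable_pi_apply a) (measurable_pi_apply a)
    simp only [hS]
    rw [variance_const_mul]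
    have h1 := IndepFun.variance_sum (X := fun k ω => U k ω a) (s := Finset.range n)
      (fun k _ => hUi k a) hpair
    have h2 : Var[fun ω => ∑ k ∈ Finset.range n, U k ω a; P] = n * Var[fun ω => U 0 ω a; P] := by
      have h3 : (fun ω => ∑ k ∈ Finset.range n, U k ω a) =
          ∑ k ∈ Finset.range n, fun ω => U k ω a := by ext; simp
      rw [h3, h1, Finset.sum_congr rfl fun k _ => (hUd k a).variance_eq]
      simp
    rw [h2, inv_pow, Real.sq_sqrt (Nat.cast_nonneg n), ← mul_assoc]
    refine mul_le_of_le_one_left (variance_nonneg _ _) ?_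
    exact inv_mul_le_one
  have hsub : {ω | B < ‖(√(n : ℝ))⁻¹ •
      (∑ k ∈ Finset.range n, U k ω - (n : ℝ) • fun a => ∫ ω, U 0 ω a ∂P)‖} ⊆
      ⋃ a ∈ (Finset.univ : Finset κ), {ω | B ≤ |S a ω - P[S a]|} := by
    intro ω hω
    by_contra hcon
    simp only [Set.mem_iUnion, not_exists, Finset.mem_univ] at hcon
    have hω' : B < ‖(√(n : ℝ))⁻¹ •
      (∑ k ∈ Finset.range n, U k ω - (n : ℝ) • fun a => ∫ ω, U 0 ω a ∂P)‖ := hω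
    refine absurd hω' (not_lt.2 ((pi_norm_le_iff_of_nonneg (by linarith)).2 fun a => ?_))
    have h1 : ¬ B ≤ |S a ω - P[S a]| := fun h => hcon a trivial h
    rw [hSm] at h1
    refine le_trans (le_of_eq ?_) (not_le.1 h1).le
    simp only [hS, Pi.smul_apply, Pi.sub_apply, Finset.sum_apply, smul_eq_mul, Real.norm_eq_abs]
    rw [mul_sub]
  calc _ ≤ _ := measureReal_mono hsub (measure_ne_top _ _)
    _ ≤ ∑ a, P.real {ω | B ≤ |S a ω - P[S a]|} := measureReal_biUnion_finset_le _ _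
    _ ≤ ∑ a, Var[fun ω => U 0 ω a; P] / B ^ 2 := by
      refine Finset.sum_le_sum fun a _ => ?_
      have h1 := meas_ge_le_variance_div_sq (hSL a) (show 0 < B by linarith)
      refine le_trans ?_ (div_le_div_of_nonneg_right (hSv a) (by positivity))
      rw [measureReal_def]
      exact ENNReal.toReal_le_of_le_ofReal (div_nonneg (variance_nonneg _ _) (by positivity)) h1
    _ = v / B ^ 2 := by rw [hv, Finset.sum_div]
    _ ≤ δ := hvB

/-- The delta method for an estimator that is eventually, and close to the mean `θ` of the `U i`,
given by applying `f` to statistics `T n`, where `T n` approximates the average of `m n` of the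
`U i` better than the scale `m n ^ (-1 / 2)`. -/
lemma tendstoInDistribution_sqrt_smul_sub [DecidableEq ι] [DecidableEq κ] [IsProbabilityMeasure P]
    {U : ℕ → Ω → κ → ℝ}
    (hmeas : ∀ i, Measurable (U i)) (hindep : iIndepFun U P)
    (hident : ∀ i, IdentDistrib (U i) (U 0) P P) (hU : ∀ a, MemLp (fun ω => U 0 ω a) 2 P)
    {f : (κ → ℝ) → ι → ℝ} (hf : DifferentiableAt ℝ f fun a => ∫ ω, U 0 ω a ∂P)
    {m : ℕ → ℕ} (hm : Tendsto m atTop atTop) {T : ℕ → Ω → κ → ℝ}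
    (hT : ∀ ε > 0, Tendsto (fun n => P.real {ω | ε < √(m n : ℝ) *
      ‖T n ω - (m n : ℝ)⁻¹ • ∑ k ∈ Finset.range (m n), U k ω‖}) atTop (𝓝 0))
    {β : ℕ → Ω → EuclideanSpace ℝ ι} (hβm : ∀ n, AEMeasurable (β n) P) {r : ℝ} (hr : 0 < r)
    (hβ : ∀ᶠ n in atTop, ∀ᵐ ω ∂P, ‖T n ω - fun a => ∫ ω, U 0 ω a ∂P‖ < r →
      (β n ω).ofLp = f (T n ω))
    {b : EuclideanSpace ℝ ι} (hb : b.ofLp = f fun a => ∫ ω, U 0 ω a ∂P) :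
    TendstoInDistribution (fun n ω => √(m n : ℝ) • (β n ω - b)) atTop id (fun _ => P)
      (multivariateGaussian 0
        (LinearMap.toMatrix' (fderiv ℝ f fun a => ∫ ω, U 0 ω a ∂P).toLinearMap *
          (Matrix.of fun a b => cov[fun ω => U 0 ω a, fun ω => U 0 ω b; P]) *
          (LinearMap.toMatrix' (fderiv ℝ f fun a => ∫ ω, U 0 ω a ∂P).toLinearMap)ᵀ)) := by
  set θ : κ → ℝ := fun a => ∫ ω, U 0 ω a ∂P with hθ
  set D := fderiv ℝ f θ with hD
  have hclt := tendstoInDistribution_mulVec hmeas hindep hident hU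
    (LinearMap.toMatrix' D.toLinearMap)
  set W : ℕ → Ω → κ → ℝ := fun n ω =>
    (√(m n : ℝ))⁻¹ • (∑ k ∈ Finset.range (m n), U k ω - (m n : ℝ) • θ) with hW
  have hclt' : TendstoInDistribution (fun n ω => WithLp.toLp 2
      (LinearMap.toMatrix' D.toLinearMap *ᵥ W n ω)) atTop id (fun _ => P)
      (multivariateGaussian 0 (LinearMap.toMatrix' D.toLinearMap *
          (Matrix.of fun a b => cov[fun ω => U 0 ω a, fun ω => U 0 ω b; P]) *
          (LinearMap.toMatrix' D.toLinearMap)ᵀ)) :=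
    ⟨fun n => hclt.forall_aemeasurable (m n), hclt.aemeasurable_limit, hclt.tendsto.comp hm⟩
  refine tendstoInDistribution_of_tendstoInMeasure_sub _ _ hclt' ?_
    fun n => ((hβm n).sub_const b).const_smul (√(m n : ℝ))
  rw [tendstoInMeasure_iff_measureReal_norm]
  intro ε hε
  set q := ‖((EuclideanSpace.equiv ι ℝ).symm : (ι → ℝ) →L[ℝ] EuclideanSpace ℝ ι)‖ with hq
  have hq0 : 0 ≤ q := norm_nonneg _
  have hqle : ∀ v : ι → ℝ, ‖WithLp.toLp 2 v‖ ≤ q * ‖v‖ := fun v =>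
    ((EuclideanSpace.equiv ι ℝ).symm : (ι → ℝ) →L[ℝ] EuclideanSpace ℝ ι).le_opNorm v
  have hD0 : 0 ≤ ‖D‖ := norm_nonneg D
  rw [Metric.tendsto_nhds]
  intro δ hδ
  obtain ⟨B, hB⟩ := exists_measureReal_lt_norm_sum_le hindep hident hU (half_pos (half_pos hδ))
  -- Where `√m ‖T - average‖ ≤ e` and `‖W‖ ≤ B`, the linearization error is at most
  -- `q * (η * (e + |B|) + ‖D‖ * e)`, and these choices make it less than `ε`.
  set e := ε / (4 * (q * ‖D‖ + 1)) with he
  have he0 : 0 < e := by positivity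
  set η := ε / (4 * (q + 1) * (e + |B| + 1)) with hη
  have hη0 : 0 < η := by positivity
  obtain ⟨s, hs0, hs⟩ := Metric.eventually_nhds_iff.1
    (hf.hasFDerivAt.isLittleO.bound hη0)
  have hsqrt : Tendsto (fun n => √(m n : ℝ)) atTop atTop :=
    Real.tendsto_sqrt_atTop.comp (tendsto_natCast_atTop_atTop.comp hm)
  have hTe := (hT e he0).eventually_lt_const (half_pos hδ)
  filter_upwards [hβ, hTe, hsqrt.eventually_gt_atTop 0,
    hsqrt.eventually_gt_atTop ((e + |B|) / min s r)] with n hβn hTn hn0 hn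
  rw [Real.dist_eq, sub_zero, abs_of_nonneg measureReal_nonneg]
  have hmn : (0 : ℝ) < m n := Real.sqrt_pos.1 hn0
  have hsub : ({ω | ε ≤ ‖((fun n ω => √(m n : ℝ) • (β n ω - b)) - fun n ω => WithLp.toLp 2
      (LinearMap.toMatrix' D.toLinearMap *ᵥ W n ω)) n ω - (0 : Ω → EuclideanSpace ℝ ι) ω‖} : Set Ω)
      ≤ᵐ[P] ({ω | e < √(m n : ℝ) * ‖T n ω - (m n : ℝ)⁻¹ • ∑ k ∈ Finset.range (m n), U k ω‖} ∪
        {ω | B < ‖W n ω‖} : Set Ω) := by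
    filter_upwards [hβn] with ω hβω hω
    by_contra hcon
    have hcon' : ¬ (e < √(m n : ℝ) * ‖T n ω - (m n : ℝ)⁻¹ • ∑ k ∈ Finset.range (m n), U k ω‖ ∨
      B < ‖W n ω‖) := hcon
    rw [not_or, not_lt, not_lt] at hcon'
    obtain ⟨h1, h2⟩ := hcon'
    set V := T n ω - (m n : ℝ)⁻¹ • ∑ k ∈ Finset.range (m n), U k ω with hV
    have hdec : √(m n : ℝ) • (T n ω - θ) = √(m n : ℝ) • V + W n ω := by
      have hss : (√(m n : ℝ))⁻¹ = √(m n : ℝ) * (m n : ℝ)⁻¹ := by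
        rw [inv_eq_iff_eq_inv, mul_inv, inv_inv, inv_mul_eq_div, Real.div_sqrt]
      simp only [hW, hV, hss, mul_smul]
      rw [← smul_add]
      congr 1
      rw [smul_sub, inv_smul_smul₀ hmn.ne']
      abel
    have hnorm : √(m n : ℝ) * ‖T n ω - θ‖ ≤ e + |B| := by
      have h3 : √(m n : ℝ) * ‖T n ω - θ‖ = ‖√(m n : ℝ) • (T n ω - θ)‖ := by
        rw [norm_smul, Real.norm_of_nonneg hn0.le]
      rw [h3, hdec]
      refine (norm_add_le _ _).trans (add_le_add ?_ (h2.trans (le_abs_self B)))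
      rwa [norm_smul, Real.norm_of_nonneg hn0.le]
    have hclose : ‖T n ω - θ‖ < min s r := by
      rw [div_lt_iff₀ (lt_min hs0 hr)] at hn
      exact lt_of_mul_lt_mul_left (hnorm.trans_lt hn) hn0.le
    have hrem := hs (y := T n ω) (by rw [dist_eq_norm]; exact hclose.trans_le (min_le_left _ _))
    have hβe := hβω (hclose.trans_le (min_le_right _ _))
    have hident' : √(m n : ℝ) • (β n ω - b) - WithLp.toLp 2
        (LinearMap.toMatrix' D.toLinearMap *ᵥ W n ω) =
        WithLp.toLp 2 (√(m n : ℝ) • (f (T n ω) - f θ - D (T n ω - θ)) + √(m n : ℝ) • D V) := by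
      have h4 : LinearMap.toMatrix' D.toLinearMap *ᵥ W n ω = D (W n ω) :=
        LinearMap.toMatrix'_mulVec _ _
      have h5 : D (W n ω) = √(m n : ℝ) • D (T n ω - θ) - √(m n : ℝ) • D V := by
        rw [← map_smul, ← map_smul, ← map_sub, hdec, add_sub_cancel_left]
      apply WithLp.ofLp_injective
      rw [WithLp.ofLp_sub, WithLp.ofLp_smul, WithLp.ofLp_sub, hβe, hb, h4, h5]
      simp only [smul_sub]
      abel
    have hω' : ε ≤ ‖√(m n : ℝ) • (β n ω - b) - WithLp.toLp 2
        (LinearMap.toMatrix' D.toLinearMap *ᵥ W n ω) - 0‖ := hω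
    rw [sub_zero, hident'] at hω'
    have hA : ‖√(m n : ℝ) • (f (T n ω) - f θ - D (T n ω - θ))‖ ≤ η * (e + |B|) := by
      rw [norm_smul, Real.norm_of_nonneg hn0.le]
      calc _ ≤ √(m n : ℝ) * (η * ‖T n ω - θ‖) := by gcongr
        _ = η * (√(m n : ℝ) * ‖T n ω - θ‖) := by ring
        _ ≤ _ := by gcongr
    have hB' : ‖√(m n : ℝ) • D V‖ ≤ ‖D‖ * e := by
      rw [norm_smul, Real.norm_of_nonneg hn0.le]
      calc _ ≤ √(m n : ℝ) * (‖D‖ * ‖V‖) := by gcongr; exact D.le_opNorm V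
        _ = ‖D‖ * (√(m n : ℝ) * ‖V‖) := by ring
        _ ≤ _ := by gcongr
    have hfin : q * (η * (e + |B|) + ‖D‖ * e) < ε := by
      have h6 : q * η * (e + |B|) ≤ ε / 4 := by
        have : q * η * (e + |B|) ≤ (q + 1) * η * (e + |B| + 1) :=
          mul_le_mul (mul_le_mul_of_nonneg_right (by linarith) hη0.le) (by linarith)
            (by positivity) (by positivity)
        refine this.trans (le_of_eq ?_)
        rw [hη]; field_simp
      have h7 : q * ‖D‖ * e ≤ ε / 4 := by
        have : q * ‖D‖ * e ≤ (q * ‖D‖ + 1) * e := by gcongr; linarith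
        refine this.trans (le_of_eq ?_)
        rw [he]; field_simp
      nlinarith
    have := (hω'.trans (hqle _)).trans (mul_le_mul_of_nonneg_left
      ((norm_add_le _ _).trans (add_le_add hA hB')) hq0)
    linarith
  calc _ ≤ _ := ENNReal.toReal_mono (measure_ne_top _ _) (measure_mono_ae hsub)
    _ ≤ _ := measureReal_union_le _ _
    _ < δ := by
      have := hB (m n)
      simp only [hW]
      linarith

end

/-! ### Least squares as a smooth functional of second moments -/

section LeastSquares

variable {ι : Type*} [Fintype ι]

lemma differentiableAt_det [DecidableEq ι] {E : Type*} [NormedAddCommGroup E] [NormedSpace ℝ E]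
    {A : E → Matrix ι ι ℝ} {v : E} (hA : ∀ i j, DifferentiableAt ℝ (fun u => A u i j) v) :
    DifferentiableAt ℝ (fun u => (A u).det) v := by
  simp only [Matrix.det_apply']
  exact DifferentiableAt.fun_sum fun σ _ => (HasFDerivAt.finsetProd (u := Finset.univ)
    (g := fun i u => A u (σ i) i) fun i _ => (hA (σ i) i).hasFDerivAt).differentiableAt.const_mul _

lemma differentiableAt_olsFunctional [DecidableEq ι] {v : (ι × ι) ⊕ ι → ℝ}
    (hv : (Matrix.of fun a b => v (Sum.inl (a, b))).det ≠ 0) :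
    DifferentiableAt ℝ (olsFunctional ι) v := by
  have hcoord : ∀ a, DifferentiableAt ℝ (fun u : (ι × ι) ⊕ ι → ℝ => u a) v := fun a =>
    differentiableAt_apply (𝕜 := ℝ) a v
  have hdet : DifferentiableAt ℝ (fun u : (ι × ι) ⊕ ι → ℝ =>
      (Matrix.of fun a b => u (Sum.inl (a, b))).det) v :=
    differentiableAt_det fun i j => hcoord _
  have hadj : ∀ i j, DifferentiableAt ℝ (fun u : (ι × ι) ⊕ ι → ℝ =>
      (Matrix.of fun a b => u (Sum.inl (a, b))).adjugate i j) v := by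
    intro i j
    simp only [Matrix.adjugate_apply]
    refine differentiableAt_det fun k l => ?_
    by_cases hk : k = j
    · subst hk
      simp
    · simp only [Matrix.updateRow_ne hk, Matrix.of_apply]
      exact hcoord _
  refine differentiableAt_pi.2 fun a => ?_
  simp only [olsFunctional, Matrix.inv_def, Ring.inverse_eq_inv', Matrix.mulVec, dotProduct,
    Matrix.smul_apply, smul_eq_mul]
  exact DifferentiableAt.fun_sum fun b _ => ((hdet.inv hv).mul (hadj a b)).mul (hcoord _)

lemma eventually_det_ne_zero [DecidableEq ι] {v : (ι × ι) ⊕ ι → ℝ}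
    (hv : (Matrix.of fun a b => v (Sum.inl (a, b))).det ≠ 0) :
    ∀ᶠ u in 𝓝 v, (Matrix.of fun a b => u (Sum.inl (a, b))).det ≠ 0 := by
  have hdet : DifferentiableAt ℝ (fun u : (ι × ι) ⊕ ι → ℝ =>
      (Matrix.of fun a b => u (Sum.inl (a, b))).det) v :=
    differentiableAt_det fun i j => differentiableAt_apply (𝕜 := ℝ) (Sum.inl (i, j)) v
  exact hdet.continuousAt.eventually_ne hv

/-- The normal equations with an invertible design matrix determine the least squares
coefficients. -/
lemma eq_olsFunctional [DecidableEq ι] {v : (ι × ι) ⊕ ι → ℝ} {b : ι → ℝ}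
    (hv : (Matrix.of fun a b => v (Sum.inl (a, b))).det ≠ 0)
    (hb : ∀ a, v (Sum.inr a) = ∑ c, v (Sum.inl (a, c)) * b c) : b = olsFunctional ι v := by
  have h1 : (fun a => v (Sum.inr a)) = (Matrix.of fun a b => v (Sum.inl (a, b))) *ᵥ b :=
    funext hb
  rw [olsFunctional, h1, Matrix.mulVec_mulVec, Matrix.nonsing_inv_mul _ (isUnit_iff_ne_zero.2 hv),
    Matrix.one_mulVec]

/-- A quadratic polynomial that is minimal at `0` has no linear term. -/
lemma eq_zero_of_forall_le_quadratic {r g q : ℝ} (h : ∀ t : ℝ, r ≤ r - 2 * t * g + t ^ 2 * q) :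
    g = 0 := by
  by_contra hg
  have hq : 0 < |q| + 1 := by positivity
  have h1 := h (g / (|q| + 1))
  have h2 : (g / (|q| + 1)) ^ 2 * q ≤ (g / (|q| + 1)) ^ 2 * (|q| + 1) := by
    gcongr
    linarith [le_abs_self q]
  have h3 : (g / (|q| + 1)) ^ 2 * (|q| + 1) = g ^ 2 / (|q| + 1) := by
    field_simp
  have h4 : 2 * (g / (|q| + 1)) * g = 2 * (g ^ 2 / (|q| + 1)) := by ring
  have h5 : 0 < g ^ 2 / (|q| + 1) := by positivity
  linarith

/-- The vector `(vec (l lᵀ), y l)` of second moments of a response `y` and a design vector `l`. -/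
def momentVector (y : ℝ) (l : ι → ℝ) : (ι × ι) ⊕ ι → ℝ :=
  Sum.elim (fun ab => l ab.1 * l ab.2) fun a => l a * y

lemma norm_momentVector_sub_le (y : ℝ) {l l' : ι → ℝ} {δ : ℝ} (hδ : 0 ≤ δ)
    (h : ∀ a, |l' a - l a| ≤ δ) :
    ‖momentVector y l' - momentVector y l‖ ≤ δ * (2 * ∑ a, |l a| + |y| + δ) := by
  have hs : ∀ a, |l a| ≤ ∑ a, |l a| := fun a =>
    Finset.single_le_sum (f := fun a => |l a|) (fun a _ => abs_nonneg _) (Finset.mem_univ a)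
  have hs0 : 0 ≤ ∑ a, |l a| := Finset.sum_nonneg fun a _ => abs_nonneg _
  have hy := abs_nonneg y
  refine (pi_norm_le_iff_of_nonneg (by positivity)).2 ?_
  rintro (⟨a, b⟩ | a)
  · have h1 : l' a * l' b - l a * l b =
        (l' a - l a) * l b + l a * (l' b - l b) + (l' a - l a) * (l' b - l b) := by ring
    simp only [momentVector, Pi.sub_apply, Sum.elim_inl, Real.norm_eq_abs]
    rw [h1]
    refine (abs_add_three _ _ _).trans ?_
    rw [abs_mul, abs_mul, abs_mul]
    calc _ ≤ δ * (∑ a, |l a|) + (∑ a, |l a|) * δ + δ * δ := by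
          gcongr
          · exact h a
          · exact hs b
          · exact hs a
          · exact h b
          · exact h a
          · exact h b
      _ ≤ _ := by nlinarith
  · simp only [momentVector, Pi.sub_apply, Sum.elim_inr, Real.norm_eq_abs]
    rw [← sub_mul, abs_mul]
    calc _ ≤ δ * |y| := by gcongr; exact h a
      _ ≤ _ := by
        gcongr
        linarith

end LeastSquares

lemma inner_add_smul_single {ι : Type*} [Fintype ι] [DecidableEq ι] (b l : EuclideanSpace ℝ ι)
    (t : ℝ) (a : ι) : inner ℝ (b + t • EuclideanSpace.single a (1 : ℝ)) l =
      inner ℝ b l + t * l a := by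
  rw [inner_add_left, inner_smul_left, EuclideanSpace.inner_single_left]
  simp

lemma inner_eq_sum {ι : Type*} [Fintype ι] (b l : EuclideanSpace ℝ ι) :
    inner ℝ b l = ∑ c, l c * b c := by
  rw [PiLp.inner_apply]
  simp [mul_comm]

/-- The normal equations for the minimizers of an empirical risk. -/
lemma normalEquation_of_isMinOn_sum {ι : Type*} [Fintype ι] [DecidableEq ι] {m : ℕ} {y : ℕ → ℝ}
    {l : ℕ → EuclideanSpace ℝ ι} {b : EuclideanSpace ℝ ι}
    (hb : IsMinOn (fun b => (m : ℝ)⁻¹ * ∑ i ∈ Finset.range m, (y i - inner ℝ b (l i)) ^ 2)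
      Set.univ b) (a : ι) :
    ((m : ℝ)⁻¹ • ∑ i ∈ Finset.range m, momentVector (y i) (l i)) (Sum.inr a) =
      ∑ c, ((m : ℝ)⁻¹ • ∑ i ∈ Finset.range m, momentVector (y i) (l i)) (Sum.inl (a, c)) * b c := by
  have h1 : (m : ℝ)⁻¹ * ∑ i ∈ Finset.range m, (y i - inner ℝ b (l i)) * l i a = 0 := by
    refine eq_zero_of_forall_le_quadratic
      (r := (m : ℝ)⁻¹ * ∑ i ∈ Finset.range m, (y i - inner ℝ b (l i)) ^ 2)
      (q := (m : ℝ)⁻¹ * ∑ i ∈ Finset.range m, l i a ^ 2) fun t => ?_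
    have h2 := isMinOn_univ_iff.1 hb (b + t • EuclideanSpace.single a (1 : ℝ))
    refine h2.trans (le_of_eq ?_)
    rw [mul_left_comm (2 * t), mul_left_comm (t ^ 2), ← mul_sub, ← mul_add]
    congr 1
    rw [Finset.mul_sum, Finset.mul_sum, ← Finset.sum_sub_distrib, ← Finset.sum_add_distrib]
    refine Finset.sum_congr rfl fun i _ => ?_
    rw [inner_add_smul_single]
    ring
  have h2 : ∑ i ∈ Finset.range m, (y i - inner ℝ b (l i)) * l i a =
      ∑ i ∈ Finset.range m, l i a * y i -
        ∑ c, (∑ i ∈ Finset.range m, l i a * l i c) * b c := by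
    simp only [Finset.sum_mul]
    rw [Finset.sum_comm, ← Finset.sum_sub_distrib]
    refine Finset.sum_congr rfl fun i _ => ?_
    rw [inner_eq_sum, sub_mul, Finset.sum_mul, mul_comm (y i)]
    congr 1
    exact Finset.sum_congr rfl fun c _ => by ring
  rw [h2, mul_sub, sub_eq_zero] at h1
  simp only [Pi.smul_apply, Finset.sum_apply, momentVector, Sum.elim_inr, Sum.elim_inl, smul_eq_mul]
  rw [h1, Finset.mul_sum]
  exact Finset.sum_congr rfl fun c _ => by ring

/-- The normal equations for the minimizers of the mean squared error. -/
lemma normalEquation_of_isMinOn_integral {Ω : Type*} [MeasurableSpace Ω] {P : Measure Ω}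
    {ι : Type*} [Fintype ι] [DecidableEq ι] {y : Ω → ℝ} {l : Ω → EuclideanSpace ℝ ι}
    (hy : MemLp y 2 P) (hl : ∀ a, MemLp (fun ω => l ω a) 2 P) {b : EuclideanSpace ℝ ι}
    (hb : IsMinOn (fun b => ∫ ω, (y ω - inner ℝ b (l ω)) ^ 2 ∂P) Set.univ b) (a : ι) :
    ∫ ω, momentVector (y ω) (l ω) (Sum.inr a) ∂P =
      ∑ c, (∫ ω, momentVector (y ω) (l ω) (Sum.inl (a, c)) ∂P) * b c := by
  have hinner : MemLp (fun ω => inner ℝ b (l ω)) 2 P := by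
    simp only [inner_eq_sum]
    exact memLp_finsetSum _ fun c _ => (hl c).mul_const _
  have hres : MemLp (fun ω => y ω - inner ℝ b (l ω)) 2 P := hy.sub hinner
  have h1 : ∫ ω, (y ω - inner ℝ b (l ω)) * l ω a ∂P = 0 := by
    refine eq_zero_of_forall_le_quadratic (r := ∫ ω, (y ω - inner ℝ b (l ω)) ^ 2 ∂P)
      (q := ∫ ω, l ω a ^ 2 ∂P) fun t => ?_
    have h2 := isMinOn_univ_iff.1 hb (b + t • EuclideanSpace.single a (1 : ℝ))
    refine h2.trans (le_of_eq ?_)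
    have i1 : Integrable (fun ω => 2 * t * ((y ω - inner ℝ b (l ω)) * l ω a)) P :=
      (hres.integrable_mul (hl a)).const_mul _
    have i0 : Integrable (fun ω => (y ω - inner ℝ b (l ω)) ^ 2 -
        2 * t * ((y ω - inner ℝ b (l ω)) * l ω a)) P := hres.integrable_sq.sub i1
    have i2 : Integrable (fun ω => t ^ 2 * l ω a ^ 2) P := (hl a).integrable_sq.const_mul _
    rw [← integral_const_mul, ← integral_const_mul, ← integral_sub hres.integrable_sq i1,
      ← integral_add i0 i2]
    refine integral_congr_ae (Eventually.of_forall fun ω => ?_)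
    simp only [inner_add_smul_single]
    ring
  have h2 : ∫ ω, (y ω - inner ℝ b (l ω)) * l ω a ∂P =
      ∫ ω, l ω a * y ω ∂P - ∑ c, (∫ ω, l ω a * l ω c ∂P) * b c := by
    have i1 : Integrable (fun ω => l ω a * y ω) P := (hl a).integrable_mul hy
    have i2 : ∀ c, Integrable (fun ω => l ω a * l ω c * b c) P := fun c =>
      ((hl a).integrable_mul (hl c)).mul_const _
    simp only [← integral_mul_const]
    rw [← integral_finsetSum _ fun c _ => i2 c,
      ← integral_sub i1 (integrable_finsetSum _ fun c _ => i2 c)]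
    refine integral_congr_ae (Eventually.of_forall fun ω => ?_)
    simp only [inner_eq_sum]
    rw [sub_mul, Finset.sum_mul, mul_comm (y ω)]
    congr 1
    exact Finset.sum_congr rfl fun c _ => by ring
  rw [h2, sub_eq_zero] at h1
  exact h1

namespace SparseGraphonModel

/-! ### The down-sampled estimator -/

section

variable {Ω : Type*} [MeasurableSpace Ω] {P : Measure Ω} {p d : ℕ}

lemma abs_Lhat_sub_L_le_maxNoise (M : SparseGraphonModel P p) (kind : Fin d → CompositeCovariate p)
    (n : ℕ) {m i : ℕ} (hi : i < m) (ω : Ω) (a : Fin p ⊕ Fin d) :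
    |M.Lhat kind n i ω a - M.L kind i ω a| ≤ M.maxNoise kind n m ω := by
  rcases a with k | j
  · have : M.Lhat kind n i ω (Sum.inl k) - M.L kind i ω (Sum.inl k) = 0 := sub_self (M.X i ω k)
    rw [this, abs_zero]
    exact M.maxNoise_nonneg _ _ _ _
  · have h1 : ‖M.Zhat kind n i ω - M.Z kind i ω‖₊ ≤
        (Finset.range m).sup fun i => ‖M.Zhat kind n i ω - M.Z kind i ω‖₊ :=
      Finset.le_sup (f := fun i => ‖M.Zhat kind n i ω - M.Z kind i ω‖₊) (Finset.mem_range.2 hi)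
    have h2 : ‖M.Zhat kind n i ω - M.Z kind i ω‖ ≤ M.maxNoise kind n m ω := h1
    exact (PiLp.norm_apply_le (M.Zhat kind n i ω - M.Z kind i ω) j).trans h2

variable [IsProbabilityMeasure P]

lemma measurable_latentVector (M : SparseGraphonModel P p) (kind : Fin d → CompositeCovariate p) :
    Measurable fun t : ℝ × EuclideanSpace ℝ (Fin p) × unitInterval =>
      (WithLp.toLp 2 fun j => M.latentCovariate t.2.2 (kind j) : EuclideanSpace ℝ (Fin d)) := by
  refine (MeasurableEquiv.toLp 2 (Fin d → ℝ)).measurable.comp ?_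
  exact measurable_pi_iff.2 fun j =>
    (M.measurable_latentCovariate (kind j)).comp (measurable_snd.comp measurable_snd)

lemma iIndepFun_Z (M : SparseGraphonModel P p) (kind : Fin d → CompositeCovariate p) :
    iIndepFun (M.Z kind) P :=
  M.iIndepFun_triple.comp _ fun _ => M.measurable_latentVector kind

lemma identDistrib_Z (M : SparseGraphonModel P p) (kind : Fin d → CompositeCovariate p) (i : ℕ) :
    IdentDistrib (M.Z kind i) (M.Z kind 0) P P :=
  (M.identDistrib_triple i).comp (M.measurable_latentVector kind)

lemma measurable_designVector (M : SparseGraphonModel P p) (kind : Fin d → CompositeCovariate p)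
    (a : Fin p ⊕ Fin d) :
    Measurable fun t : ℝ × EuclideanSpace ℝ (Fin p) × unitInterval =>
      Sum.elim (fun k => t.2.1 k) (fun j => M.latentCovariate t.2.2 (kind j)) a := by
  rcases a with k | j
  · exact (EuclideanSpace.proj (𝕜 := ℝ) k).continuous.measurable.comp
      (measurable_fst.comp measurable_snd)
  · exact (M.measurable_latentCovariate (kind j)).comp (measurable_snd.comp measurable_snd)

lemma measurable_momentVector (M : SparseGraphonModel P p) (kind : Fin d → CompositeCovariate p) :
    Measurable fun t : ℝ × EuclideanSpace ℝ (Fin p) × unitInterval => momentVector t.1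
      (Sum.elim (fun k => t.2.1 k) fun j => M.latentCovariate t.2.2 (kind j)) := by
  refine measurable_pi_iff.2 ?_
  rintro (⟨a, b⟩ | a)
  · exact (M.measurable_designVector kind a).mul (M.measurable_designVector kind b)
  · exact (M.measurable_designVector kind a).mul measurable_fst

lemma identDistrib_momentVector (M : SparseGraphonModel P p) (kind : Fin d → CompositeCovariate p)
    (i : ℕ) : IdentDistrib (fun ω => momentVector (M.Y i ω) (M.L kind i ω))
      (fun ω => momentVector (M.Y 0 ω) (M.L kind 0 ω)) P P :=
  (M.identDistrib_triple i).comp (M.measurable_momentVector kind)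

lemma iIndepFun_momentVector (M : SparseGraphonModel P p)
    (kind : Fin d → CompositeCovariate p) :
    iIndepFun (fun i ω => momentVector (M.Y i ω) (M.L kind i ω)) P :=
  M.iIndepFun_triple.comp _ fun _ => M.measurable_momentVector kind

lemma memLp_L (M : SparseGraphonModel P p) (kind : Fin d → CompositeCovariate p) {c C : ℝ}
    (hc : 0 < c) (hw : ∀ᵐ z ∂(volume : Measure (unitInterval × unitInterval)),
      c ≤ M.w z.1 z.2 ∧ M.w z.1 z.2 ≤ C) (hX : MemLp (M.X 0) 4 P) (a : Fin p ⊕ Fin d) :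
    MemLp (fun ω => M.L kind 0 ω a) 4 P := by
  rcases a with k | j
  · exact M.memLp_coord hX k
  · obtain ⟨K, hK⟩ := M.exists_ae_abs_latentCovariate_le hc hw hX (kind j)
    refine MemLp.of_bound (((M.measurable_designVector kind (Sum.inr j)).comp
      (M.measurable_triple 0)).aestronglyMeasurable) K ?_
    exact M.ae_ξ_of_ae hK 0

lemma memLp_momentVector (M : SparseGraphonModel P p) (kind : Fin d → CompositeCovariate p)
    {c C : ℝ} (hc : 0 < c) (hw : ∀ᵐ z ∂(volume : Measure (unitInterval × unitInterval)),
      c ≤ M.w z.1 z.2 ∧ M.w z.1 z.2 ≤ C) (hY : MemLp (M.Y 0) 4 P) (hX : MemLp (M.X 0) 4 P)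
    (a : ((Fin p ⊕ Fin d) × (Fin p ⊕ Fin d)) ⊕ (Fin p ⊕ Fin d)) :
    MemLp (fun ω => momentVector (M.Y 0 ω) (M.L kind 0 ω) a) 2 P := by
  -- `1 / 4 + 1 / 4 = 1 / 2`
  have : ENNReal.HolderTriple 4 4 2 := ⟨by
    rw [← two_mul, show (4 : ENNReal) = 2 * 2 by norm_num,
      ENNReal.mul_inv (Or.inl two_ne_zero) (Or.inl ENNReal.ofNat_ne_top), ← mul_assoc,
      ENNReal.mul_inv_cancel two_ne_zero ENNReal.ofNat_ne_top, one_mul]⟩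
  have hL := M.memLp_L kind hc hw hX
  rcases a with ⟨a, b⟩ | a
  · exact (hL b).mul (hL a)
  · exact hY.mul (hL a)

/-- Replacing the noiseless by the observed network covariates changes the empirical second moments
by `o_P (m ^ (-1 / 2))`. -/
lemma tendsto_sqrt_mul_norm_momentVector_sub (M : SparseGraphonModel P p)
    (kind : Fin d → CompositeCovariate p) {c C : ℝ} (hc : 0 < c)
    (hw : ∀ᵐ z ∂(volume : Measure (unitInterval × unitInterval)),
      c ≤ M.w z.1 z.2 ∧ M.w z.1 z.2 ≤ C) (hY : MemLp (M.Y 0) 4 P) (hX : MemLp (M.X 0) 4 P)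
    {m : ℕ → ℕ} (hm : Tendsto m atTop atTop)
    (hnoise : ∀ ε > 0, Tendsto (fun n => P.real {ω | ε < √(m n : ℝ) * M.maxNoise kind n (m n) ω})
      atTop (𝓝 0)) {ε : ℝ} (hε : 0 < ε) :
    Tendsto (fun n => P.real {ω | ε < √(m n : ℝ) *
      ‖(m n : ℝ)⁻¹ • ∑ i ∈ Finset.range (m n), momentVector (M.Y i ω) (M.Lhat kind n i ω) -
        (m n : ℝ)⁻¹ • ∑ i ∈ Finset.range (m n), momentVector (M.Y i ω) (M.L kind i ω)‖})
      atTop (𝓝 0) := by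
  set g : ℝ × EuclideanSpace ℝ (Fin p) × unitInterval → ℝ := fun t =>
    2 * ∑ a, |Sum.elim (fun k => t.2.1 k) (fun j => M.latentCovariate t.2.2 (kind j)) a| + |t.1|
  have hg : Measurable g := ((Finset.measurable_fun_sum _ fun a _ =>
    (M.measurable_designVector kind a).norm).const_mul _).add measurable_fst.norm
  set G : ℕ → Ω → ℝ := fun i ω => 2 * ∑ a, |M.L kind i ω a| + |M.Y i ω| with hG
  have hGd : ∀ i, IdentDistrib (G i) (G 0) P P := fun i => (M.identDistrib_triple i).comp hg
  have hG0 : ∀ i ω, 0 ≤ G i ω := fun i ω => by simp only [hG]; positivity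
  have hGi0 : Integrable (G 0) P :=
    ((integrable_finsetSum _ fun a _ =>
      ((M.memLp_L kind hc hw hX a).integrable (by norm_num)).abs).const_mul _).add
      (hY.integrable (by norm_num)).abs
  have hGi : ∀ i, Integrable (G i) P := fun i => (hGd i).integrable_iff.2 hGi0
  have hmean0 : 0 ≤ P[G 0] := integral_nonneg (hG0 0)
  rw [Metric.tendsto_nhds]
  intro δ hδ
  -- By Markov's inequality the average of the `G i`, plus one, exceeds `B` with probability at
  -- most `δ / 2`; the bound `e ≤ 1` lets the term quadratic in the noise be absorbed.
  set B := 2 * (P[G 0] + 1) / δ with hB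
  have hB0 : 0 < B := by positivity
  set e := min 1 (ε / B) with he
  have he0 : 0 < e := lt_min one_pos (by positivity)
  filter_upwards [(hnoise e he0).eventually_lt_const (half_pos hδ), hm.eventually_gt_atTop 0]
    with n hn hmn
  rw [Real.dist_eq, sub_zero, abs_of_nonneg measureReal_nonneg]
  have hmn' : (1 : ℝ) ≤ m n := by exact_mod_cast hmn
  have hmpos : (0 : ℝ) < m n := by linarith
  set Gbar : Ω → ℝ := fun ω => (m n : ℝ)⁻¹ * ∑ i ∈ Finset.range (m n), G i ω + 1 with hGbar
  have hGsum : Integrable (fun ω => (m n : ℝ)⁻¹ * ∑ i ∈ Finset.range (m n), G i ω) P :=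
    (integrable_finsetSum _ fun i _ => hGi i).const_mul _
  have hGbi : Integrable Gbar P := hGsum.add (integrable_const 1)
  have hGb0 : ∀ ω, 0 ≤ Gbar ω := fun ω => by
    have := Finset.sum_nonneg fun i (_ : i ∈ Finset.range (m n)) => hG0 i ω
    simp only [hGbar]
    positivity
  have hGbm : P[Gbar] = P[G 0] + 1 := by
    simp only [hGbar]
    rw [integral_add hGsum (integrable_const 1), integral_const_mul,
      integral_finsetSum _ fun i _ => hGi i, Finset.sum_congr rfl fun i _ => (hGd i).integral_eq,
      Finset.sum_const, Finset.card_range, nsmul_eq_mul, inv_mul_cancel_left₀ hmpos.ne']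
    simp
  have hmarkov : P.real {ω | B ≤ Gbar ω} ≤ δ / 2 := by
    have h1 := mul_meas_ge_le_integral_of_nonneg (Eventually.of_forall hGb0) hGbi B
    rw [hGbm, mul_comm, ← le_div_iff₀ hB0] at h1
    refine h1.trans (le_of_eq ?_)
    rw [hB]
    field_simp
  have hsub : {ω | ε < √(m n : ℝ) *
      ‖(m n : ℝ)⁻¹ • ∑ i ∈ Finset.range (m n), momentVector (M.Y i ω) (M.Lhat kind n i ω) -
        (m n : ℝ)⁻¹ • ∑ i ∈ Finset.range (m n), momentVector (M.Y i ω) (M.L kind i ω)‖} ⊆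
      {ω | e < √(m n : ℝ) * M.maxNoise kind n (m n) ω} ∪ {ω | B ≤ Gbar ω} := by
    intro ω hω
    have hω' : ε < √(m n : ℝ) *
      ‖(m n : ℝ)⁻¹ • ∑ i ∈ Finset.range (m n), momentVector (M.Y i ω) (M.Lhat kind n i ω) -
        (m n : ℝ)⁻¹ • ∑ i ∈ Finset.range (m n), momentVector (M.Y i ω) (M.L kind i ω)‖ := hω
    by_contra hcon
    have hcon' : ¬ (e < √(m n : ℝ) * M.maxNoise kind n (m n) ω ∨ B ≤ Gbar ω) := hcon
    rw [not_or, not_lt, not_le] at hcon'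
    obtain ⟨h1, h2⟩ := hcon'
    set D := M.maxNoise kind n (m n) ω with hD
    have hD0 : 0 ≤ D := M.maxNoise_nonneg _ _ _ _
    have hD1 : D ≤ 1 := by
      have h3 : 1 ≤ √(m n : ℝ) := Real.one_le_sqrt.2 hmn'
      exact (le_mul_of_one_le_left hD0 h3).trans (h1.trans (min_le_left _ _))
    have h4 : ‖(m n : ℝ)⁻¹ • ∑ i ∈ Finset.range (m n),
        momentVector (M.Y i ω) (M.Lhat kind n i ω) -
        (m n : ℝ)⁻¹ • ∑ i ∈ Finset.range (m n), momentVector (M.Y i ω) (M.L kind i ω)‖ ≤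
        D * Gbar ω := by
      rw [← smul_sub, ← Finset.sum_sub_distrib, norm_smul, Real.norm_of_nonneg (by positivity)]
      calc _ ≤ (m n : ℝ)⁻¹ * ∑ i ∈ Finset.range (m n), D * (G i ω + 1) := by
            refine mul_le_mul_of_nonneg_left ?_ (by positivity)
            refine norm_sum_le_of_le _ fun i hi => ?_
            refine (norm_momentVector_sub_le _ hD0 fun a =>
              M.abs_Lhat_sub_L_le_maxNoise kind n (Finset.mem_range.1 hi) ω a).trans ?_
            exact mul_le_mul_of_nonneg_left (add_le_add_right hD1 _) hD0
        _ = D * Gbar ω := by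
          simp only [hGbar]
          rw [← Finset.mul_sum, Finset.sum_add_distrib, Finset.sum_const, Finset.card_range,
            nsmul_eq_mul]
          field_simp
    have h5 : √(m n : ℝ) * (D * Gbar ω) ≤ ε := by
      calc _ = (√(m n : ℝ) * D) * Gbar ω := by ring
        _ ≤ (ε / B) * B := mul_le_mul (h1.trans (min_le_right _ _)) h2.le (hGb0 ω) (by positivity)
        _ = ε := div_mul_cancel₀ _ hB0.ne'
    exact absurd (hω'.trans_le ((mul_le_mul_of_nonneg_left h4 (Real.sqrt_nonneg _)).trans h5))
      (lt_irrefl _)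
  calc _ ≤ _ := measureReal_mono hsub (measure_ne_top _ _)
    _ ≤ _ := measureReal_union_le _ _
    _ < δ := by linarith

/-- The asymptotic normality of the down-sampled least squares estimator: the delta method applied
to the least squares functional at the second moments `(Λ, γ)`. -/
lemma tendstoInDistribution_downSample (M : SparseGraphonModel P p)
    (kind : Fin d → CompositeCovariate p) {c C : ℝ} (hc : 0 < c)
    (hw : ∀ᵐ z ∂(volume : Measure (unitInterval × unitInterval)),
      c ≤ M.w z.1 z.2 ∧ M.w z.1 z.2 ≤ C) (hY : MemLp (M.Y 0) 4 P) (hX : MemLp (M.X 0) 4 P)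
    (hΛ : IsUnit (M.Lambda kind)) {m : ℕ → ℕ} (hm : Tendsto m atTop atTop)
    (hnoise : ∀ ε > 0, Tendsto (fun n => P.real {ω | ε < √(m n : ℝ) * M.maxNoise kind n (m n) ω})
      atTop (𝓝 0))
    {βstar : EuclideanSpace ℝ (Fin p ⊕ Fin d)}
    (hβstar : IsMinOn (M.populationRisk kind) Set.univ βstar)
    {βhat : ℕ → Ω → EuclideanSpace ℝ (Fin p ⊕ Fin d)} (hβhat_meas : ∀ n, AEMeasurable (βhat n) P)
    (hβhat : ∀ n, ∀ᵐ ω ∂P, IsMinOn (M.downSampleRisk kind n (m n) ω) Set.univ (βhat n ω)) :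
    TendstoInDistribution (fun n ω => √(m n : ℝ) • (βhat n ω - βstar)) atTop id
      (fun _ => P) (multivariateGaussian 0 (M.SigmaBeta kind)) := by
  set θ : ((Fin p ⊕ Fin d) × (Fin p ⊕ Fin d)) ⊕ (Fin p ⊕ Fin d) → ℝ := fun a =>
    ∫ ω, momentVector (M.Y 0 ω) (M.L kind 0 ω) a ∂P with hθ
  have hdet : (Matrix.of fun a b => θ (Sum.inl (a, b))).det ≠ 0 :=
    isUnit_iff_ne_zero.1 ((Matrix.isUnit_iff_isUnit_det _).1 hΛ)
  obtain ⟨r, hr, hrdet⟩ := Metric.eventually_nhds_iff.1 (eventually_det_ne_zero hdet)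
  have hL2 : ∀ a, MemLp (fun ω => M.L kind 0 ω a) 2 P := fun a =>
    (M.memLp_L kind hc hw hX a).mono_exponent (by norm_num)
  have hY2 : MemLp (M.Y 0) 2 P := hY.mono_exponent (by norm_num)
  refine tendstoInDistribution_sqrt_smul_sub
    (U := fun i ω => momentVector (M.Y i ω) (M.L kind i ω))
    (T := fun n ω => (m n : ℝ)⁻¹ •
      ∑ i ∈ Finset.range (m n), momentVector (M.Y i ω) (M.Lhat kind n i ω))
    (fun i => (M.measurable_momentVector kind).comp (M.measurable_triple i))
    (M.iIndepFun_momentVector kind) (M.identDistrib_momentVector kind)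
    (M.memLp_momentVector kind hc hw hY hX) (differentiableAt_olsFunctional hdet) hm
    (fun ε hε => M.tendsto_sqrt_mul_norm_momentVector_sub kind hc hw hY hX hm hnoise hε)
    hβhat_meas hr (Eventually.of_forall fun n => ?_)
    (eq_olsFunctional hdet fun a => normalEquation_of_isMinOn_integral hY2 hL2 hβstar a)
  filter_upwards [hβhat n] with ω hω hclose
  exact eq_olsFunctional (hrdet (by rwa [dist_eq_norm]))
    fun a => normalEquation_of_isMinOn_sum hω a

end

end SparseGraphonModel

end NetworkRegression

end

theorem proposition3 {Ω : Type*} [MeasurableSpace Ω] (P : Measure Ω) [IsProbabilityMeasure P]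
    (p d : ℕ) (hd : 0 < d)
    (M : NetworkRegression.SparseGraphonModel P p)
    (kind : Fin d → NetworkRegression.CompositeCovariate p)
    (c C : ℝ) (hc : 0 < c)
    (hw : ∀ᵐ z ∂(volume : Measure (unitInterval × unitInterval)),
      c ≤ M.w z.1 z.2 ∧ M.w z.1 z.2 ≤ C)
    (hY : MemLp (M.Y 0) 4 P) (hX : MemLp (M.X 0) 4 P)
    (hΛ : IsUnit (M.Lambda kind))
    (m : ℕ → ℕ) (hm : Tendsto m atTop atTop)
    (hsize : ∀ j, M.SizeCondition m (kind j))
    (βstar : EuclideanSpace ℝ (Fin p ⊕ Fin d))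
    (hβstar : IsMinOn (M.populationRisk kind) Set.univ βstar)
    (βhat : ℕ → Ω → EuclideanSpace ℝ (Fin p ⊕ Fin d))
    (hβhat_meas : ∀ n, AEMeasurable (βhat n) P)
    (hβhat : ∀ n, ∀ᵐ ω ∂P, IsMinOn (M.downSampleRisk kind n (m n) ω) Set.univ (βhat n ω)) :
    (iIndepFun (M.Z kind) P ∧ ∀ i, IdentDistrib (M.Z kind i) (M.Z kind 0) P P) ∧
    ((fun n => (m n : ℝ)) =o[atTop] fun n : ℕ => (n : ℝ)) ∧
    (∃ a : ℕ → ℝ, (∀ n, 0 < a n) ∧ Tendsto a atTop (𝓝 0) ∧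
      NetworkRegression.IsBigOInProbability P (fun n => M.maxNoise kind n (m n)) a ∧
      a =o[atTop] fun n => (m n : ℝ) ^ (-(1 / 2) : ℝ)) ∧
    (M.SigmaBeta kind).PosSemidef ∧
    TendstoInDistribution (fun n ω => Real.sqrt (m n) • (βhat n ω - βstar)) atTop id
      (fun _ => P) (multivariateGaussian 0 (M.SigmaBeta kind)) := by
  have hcC : c ≤ C := by
    obtain ⟨z, hz⟩ := hw.exists
    exact hz.1.trans hz.2
  obtain ⟨a, ha0, ha, hO, hao⟩ := M.exists_rate_maxNoise kind hd hc hcC hw hX hm hsize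
  exact ⟨⟨M.iIndepFun_Z kind, M.identDistrib_Z kind⟩, (hsize ⟨0, hd⟩).isLittleO_id,
    ⟨a, ha0, ha, hO, hao⟩,
    NetworkRegression.posSemidef_mul_covariance_mul_transpose
      (M.memLp_momentVector kind hc hw hY hX) _,
    M.tendstoInDistribution_downSample kind hc hw hY hX hΛ hm
      (fun _ hε => M.tendsto_sqrt_mul_maxNoise kind hm hO hao hε) hβstar hβhat_meas hβhat⟩
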